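/- Let $G=(V,E)$ be an infinite, connected, locally finite, vertex-transitive graph, let $d$ be its degree, and let $\lambda>0$. In activated random walk (ARW) on $G$ with sleeping rate $\lambda$, every active particle performs a continuous-time simple random walk of jump rate $1$, independently of the others, and carries a Poisson clock of rate $\lambda$; when the clock rings, the particle falls asleep if it is alone at its vertex, and nothing happens otherwise. A sleeping particle does not move, and becomes active when another particle jumps to its vertex. Initially all particles are active, and the numbers of particles at the vertices are i.i.d. with values in $\{0,1,2,\dots\}$ and finite mean $\mu$; let $\nu_0$ be the probability that a vertex is initially empty. The infinite system is the limit of the systems started from the particles in finite sets $S\uparrow V$. ARW fixates if every vertex is, from some time on, for ever empty or occupied by exactly one sleeping particle; ARW is active if it does not fixate. Fix a vertex $x$. For integers $n,L\ge 0$ let $B_L$ and $A_L$ be the ball and the sphere of radius $L$ about $x$ ($B_{-1}=\emptyset$). Let $(X(t))_{t\ge 0}$ be discrete-time simple random walk on $G$ with $X(0)=x$, and let $(Y(t))_{t\ge 0}$ be i.i.d., independent of $X$, with $P(Y(t)=1)=\frac{\lambda}{1+\lambda}$ and $P(Y(t)=0)=\frac{1}{1+\lambda}$. Put $$\tau_{V\setminus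 B_L}=\min\{t\ge 0: X(t)\notin B_L\},\quad \tau_x^+=\min\{t\ge 1: X(t)=x\},\quad \tau^{\mathrm k}_{B_{n-1}}=\min\{t\ge 1: X(t)\notin B_{n-1},\ Y(t)=1\},$$ and, for $0\le n\le L$, $$N_n^L=|\{t\ge 0: X(t)\in A_n,\ t<\tau_{V\setminus B_L}\wedge\tau_x^+\}|,\qquad \tilde N_n^L=|\{t\ge 0: X(t)\in A_n,\ t<\tau_{V\setminus B_L}\wedge\tau_x^+\wedge\tau^{\mathrm k}_{B_{n-1}}\}|,$$ $$M_L=\sum_{n=0}^L N_n^L,\qquad \tilde M_L=\sum_{n=0}^L\tilde N_n^L .$$ If $$\liminf_{L\to\infty}\frac{E[\tilde M_L]}{E[M_L]}>\frac{\nu_0}{\mu+\nu_0}\qquad\text{and}\qquad \lim_{L\to\infty}E[\tilde M_L]=\infty,$$ then ARW is active almost surely. -/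

import Mathlib

open MeasureTheory ProbabilityTheory Filter Topology
open scoped NNReal ENNReal

noncomputable section

namespace ARW

/-! ## States and instructions -/

/-- The state of a vertex: one sleeping particle, or `n` active particles
(`active 0` is the empty vertex). -/
inductive SiteState : Type
  | sleeping : SiteState
  | active (n : ℕ) : SiteState

/-- The number of active particles at a vertex. -/
def SiteState.numActive : SiteState → ℕ
  | .sleeping => 0
  | .active n => n

/-- A particle arrives: it is active, and a sleeping particle that is there wakes up. -/
def SiteState.arrive : SiteState → SiteState
  | .sleeping => .active 2
  | .active n => .active (n + 1)

/-- An active particle leaves. -/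
def SiteState.leave : SiteState → SiteState
  | .sleeping => .sleeping
  | .active n => .active (n - 1)

/-- An active particle tries to fall asleep: it succeeds only if it is alone. -/
def SiteState.tryToSleep : SiteState → SiteState
  | .active 1 => .sleeping
  | s => s

/-- What an active particle may be told to do: to sleep, or to jump to a vertex. -/
inductive Instr (V : Type*) : Type _
  | sleep : Instr V
  | jump (y : V) : Instr V

instance (V : Type*) : MeasurableSpace (Instr V) := ⊤

open Classical in
/-- The configuration after an active particle at `x` has followed an instruction. -/
def perform {V : Type*} (x : V) (η : V → SiteState) : Instr V → (V → SiteState)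
  | .sleep => Function.update η x (η x).tryToSleep
  | .jump y =>
      let η' := Function.update η x (η x).leave
      Function.update η' y (η' y).arrive

/-! ## The driving randomness -/

/-- The step of simple random walk from `x`: uniform on the neighbours of `x`. (The walk stays put
at a vertex without neighbours.) -/
def stepLaw {V : Type*} (G : SimpleGraph V) [G.LocallyFinite] (x : V) : PMF V :=
  if h : (G.neighborFinset x).Nonempty then PMF.uniformOfFinset (G.neighborFinset x) h
  else PMF.pure x

/-- `true` (a sleep mark) with probability `lam / (1 + lam)`, and `false` otherwise. -/
def markLaw (lam : ℝ≥0) : PMF Bool :=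
  PMF.ofFintype (fun b => ((if b then lam / (1 + lam) else 1 / (1 + lam) : ℝ≥0) : ℝ≥0∞)) <| by
    rw [Fintype.sum_bool, ← ENNReal.coe_add]
    norm_cast
    simp only [if_true, if_false]
    rw [← add_div, add_comm, div_self (by positivity)]

/-- The law of an instruction at `x`: sleep with probability `lam / (1 + lam)`, and otherwise a
jump to a uniformly random neighbour. -/
def instrLaw {V : Type*} (G : SimpleGraph V) [G.LocallyFinite] (lam : ℝ≥0) (x : V) :
    PMF (Instr V) :=
  (markLaw lam).bind fun b => if b then PMF.pure .sleep else (stepLaw G x).map .jump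

/-- The exponential law of rate `1 + lam`. -/
def clockLaw (lam : ℝ≥0) : Measure ℝ := expMeasure (1 + (lam : ℝ))

instance (lam : ℝ≥0) : IsProbabilityMeasure (clockLaw lam) :=
  isProbabilityMeasure_expMeasure (by positivity)

/-- The sample space: the initial number of (active) particles at each vertex; for each vertex `x`
and `j : ℕ`, the `j`-th instruction at `x`; and the `j`-th waiting time at `x`. -/
abbrev Sample (V : Type*) : Type _ :=
  (V → ℕ) × (V → ℕ → Instr V) × (V → ℕ → ℝ)

/-- The initial particle numbers are i.i.d. of law `ν`, the instructions and the waiting times are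
independent with laws `instrLaw` and `clockLaw`, and the three families are independent. -/
def law {V : Type*} (G : SimpleGraph V) [G.LocallyFinite] (lam : ℝ≥0) (ν : Measure ℕ)
    [IsProbabilityMeasure ν] : Measure (Sample V) :=
  (Measure.infinitePi fun _ : V => ν).prod
    ((Measure.infinitePi fun x : V => Measure.infinitePi fun _ : ℕ =>
        (instrLaw G lam x).toMeasure).prod
      (Measure.infinitePi fun _ : V => Measure.infinitePi fun _ : ℕ => clockLaw lam))

/-! ## Activated random walk in continuous time

Every active particle acts at rate `1 + lam`, and an action is an attempt to sleep with probability
`lam / (1 + lam)` and otherwise a jump to a uniformly random neighbour; that is, it jumps at rate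
`1` and tries to sleep at rate `lam`. So a vertex with `k` active particles acts at rate
`k * (1 + lam)`: it carries a clock, with independent exponential waiting times of rate `1 + lam`,
that runs at speed `k`. -/

/-- The data of the evolution just after an action: the configuration, the number of instructions
used at each vertex, the remaining waiting time on the clock of each vertex, and the time. -/
structure Stage (V : Type*) where
  config : V → SiteState
  used : V → ℕ
  clock : V → ℝ
  time : ℝ

open Classical in
/-- The start: only the particles in the finite set `S` are present. -/
def start {V : Type*} (ω : Sample V) (S : Finset V) : Stage V where
  config x := .active (if x ∈ S then ω.1 x else 0)
  used _ := 0
  clock x := ω.2.2 x 0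
  time := 0

/-- The clock at `x` is the next one to ring: `x` has active particles and, with each clock running
at the speed given by the number of active particles, none rings before that of `x`. -/
def Stage.RingsNext {V : Type*} (s : Stage V) (x : V) : Prop :=
  0 < (s.config x).numActive ∧ ∀ y, 0 < (s.config y).numActive →
    s.clock x / (s.config x).numActive ≤ s.clock y / (s.config y).numActive

open Classical in
/-- Proceed to the next ring of a clock. If there is no active particle left, nothing happens, and
one unit of time passes. -/
def Stage.next {V : Type*} (ω : Sample V) (s : Stage V) : Stage V :=
  if h : ∃ x, s.RingsNext x then
    let x := h.choose
    let δ := s.clock x / (s.config x).numActive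
    { config := perform x s.config (ω.2.1 x (s.used x))
      used := Function.update s.used x (s.used x + 1)
      clock := Function.update (fun y => s.clock y - (s.config y).numActive * δ) x
        (ω.2.2 x (s.used x + 1))
      time := s.time + δ }
  else { s with time := s.time + 1 }

/-- The evolution with finitely many particles after `k` rings. -/
def stage {V : Type*} (ω : Sample V) (S : Finset V) (k : ℕ) : Stage V :=
  (Stage.next ω)^[k] (start ω S)

/-- The configuration at time `t` of activated random walk on the whole graph, started from only
those particles that are initially in the finite set `S`. -/
def finiteProcess {V : Type*} (ω : Sample V) (S : Finset V) (t : ℝ) : V → SiteState :=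
  (stage ω S (sSup {k : ℕ | (stage ω S k).time ≤ t})).config

open Classical in
/-- Activated random walk started from all the particles: the state of `x` at time `t` is the
limit, as the finite set `S` grows to the whole vertex set, of that state in the evolution started
from the particles in `S`. (If there is no limit, `x` counts as empty.) -/
def process {V : Type*} (ω : Sample V) (t : ℝ) (x : V) : SiteState :=
  if h : ∃ s, ∀ᶠ S : Finset V in atTop, finiteProcess ω S t x = s then h.choose else .active 0

/-- Fixation: each vertex is eventually stable for ever, i.e. from some time on it is empty or
holds one particle that sleeps. -/
def Fixates {V : Type*} (ω : Sample V) : Prop :=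
  ∀ x, ∃ T : ℝ, ∀ t, T ≤ t → (process ω t x).numActive = 0

/-- The process is active if it does not fixate. -/
def IsActive {V : Type*} (ω : Sample V) : Prop := ¬ Fixates ω

/-! ## Simple random walk with sleep marks -/

/-- `X` is simple random walk started at `o`, and `Y` is an independent sequence of i.i.d. marks of
law `markLaw lam`: the joint law is given on cylinders. -/
structure IsMarkedWalk {V Ω : Type*} [MeasurableSpace Ω] (Q : Measure Ω) (G : SimpleGraph V)
    [G.LocallyFinite] (lam : ℝ≥0) (o : V) (X : ℕ → Ω → V) (Y : ℕ → Ω → Bool) : Prop where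
  measurableSet_walk : ∀ t v, MeasurableSet {ω | X t ω = v}
  measurableSet_mark : ∀ t b, MeasurableSet {ω | Y t ω = b}
  start_eq : ∀ᵐ ω ∂Q, X 0 ω = o
  cylinder : ∀ (n : ℕ) (p : ℕ → V) (b : ℕ → Bool), p 0 = o →
    Q {ω | ∀ t ≤ n, X t ω = p t ∧ Y t ω = b t} =
      (∏ t ∈ Finset.range n, stepLaw G (p t) (p (t + 1))) *
        ∏ t ∈ Finset.range (n + 1), markLaw lam (b t)

/-- The first time at which `p` holds (`⊤` if there is none). -/
def firstTime (p : ℕ → Prop) : ℕ∞ := ⨅ (t : ℕ) (_ : p t), (t : ℕ∞)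

/-- The first time at which the walk is outside the ball of radius `L` about `o`. -/
def exitTime {V : Type*} (G : SimpleGraph V) (o : V) (L : ℕ) (X : ℕ → V) : ℕ∞ :=
  firstTime fun t => L < G.dist o (X t)

/-- The first return time to `o`. -/
def returnTime {V : Type*} (o : V) (X : ℕ → V) : ℕ∞ :=
  firstTime fun t => 1 ≤ t ∧ X t = o

/-- The first time `t ≥ 1` at which the walk has a sleep mark while it is at distance at least `n`
from `o`, i.e. outside the ball of radius `n - 1` (which is empty for `n = 0`). -/
def killTime {V : Type*} (G : SimpleGraph V) (o : V) (n : ℕ) (X : ℕ → V) (Y : ℕ → Bool) : ℕ∞ :=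
  firstTime fun t => 1 ≤ t ∧ n ≤ G.dist o (X t) ∧ Y t = true

/-- The number of visits to the sphere of radius `n` about `o` before the time `T`. -/
def visits {V : Type*} (G : SimpleGraph V) (o : V) (n : ℕ) (X : ℕ → V) (T : ℕ∞) : ℕ∞ :=
  Set.encard {t : ℕ | G.dist o (X t) = n ∧ (t : ℕ∞) < T}

/-- `M_L`: visits to the spheres of radius `0, …, L` before the walk leaves the ball of radius `L`
or returns to `o`. -/
def totalVisits {V : Type*} (G : SimpleGraph V) (o : V) (L : ℕ) (X : ℕ → V) : ℕ∞ :=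
  ∑ n ∈ Finset.range (L + 1), visits G o n X (exitTime G o L X ⊓ returnTime o X)

/-- `M̃_L`: the same, but visits to the sphere of radius `n` are counted only until the walk is
killed outside the ball of radius `n - 1`. -/
def totalVisitsKilled {V : Type*} (G : SimpleGraph V) (o : V) (L : ℕ) (X : ℕ → V)
    (Y : ℕ → Bool) : ℕ∞ :=
  ∑ n ∈ Finset.range (L + 1),
    visits G o n X (exitTime G o L X ⊓ returnTime o X ⊓ killTime G o n X Y)

/-- `E[M_L]`. -/
def meanVisits {V Ω : Type*} [MeasurableSpace Ω] (Q : Measure Ω) (G : SimpleGraph V) (o : V)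
    (X : ℕ → Ω → V) (L : ℕ) : ℝ≥0∞ :=
  ∫⁻ ω, (totalVisits G o L (fun t => X t ω) : ℝ≥0∞) ∂Q

/-- `E[M̃_L]`. -/
def meanVisitsKilled {V Ω : Type*} [MeasurableSpace Ω] (Q : Measure Ω) (G : SimpleGraph V) (o : V)
    (X : ℕ → Ω → V) (Y : ℕ → Ω → Bool) (L : ℕ) : ℝ≥0∞ :=
  ∫⁻ ω, (totalVisitsKilled G o L (fun t => X t ω) (fun t => Y t ω) : ℝ≥0∞) ∂Q

end ARW

end

noncomputable section

open scoped Classical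

namespace ARW

/-! ## The graph and the instruction law -/

section Graph

variable {V : Type*} (G : SimpleGraph V) [G.LocallyFinite]

/-! Every vertex carries a stack of instructions and a clock. The proof has two halves: a toppling
strategy that brings arbitrarily many active particles to `o`, and a pathwise transfer from legal
topplings to the process in continuous time.

Strategy. Only the particles in the ball of radius `L` are used, those of the farthest vertices
first. A particle from distance `n` is toppled until it reaches `o`, leaves the ball, is told to
sleep at distance at least `n`, or enters an empty vertex at distance less than `n`. In the last
case it fills the hole and from then on counts as a particle of that vertex, whose turn is still to
come. At an occupied vertex nearer than `n` a sleep instruction is harmless, because the particle is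
not alone. Let `h y` be the probability that simple random walk from `y` hits `o` before leaving the
ball, and let `f y` be the same probability with killing by sleep marks at distance at least that of
`y`. Filling a hole at `z` costs a walking particle at most `h z` and leaves a particle worth `f z`.
Hence `E[(1 - c) ^ N]`, with `N` the final number of active particles at `o`, is at most a product
over the vertices: the factor is `(1 - c f) ^ k` for `k ≥ 1` initial particles and `(1 - c f) / (1 -
c h)` for a hole (`Bounded.walk`, `bounded_potential`). Averaging over the independent initial
numbers gives the exponential of an exponent that to first order in `c` is `-c ((μ + ν₀) ∑ f - ν₀ ∑
h)`. By reversibility `∑ h = E[M_L]` and `∑ f` is at least `E[M̃_L]`, up to an error from bounding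
the number of topplings. Under the two hypotheses the exponent therefore tends to `-∞` as `L → ∞`,
for a fixed small `c`, and `N` exceeds every bound for some `L` almost surely
(`measure_forall_reach_le`, `exists_rate_pos`, `ae_exists_reach`).

Transfer. The state of a vertex is a function of its initial number and of the numbers of
instructions used there and at its neighbours (`Reach.total_add`, `Reach.lastSleep`). The resulting
monotonicity gives a least action principle (`Reach.exists_le_used`) and shows that adding particles
never delays a clock (`progressAt_mono_set`). A Gronwall estimate for the mean numbers of
instructions used (`gronwall`) excludes explosion and, with a summable weight, is uniform in the
finite set of particles, so that the infinite system exists as a limit. If `o` had no active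
particle from some time on, its clock would be frozen in the limit, while the strategy forces it to
ring arbitrarily often (`isActive_of_reach`). -/

theorem finite_closedBall (hconn : G.Connected) (o : V) (n : ℕ) :
    {y | G.dist o y ≤ n}.Finite := by
  induction n with
  | zero =>
    refine (Set.finite_singleton o).subset fun y hy => ?_
    have : G.dist o y = 0 := Nat.le_zero.1 hy
    exact ((hconn.dist_eq_zero_iff).1 this).symm
  | succ n ih =>
    refine (ih.biUnion (t := fun z => insert z (G.neighborFinset z : Set V)) fun z _ =>
      (Finset.finite_toSet _).insert z).subset fun y hy => ?_
    obtain ⟨p, hp⟩ := hconn.exists_walk_length_eq_dist o y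
    simp only [Set.mem_iUnion, Set.mem_insert_iff, exists_prop]
    by_cases hn : G.dist o y ≤ n
    · exact ⟨y, hn, Or.inl rfl⟩
    have hlen : p.length = n + 1 := by
      have : G.dist o y ≤ n + 1 := hy
      omega
    refine ⟨p.getVert n, ?_, Or.inr ?_⟩
    · exact (SimpleGraph.dist_le (p.take n)).trans (by simp [SimpleGraph.Walk.take_length])
    · have h := p.adj_getVert_succ (i := n) (by omega)
      rw [← hlen, SimpleGraph.Walk.getVert_length] at h
      simpa using h

theorem countable_of_connected (hconn : G.Connected) : Countable V := by
  obtain ⟨o⟩ := hconn.nonempty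
  have : (⋃ n : ℕ, {y | G.dist o y ≤ n}) = Set.univ :=
    Set.eq_univ_of_forall fun y => Set.mem_iUnion.2 ⟨G.dist o y, le_refl (G.dist o y)⟩
  rw [← Set.countable_univ_iff, ← this]
  exact Set.countable_iUnion fun n => (finite_closedBall G hconn o n).countable

/-- The ball of radius `L` about `o` as a finset. -/
def ball (hconn : G.Connected) (o : V) (L : ℕ) : Finset V := (finite_closedBall G hconn o L).toFinset

@[simp] theorem mem_ball {hconn : G.Connected} {o y : V} {L : ℕ} :
    y ∈ ball G hconn o L ↔ G.dist o y ≤ L := by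
  simp [ball]

theorem degree_eq_of_transitive (htrans : ∀ u v : V, ∃ φ : G ≃g G, φ u = v) (u v : V) :
    G.degree u = G.degree v := by
  obtain ⟨φ, rfl⟩ := htrans u v
  exact (φ.degree_eq u).symm

theorem degree_pos_of_connected [Infinite V] (hconn : G.Connected) (u : V) : 0 < G.degree u :=
  hconn.preconnected.degree_pos_of_nontrivial u

theorem stepLaw_apply {x : V} (hx : 0 < G.degree x) (y : V) :
    stepLaw G x y = if G.Adj x y then (G.degree x : ℝ≥0∞)⁻¹ else 0 := by
  have h : (G.neighborFinset x).Nonempty := by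
    rwa [← Finset.card_pos, SimpleGraph.card_neighborFinset_eq_degree]
  rw [stepLaw, dif_pos h, PMF.uniformOfFinset_apply]
  simp

theorem markLaw_apply (lam : ℝ≥0) (b : Bool) :
    markLaw lam b = ((if b then lam / (1 + lam) else 1 / (1 + lam) : ℝ≥0) : ℝ≥0∞) := rfl

theorem lintegral_instrLaw {lam : ℝ≥0} {x : V} (hx : 0 < G.degree x) (β : Instr V → ℝ≥0∞) :
    ∫⁻ i, β i ∂(instrLaw G lam x).toMeasure =
      ((lam / (1 + lam) : ℝ≥0) : ℝ≥0∞) * β .sleep +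
        ((1 / (1 + lam) : ℝ≥0) : ℝ≥0∞) *
          ∑ y ∈ G.neighborFinset x, (G.degree x : ℝ≥0∞)⁻¹ * β (.jump y) := by
  have h : (G.neighborFinset x).Nonempty := by
    rwa [← Finset.card_pos, SimpleGraph.card_neighborFinset_eq_degree]
  have e : (instrLaw G lam x).toMeasure =
      ((lam / (1 + lam) : ℝ≥0) : ℝ≥0∞) • Measure.dirac (Instr.sleep : Instr V) +
        ((1 / (1 + lam) : ℝ≥0) : ℝ≥0∞) • ∑ y ∈ G.neighborFinset x,
          (G.degree x : ℝ≥0∞)⁻¹ • Measure.dirac (Instr.jump y) := by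
    ext s hs
    rw [PMF.toMeasure_apply_eq_tsum, instrLaw]
    simp only [Measure.add_apply, Measure.smul_apply, Measure.dirac_apply' _ hs, smul_eq_mul,
      Measure.coe_finsetSum, Finset.sum_apply]
    have e1 : ∀ i : Instr V, s.indicator (⇑((markLaw lam).bind fun b =>
          if b then PMF.pure .sleep else (stepLaw G x).map .jump)) i =
        ((lam / (1 + lam) : ℝ≥0) : ℝ≥0∞) * s.indicator (⇑(PMF.pure (Instr.sleep : Instr V))) i +
        ((1 / (1 + lam) : ℝ≥0) : ℝ≥0∞) *
          s.indicator (⇑((stepLaw G x).map (Instr.jump : V → Instr V))) i := by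
      intro i
      by_cases hi : i ∈ s
      · simp [hi, markLaw_apply, PMF.bind_apply, tsum_fintype]
      · simp [hi]
    simp_rw [e1]
    rw [ENNReal.tsum_add, ENNReal.tsum_mul_left, ENNReal.tsum_mul_left,
      ← PMF.toMeasure_apply_eq_tsum, ← PMF.toMeasure_apply_eq_tsum, PMF.toMeasure_pure,
      Measure.dirac_apply' _ hs]
    congr 2
    rw [PMF.toMeasure_apply_eq_tsum]
    have e2 : ∀ i : Instr V, s.indicator (⇑((stepLaw G x).map (Instr.jump : V → Instr V))) i =
        ∑ y ∈ G.neighborFinset x, (G.degree x : ℝ≥0∞)⁻¹ *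
          ({Instr.jump y} : Set (Instr V)).indicator (s.indicator 1) i := by
      intro i
      by_cases hi : i ∈ s
      · rw [Set.indicator_of_mem hi, PMF.map_apply]
        cases i with
        | sleep => simp
        | jump z =>
          rw [tsum_eq_single z]
          · simp only [if_true, stepLaw_apply G hx]
            by_cases hz : G.Adj x z
            · rw [Finset.sum_eq_single z]
              · simp [hz, hi]
              · intro b _ hb
                rw [Set.indicator_of_notMem]
                · simp
                · simpa using fun h => hb h.symm
              · simp [hz]
            · rw [if_neg hz, eq_comm]
              refine Finset.sum_eq_zero fun y hy => ?_
              rw [Set.indicator_of_notMem]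
              · simp
              · rintro h
                simp only [Set.mem_singleton_iff, Instr.jump.injEq] at h
                exact hz (by simpa [h] using hy)
          · intro b hb
            rw [if_neg]
            simpa using fun h => hb h.symm
      · rw [Set.indicator_of_notMem hi]
        simp [Set.indicator, hi]
    simp_rw [e2]
    rw [Summable.tsum_finsetSum fun _ _ => ENNReal.summable]
    refine Finset.sum_congr rfl fun y _ => ?_
    rw [ENNReal.tsum_mul_left, tsum_eq_single (Instr.jump y)]
    · simp
    · intro b hb
      simp [Set.indicator, hb]
  rw [e, lintegral_add_measure, lintegral_smul_measure, lintegral_smul_measure,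
    lintegral_finsetSum_measure, lintegral_dirac' _ measurable_from_top]
  simp only [smul_eq_mul, lintegral_smul_measure, lintegral_dirac' _ measurable_from_top]

end Graph

/-! ## Legal topplings -/

section Reach

variable {V : Type*}

/-- The number of particles at a vertex. -/
def SiteState.total : SiteState → ℕ
  | .sleeping => 1
  | .active n => n

/-- Configurations, with the number of instructions used, that are reached from `η` active
particles by legal topplings that follow the instructions `I`. -/
inductive Reach (η : V → ℕ) (I : V → ℕ → Instr V) : (V → SiteState) → (V → ℕ) → Prop
  | start : Reach η I (fun x => .active (η x)) 0
  | topple {c : V → SiteState} {u : V → ℕ} (z : V) (h : Reach η I c u) (hz : 0 < (c z).numActive) :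
      Reach η I (perform z c (I z (u z))) (Function.update u z (u z + 1))

/-- The last instruction used at a vertex was to sleep. -/
def LastSleep (I : ℕ → Instr V) (m : ℕ) : Prop := ∃ j, m = j + 1 ∧ I j = .sleep

/-- The number of jumps among the first `m` instructions. -/
def departures (I : ℕ → Instr V) (m : ℕ) : ℕ := ((Finset.range m).filter fun j => I j ≠ .sleep).card

/-- The number of jumps to `x` among the first `m` instructions. -/
def jumpsTo (I : ℕ → Instr V) (x : V) (m : ℕ) : ℕ :=
  ((Finset.range m).filter fun j => I j = .jump x).card

/-- All jumps are along edges. -/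
def ValidInstr (G : SimpleGraph V) (I : V → ℕ → Instr V) : Prop :=
  ∀ x j y, I x j = .jump y → G.Adj x y

theorem not_lastSleep_zero (I : ℕ → Instr V) : ¬ LastSleep I 0 := by
  rintro ⟨j, h, -⟩; omega

theorem lastSleep_succ (I : ℕ → Instr V) (m : ℕ) : LastSleep I (m + 1) ↔ I m = .sleep := by
  constructor
  · rintro ⟨j, h, hj⟩
    obtain rfl : m = j := by omega
    exact hj
  · exact fun h => ⟨m, rfl, h⟩

theorem departures_succ (I : ℕ → Instr V) (m : ℕ) :
    departures I (m + 1) = departures I m + if I m = .sleep then 0 else 1 := by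
  unfold departures
  rw [Finset.range_add_one, Finset.filter_insert]
  by_cases h : I m = .sleep
  · rw [if_neg (not_not.2 h), if_pos h, add_zero]
  · rw [if_pos h, if_neg h, Finset.card_insert_of_notMem (by simp)]

theorem jumpsTo_succ (I : ℕ → Instr V) (x : V) (m : ℕ) :
    jumpsTo I x (m + 1) = jumpsTo I x m + if I m = .jump x then 1 else 0 := by
  unfold jumpsTo
  rw [Finset.range_add_one, Finset.filter_insert]
  split_ifs with h
  · rw [Finset.card_insert_of_notMem (by simp)]
  · rfl

theorem jumpsTo_mono (I : ℕ → Instr V) (x : V) : Monotone (jumpsTo I x) :=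
  monotone_nat_of_le_succ fun m => by rw [jumpsTo_succ]; omega

theorem jumpsTo_le (I : ℕ → Instr V) (x : V) (m : ℕ) : jumpsTo I x m ≤ m :=
  (Finset.card_filter_le _ _).trans (by simp)

theorem perform_sleep_apply (z : V) (c : V → SiteState) (x : V) :
    perform z c .sleep x = if x = z then (c z).tryToSleep else c x := by
  simp only [perform, Function.update_apply]

theorem perform_jump_apply (z : V) (c : V → SiteState) (y : V) (hy : y ≠ z) (x : V) :
    perform z c (.jump y) x =
      if x = y then (c y).arrive else if x = z then (c z).leave else c x := by
  simp only [perform, Function.update_apply, if_neg hy]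

/-- The stack remembers sleep: a particle falls asleep only by the last instruction used at its
vertex, and after an effective or ineffective sleep instruction an active vertex has at least two
particles, since an arrival wakes the sleeper. So the total number and the last instruction
determine the state. -/
theorem Reach.lastSleep {G : SimpleGraph V} {η : V → ℕ} {I : V → ℕ → Instr V}
    (hI : ValidInstr G I) {c : V → SiteState} {u : V → ℕ} (h : Reach η I c u) (x : V) :
    (LastSleep (I x) (u x) → c x = .sleeping ∨ ∃ n, 2 ≤ n ∧ c x = .active n) ∧
      (c x = .sleeping → LastSleep (I x) (u x)) := by
  induction h with
  | start => exact ⟨fun h => absurd h (not_lastSleep_zero _), fun h => by simp at h⟩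
  | @topple c u z h hz ih =>
    rcases hi : I z (u z) with _ | y
    · rw [perform_sleep_apply]
      by_cases hx : x = z
      · subst hx
        simp only [if_true, Function.update_self, lastSleep_succ, hi]
        rcases hc : c x with _ | n
        · simp [SiteState.tryToSleep]
        · rcases n with _ | _ | n
          · simp [hc, SiteState.numActive] at hz
          · simp [SiteState.tryToSleep]
          · simp [SiteState.tryToSleep]
      · simp only [if_neg hx, Function.update_of_ne hx]
        exact ih
    · have hyz : y ≠ z := fun e => (hI z (u z) y hi).ne e.symm
      rw [perform_jump_apply _ _ _ hyz]
      by_cases hxz : x = z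
      · subst hxz
        simp only [Function.update_self, lastSleep_succ, hi, if_neg hyz.symm, if_true]
        rcases hc : c x with _ | n
        · simp [hc, SiteState.numActive] at hz
        · simp [SiteState.leave]
      · simp only [Function.update_of_ne hxz]
        by_cases hxy : x = y
        · subst hxy
          simp only [if_true]
          rcases hc : c x with _ | n
          · simp [SiteState.arrive]
          · simp only [SiteState.arrive, reduceCtorEq, false_imp_iff, and_true]
            intro hl
            rcases ih.1 hl with h' | ⟨m, hm, h'⟩
            · simp [h'] at hc
            · rw [hc] at h'
              simp only [SiteState.active.injEq] at h'
              exact Or.inr ⟨n + 1, by omega, rfl⟩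
        · simp only [if_neg hxy, if_neg hxz]
          exact ih

/-- Conservation of mass at one vertex. Both sides depend on the order of the topplings only through
the counts `u`. -/
theorem Reach.total_add {G : SimpleGraph V} [G.LocallyFinite] {η : V → ℕ} {I : V → ℕ → Instr V}
    (hI : ValidInstr G I) {c : V → SiteState} {u : V → ℕ} (h : Reach η I c u) (x : V) :
    (c x).total + departures (I x) (u x) =
      η x + ∑ y ∈ G.neighborFinset x, jumpsTo (I y) x (u y) := by
  induction h with
  | start => simp [departures, jumpsTo, SiteState.total]
  | @topple c u z h hz ih =>
    have hsum : ∑ y ∈ G.neighborFinset x, jumpsTo (I y) x (Function.update u z (u z + 1) y) =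
        ∑ y ∈ G.neighborFinset x, jumpsTo (I y) x (u y) +
          if I z (u z) = .jump x then 1 else 0 := by
      by_cases hzx : z ∈ G.neighborFinset x
      · rw [← Finset.add_sum_erase _ _ hzx, ← Finset.add_sum_erase _ _ hzx, Function.update_self,
          jumpsTo_succ, Finset.sum_congr rfl (g := fun y => jumpsTo (I y) x (u y))]
        · ring
        · intro y hy
          rw [Function.update_of_ne (Finset.ne_of_mem_erase hy)]
      · rw [if_neg fun e => hzx (by simpa using (hI _ _ _ e).symm), add_zero]
        refine Finset.sum_congr rfl fun y hy => ?_
        rw [Function.update_of_ne]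
        rintro rfl
        exact hzx hy
    rw [hsum]
    rcases hi : I z (u z) with _ | y
    · rw [perform_sleep_apply]
      by_cases hx : x = z
      · subst hx
        simp only [if_true, Function.update_self, departures_succ, hi]
        rw [← add_assoc (η x), ← ih]
        rcases hc : c x with _ | n
        · simp [SiteState.tryToSleep, SiteState.total]
        · rcases n with _ | _ | n
          · simp [hc, SiteState.numActive] at hz
          · simp [SiteState.tryToSleep, SiteState.total]
          · simp [SiteState.tryToSleep, SiteState.total]
      · simpa [if_neg hx, Function.update_of_ne hx] using ih
    · have hyz : y ≠ z := fun e => (hI z (u z) y hi).ne e.symm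
      rw [perform_jump_apply _ _ _ hyz]
      by_cases hxz : x = z
      · subst hxz
        simp only [Function.update_self, departures_succ, hi, if_neg hyz.symm, if_true]
        rw [← add_assoc (η x), ← ih]
        rcases hc : c x with _ | n
        · simp [hc, SiteState.numActive] at hz
        · simp only [hc, SiteState.numActive] at hz
          simp only [SiteState.leave, SiteState.total, Instr.jump.injEq, hyz, reduceCtorEq,
            if_false]
          omega
      · simp only [Function.update_of_ne hxz]
        by_cases hxy : x = y
        · subst hxy
          simp only [if_true]
          rw [← add_assoc (η x), ← ih]
          rcases hc : c x with _ | n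
          · simp [SiteState.arrive, SiteState.total]; ring
          · simp [SiteState.arrive, SiteState.total]; ring
        · have hxy' : y ≠ x := fun e => hxy e.symm
          simpa [if_neg hxy, if_neg hxz, hxy'] using ih

/-! ### Comparison of configurations reached by legal topplings -/

theorem SiteState.numActive_le_total (s : SiteState) : s.numActive ≤ s.total := by
  cases s <;> simp [numActive, total]

/-- The number of active particles at `x` is monotone in the initial configuration and the numbers
of instructions used, as long as the number used at `x` stays the same. -/
theorem Reach.numActive_le {G : SimpleGraph V} [G.LocallyFinite] {η η' : V → ℕ}
    {I : V → ℕ → Instr V} (hI : ValidInstr G I) {c c' : V → SiteState} {u u' : V → ℕ}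
    (h : Reach η I c u) (h' : Reach η' I c' u') {x : V} (hη : η x ≤ η' x) (hu : ∀ y, u y ≤ u' y)
    (hx : u x = u' x) : (c x).numActive ≤ (c' x).numActive := by
  have t := h.total_add hI x
  have t' := h'.total_add hI x
  have hs : ∑ y ∈ G.neighborFinset x, jumpsTo (I y) x (u y) ≤
      ∑ y ∈ G.neighborFinset x, jumpsTo (I y) x (u' y) :=
    Finset.sum_le_sum fun y _ => jumpsTo_mono _ _ (hu y)
  have l := h.lastSleep hI x
  have l' := h'.lastSleep hI x
  rw [← hx] at t' l'
  rcases hc : c x with _ | n <;> rcases hc' : c' x with _ | n' <;>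
    simp only [hc, hc', SiteState.total, SiteState.numActive] at t t' ⊢
  · omega
  · omega
  -- The larger configuration sleeps at `x`, so the common last instruction is to sleep. An active
  -- vertex of the smaller one would then hold at least two particles, more than the single sleeper.
  · rcases l.1 (l'.2 hc') with h1 | ⟨m, hm, h1⟩
    · simp [hc] at h1
    · rw [hc] at h1
      simp only [SiteState.active.injEq] at h1
      omega
  · omega

/-- Locality: the state at `x` does not see the set of particles elsewhere. This turns stabilisation
of the finitely many counts around `x` into convergence of the state as the set of particles grows.
-/
theorem Reach.config_eq {G : SimpleGraph V} [G.LocallyFinite] {η η' : V → ℕ}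
    {I : V → ℕ → Instr V} (hI : ValidInstr G I) {c c' : V → SiteState} {u u' : V → ℕ}
    (h : Reach η I c u) (h' : Reach η' I c' u') {x : V} (hη : η x = η' x)
    (hu : ∀ y ∈ G.neighborFinset x, u y = u' y) (hx : u x = u' x) : c x = c' x := by
  have t := h.total_add hI x
  have t' := h'.total_add hI x
  have hs : ∑ y ∈ G.neighborFinset x, jumpsTo (I y) x (u y) =
      ∑ y ∈ G.neighborFinset x, jumpsTo (I y) x (u' y) :=
    Finset.sum_congr rfl fun y hy => by rw [hu y hy]
  have l := h.lastSleep hI x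
  have l' := h'.lastSleep hI x
  rw [← hx] at t' l'
  rcases hc : c x with _ | n <;> rcases hc' : c' x with _ | n' <;>
    simp only [hc, hc', SiteState.total] at t t' ⊢
  · rcases l'.1 (l.2 hc) with h1 | ⟨m, hm, h1⟩
    · simp [hc'] at h1
    · rw [hc'] at h1
      simp only [SiteState.active.injEq] at h1
      omega
  · rcases l.1 (l'.2 hc') with h1 | ⟨m, hm, h1⟩
    · simp [hc] at h1
    · rw [hc] at h1
      simp only [SiteState.active.injEq] at h1
      omega
  · congr 1
    omega

theorem Reach.numActive_le_add {G : SimpleGraph V} [G.LocallyFinite] {η : V → ℕ}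
    {I : V → ℕ → Instr V} (hI : ValidInstr G I) {c : V → SiteState} {u : V → ℕ}
    (h : Reach η I c u) (x : V) :
    (c x).numActive ≤ η x + ∑ y ∈ G.neighborFinset x, u y := by
  have t := h.total_add hI x
  have hs : ∑ y ∈ G.neighborFinset x, jumpsTo (I y) x (u y) ≤ ∑ y ∈ G.neighborFinset x, u y :=
    Finset.sum_le_sum fun y _ => jumpsTo_le _ _ _
  have := (c x).numActive_le_total
  omega

theorem numActive_perform_ge (z : V) (c : V → SiteState) (i : Instr V) {x : V} (hx : x ≠ z) :
    (c x).numActive ≤ (perform z c i x).numActive := by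
  cases i with
  | sleep => rw [perform_sleep_apply, if_neg hx]
  | jump y =>
    simp only [perform, Function.update_apply, if_neg hx]
    split_ifs with h1 h2
    · subst h1; exact absurd h2 hx
    · subst h1; cases c x <;> simp [SiteState.arrive, SiteState.numActive]
    · exact le_rfl

theorem numActive_perform_le (z : V) (c : V → SiteState) (i : Instr V) {x : V} (hx : x ≠ z)
    (hi : i ≠ .jump x) : (perform z c i x).numActive = (c x).numActive := by
  cases i with
  | sleep => rw [perform_sleep_apply, if_neg hx]
  | jump y =>
    have : x ≠ y := fun e => hi (e ▸ rfl)
    simp only [perform, Function.update_apply, if_neg hx, if_neg this]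

theorem numActive_perform_self_ge (z : V) (c : V → SiteState) (i : Instr V) :
    2 ≤ (c z).numActive → (c z).numActive ≤ (perform z c i z).numActive + 1 := by
  intro h
  rcases hc : c z with _ | n
  · simp [hc, SiteState.numActive] at h
  simp only [hc, SiteState.numActive] at h
  cases i with
  | sleep =>
    rw [perform_sleep_apply, if_pos rfl, hc]
    rcases n with _ | _ | n <;> simp [SiteState.tryToSleep, SiteState.numActive] at h ⊢
  | jump y =>
    by_cases hy : z = y
    · subst hy
      simp [perform, hc, SiteState.leave, SiteState.arrive, SiteState.numActive]
      omega
    · simp [perform, Function.update_apply, hy, hc, SiteState.leave, SiteState.numActive]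
      omega

/-- A vertex with `N + 1` active particles can be toppled `N` times. -/
theorem Reach.exists_used_ge {η : V → ℕ} {I : V → ℕ → Instr V} {o : V} (N : ℕ)
    {c : V → SiteState} {u : V → ℕ} (h : Reach η I c u) (hN : N + 1 ≤ (c o).numActive) :
    ∃ c' u', Reach η I c' u' ∧ u o + N ≤ u' o := by
  induction N generalizing c u with
  | zero => exact ⟨_, _, h, by simp⟩
  | succ m ih =>
    obtain ⟨c', u', h', hu⟩ := ih (h.topple o (by omega))
      (by have := numActive_perform_self_ge o c (I o (u o)) (by omega); omega)
    refine ⟨c', u', h', ?_⟩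
    simp only [Function.update_self] at hu
    omega

end Reach

/-! ## The evolution with finitely many particles -/

section Stages

variable {V : Type*}

/-- The stage after the clock at `x` has rung. -/
def Stage.ring (ω : Sample V) (s : Stage V) (x : V) : Stage V where
  config := perform x s.config (ω.2.1 x (s.used x))
  used := Function.update s.used x (s.used x + 1)
  clock := Function.update
    (fun y => s.clock y - (s.config y).numActive * (s.clock x / (s.config x).numActive)) x
    (ω.2.2 x (s.used x + 1))
  time := s.time + s.clock x / (s.config x).numActive

theorem Stage.next_of_ringsNext (ω : Sample V) (s : Stage V) (h : ∃ x, s.RingsNext x) :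
    s.next ω = s.ring ω h.choose := by
  rw [Stage.next, dif_pos h]
  rfl

theorem Stage.next_of_not_ringsNext (ω : Sample V) (s : Stage V) (h : ¬ ∃ x, s.RingsNext x) :
    s.next ω = { s with time := s.time + 1 } := by
  rw [Stage.next, dif_neg h]

theorem Stage.next_cases (ω : Sample V) (s : Stage V) :
    (∃ x, s.RingsNext x ∧ s.next ω = s.ring ω x) ∨
      ((¬ ∃ x, s.RingsNext x) ∧ s.next ω = { s with time := s.time + 1 }) := by
  by_cases h : ∃ x, s.RingsNext x
  · exact Or.inl ⟨h.choose, h.choose_spec, s.next_of_ringsNext ω h⟩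
  · exact Or.inr ⟨h, s.next_of_not_ringsNext ω h⟩

theorem stage_zero (ω : Sample V) (S : Finset V) : stage ω S 0 = start ω S := rfl

theorem stage_succ (ω : Sample V) (S : Finset V) (k : ℕ) :
    stage ω S (k + 1) = (stage ω S k).next ω := by
  rw [stage, Function.iterate_succ_apply']
  rfl

/-- The initial number of particles at `x` if only those in `S` are present. -/
def initial (ω : Sample V) (S : Finset V) (x : V) : ℕ := if x ∈ S then ω.1 x else 0

theorem initial_mono (ω : Sample V) {S S' : Finset V} (h : S ⊆ S') (x : V) :
    initial ω S x ≤ initial ω S' x := by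
  unfold initial
  split_ifs with h1 h2 h2
  · exact le_rfl
  · exact absurd (h h1) h2
  · exact Nat.zero_le _
  · exact le_rfl

theorem reach_stage (ω : Sample V) (S : Finset V) (k : ℕ) :
    Reach (initial ω S) ω.2.1 (stage ω S k).config (stage ω S k).used := by
  induction k with
  | zero => exact Reach.start
  | succ k ih =>
    rw [stage_succ]
    rcases (stage ω S k).next_cases ω with ⟨x, hx, e⟩ | ⟨-, e⟩
    · rw [e]
      exact ih.topple x hx.1
    · rw [e]
      exact ih

theorem finite_active_stage (ω : Sample V) (S : Finset V) (k : ℕ) :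
    {x | 0 < ((stage ω S k).config x).numActive}.Finite := by
  induction k with
  | zero =>
    refine S.finite_toSet.subset fun x hx => ?_
    by_contra h
    simp only [Finset.mem_coe] at h
    simp [stage_zero, start, SiteState.numActive, h] at hx
  | succ k ih =>
    rw [stage_succ]
    rcases (stage ω S k).next_cases ω with ⟨x, hx, e⟩ | ⟨-, e⟩
    · rw [e]
      have : ∃ w, ∀ y, y ≠ w → y ≠ x →
          (((stage ω S k).ring ω x).config y).numActive = ((stage ω S k).config y).numActive := by
        rcases hi : ω.2.1 x ((stage ω S k).used x) with _ | w
        · refine ⟨x, fun y hy _ => ?_⟩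
          simp only [Stage.ring, hi]
          exact numActive_perform_le _ _ _ hy (by simp)
        · refine ⟨w, fun y hy hyx => ?_⟩
          simp only [Stage.ring, hi]
          exact numActive_perform_le _ _ _ hyx (by simpa using fun e => hy e.symm)
      obtain ⟨w, hw⟩ := this
      refine (ih.union (Set.toFinite {w, x})).subset fun y hy => ?_
      by_cases h : y = w ∨ y = x
      · exact Or.inr (by simpa using h)
      · push Not at h
        left
        simpa [hw y h.1 h.2] using hy
    · rw [e]
      exact ih

theorem exists_ringsNext {s : Stage V} (hf : {x | 0 < (s.config x).numActive}.Finite)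
    (h : ∃ x, 0 < (s.config x).numActive) : ∃ x, s.RingsNext x := by
  obtain ⟨x, hx, hmin⟩ := Set.exists_min_image _
    (fun x => s.clock x / (s.config x).numActive) hf h
  exact ⟨x, hx, fun y hy => hmin y hy⟩

/-- The almost sure properties of a sample that the evolution depends on: jumps are along edges and
waiting times are positive. -/
structure Regular (G : SimpleGraph V) (ω : Sample V) : Prop where
  valid : ValidInstr G ω.2.1
  wait_pos : ∀ x j, 0 < ω.2.2 x j

/-- The sum of the first `j` waiting times at `x`. -/
def waitSum (ω : Sample V) (x : V) (j : ℕ) : ℝ := ∑ i ∈ Finset.range j, ω.2.2 x i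

/-- How far the clock at `x` has advanced. -/
def Stage.progress (ω : Sample V) (s : Stage V) (x : V) : ℝ :=
  waitSum ω x (s.used x + 1) - s.clock x

theorem waitSum_succ (ω : Sample V) (x : V) (j : ℕ) :
    waitSum ω x (j + 1) = waitSum ω x j + ω.2.2 x j := Finset.sum_range_succ _ _

theorem Regular.waitSum_strictMono {G : SimpleGraph V} {ω : Sample V} (hω : Regular G ω) (x : V) :
    StrictMono (waitSum ω x) :=
  strictMono_nat_of_lt_succ fun j => by
    rw [waitSum_succ]; linarith [hω.wait_pos x j]

/-! ### Clocks and their progress -/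

structure Stage.Inv (ω : Sample V) (s : Stage V) : Prop where
  clock_nonneg : ∀ x, 0 ≤ s.clock x
  clock_le : ∀ x, s.clock x ≤ ω.2.2 x (s.used x)
  clock_pos : ∀ x, (s.config x).numActive = 0 → 0 < s.clock x

variable {G : SimpleGraph V} {ω : Sample V}

/-- The first clock to ring is read off before any other one runs below zero. -/
theorem Stage.RingsNext.mul_le {s : Stage V} {x : V} (hx : s.RingsNext x)
    (y : V) (hy : 0 ≤ s.clock y) :
    (s.config y).numActive * (s.clock x / (s.config x).numActive) ≤ s.clock y := by
  by_cases h : 0 < (s.config y).numActive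
  · have := hx.2 y h
    have h' : (0 : ℝ) < (s.config y).numActive := by exact_mod_cast h
    rw [le_div_iff₀ h'] at this
    linarith
  · have : (s.config y).numActive = 0 := by omega
    simpa [this] using hy

theorem Stage.Inv.next (hω : Regular G ω) {s : Stage V} (hs : s.Inv ω) : (s.next ω).Inv ω := by
  rcases s.next_cases ω with ⟨x, hx, e⟩ | ⟨-, e⟩
  · have hd : 0 ≤ s.clock x / (s.config x).numActive :=
      div_nonneg (hs.clock_nonneg x) (Nat.cast_nonneg _)
    rw [e]
    refine ⟨fun y => ?_, fun y => ?_, fun y hy => ?_⟩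
    · by_cases hyx : y = x
      · subst hyx; simpa [Stage.ring] using (hω.wait_pos _ _).le
      · simpa [Stage.ring, hyx] using hx.mul_le y (hs.clock_nonneg y)
    · by_cases hyx : y = x
      · subst hyx; simp [Stage.ring]
      · simp only [Stage.ring, Function.update_of_ne hyx]
        have := mul_nonneg (Nat.cast_nonneg (α := ℝ) (s.config y).numActive) hd
        linarith [hs.clock_le y]
    · by_cases hyx : y = x
      · subst hyx; simpa [Stage.ring] using hω.wait_pos _ _
      · have h0 : (s.config y).numActive = 0 := by
          have := numActive_perform_ge x s.config (ω.2.1 x (s.used x)) hyx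
          simp only [Stage.ring] at hy
          omega
        simpa [Stage.ring, hyx, h0] using hs.clock_pos y h0
  · rw [e]
    exact ⟨hs.clock_nonneg, hs.clock_le, hs.clock_pos⟩

theorem inv_stage (hω : Regular G ω) (S : Finset V) (k : ℕ) : (stage ω S k).Inv ω := by
  induction k with
  | zero =>
    refine ⟨fun x => (hω.wait_pos x 0).le, fun x => le_rfl, fun x _ => hω.wait_pos x 0⟩
  | succ k ih => rw [stage_succ]; exact ih.next hω

theorem used_stage_le_succ (ω : Sample V) (S : Finset V) (k : ℕ) (x : V) :
    (stage ω S k).used x ≤ (stage ω S (k + 1)).used x := by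
  rw [stage_succ]
  rcases (stage ω S k).next_cases ω with ⟨z, -, e⟩ | ⟨-, e⟩
  · rw [e]
    simp only [Stage.ring, Function.update_apply]
    split_ifs with h
    · subst h; omega
    · exact le_rfl
  · rw [e]

theorem used_stage_mono (ω : Sample V) (S : Finset V) (x : V) :
    Monotone fun k => (stage ω S k).used x :=
  monotone_nat_of_le_succ fun k => used_stage_le_succ ω S k x

theorem time_stage_le_succ (hω : Regular G ω) (S : Finset V) (k : ℕ) :
    (stage ω S k).time ≤ (stage ω S (k + 1)).time := by
  rw [stage_succ]
  rcases (stage ω S k).next_cases ω with ⟨z, -, e⟩ | ⟨-, e⟩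
  · rw [e]
    have := div_nonneg ((inv_stage hω S k).clock_nonneg z)
      (Nat.cast_nonneg (α := ℝ) ((stage ω S k).config z).numActive)
    simp only [Stage.ring]
    linarith
  · rw [e]
    simp

theorem time_stage_mono (hω : Regular G ω) (S : Finset V) : Monotone fun k => (stage ω S k).time :=
  monotone_nat_of_le_succ fun k => time_stage_le_succ hω S k

theorem time_stage_zero (ω : Sample V) (S : Finset V) : (stage ω S 0).time = 0 := rfl

/-- Between two rings the clock at `x` runs at speed given by the number of active particles. -/
theorem progress_succ (ω : Sample V) (S : Finset V) (k : ℕ) (x : V) :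
    (stage ω S (k + 1)).progress ω x = (stage ω S k).progress ω x +
      ((stage ω S k).config x).numActive * ((stage ω S (k + 1)).time - (stage ω S k).time) := by
  rw [stage_succ]
  rcases (stage ω S k).next_cases ω with ⟨z, hz, e⟩ | ⟨h, e⟩
  · rw [e]
    simp only [Stage.ring, Stage.progress, Function.update_apply]
    split_ifs with h
    · subst h
      have : (((stage ω S k).config x).numActive : ℝ) ≠ 0 := by exact_mod_cast hz.1.ne'
      rw [waitSum_succ]
      field_simp
      ring
    · ring
  · rw [e]
    have : ((stage ω S k).config x).numActive = 0 := by
      by_contra h0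
      exact h (exists_ringsNext (finite_active_stage ω S k) ⟨x, Nat.pos_of_ne_zero h0⟩)
    simp [Stage.progress, this]

theorem active_mul_le_clock (hω : Regular G ω) (S : Finset V) (k : ℕ) (x : V) :
    ((stage ω S k).config x).numActive * ((stage ω S (k + 1)).time - (stage ω S k).time) ≤
      (stage ω S k).clock x := by
  rw [stage_succ]
  rcases (stage ω S k).next_cases ω with ⟨z, hz, e⟩ | ⟨h, e⟩
  · rw [e]
    have := hz.mul_le x ((inv_stage hω S k).clock_nonneg x)
    simpa [Stage.ring] using this
  · have : ((stage ω S k).config x).numActive = 0 := by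
      by_contra h0
      exact h (exists_ringsNext (finite_active_stage ω S k) ⟨x, Nat.pos_of_ne_zero h0⟩)
    simpa [this] using (inv_stage hω S k).clock_nonneg x

theorem waitSum_le_progress (hω : Regular G ω) (S : Finset V) (k : ℕ) (x : V) :
    waitSum ω x ((stage ω S k).used x) ≤ (stage ω S k).progress ω x := by
  rw [Stage.progress, waitSum_succ]
  linarith [(inv_stage hω S k).clock_le x]

theorem progress_zero (ω : Sample V) (S : Finset V) (x : V) : (stage ω S 0).progress ω x = 0 := by
  simp [Stage.progress, stage_zero, start, waitSum]

theorem progress_le_add (hω : Regular G ω) (S : Finset V) (x : V) {M : ℝ} {k l : ℕ} (hkl : k ≤ l)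
    (hM : ∀ j, k ≤ j → j < l → (((stage ω S j).config x).numActive : ℝ) ≤ M) :
    (stage ω S l).progress ω x ≤ (stage ω S k).progress ω x +
      M * ((stage ω S l).time - (stage ω S k).time) := by
  induction l, hkl using Nat.le_induction with
  | base => simp
  | succ l hl ih =>
    have h1 := ih fun j h1 h2 => hM j h1 (h2.trans (Nat.lt_succ_self l))
    have h2 := mul_le_mul_of_nonneg_right (hM l hl (Nat.lt_succ_self l))
      (sub_nonneg.2 (time_stage_le_succ hω S l))
    rw [progress_succ]
    linarith

theorem progress_mono (hω : Regular G ω) (S : Finset V) (x : V) :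
    Monotone fun k => (stage ω S k).progress ω x :=
  monotone_nat_of_le_succ fun k => by
    have := mul_nonneg (Nat.cast_nonneg (α := ℝ) ((stage ω S k).config x).numActive)
      (sub_nonneg.2 (time_stage_le_succ hω S k))
    simp only [progress_succ ω S k x]
    linarith

/-- Progress is linearly interpolated from stage `k` to time `a` and from stage `l` to time `b`.
Stating this for stages lets it serve both the evolution cut off at a time and the one cut off also
at a number of stages. -/
theorem extrapolate_le_add (hω : Regular G ω) (S : Finset V) (x : V) {a b M : ℝ} {k l : ℕ}
    (hkl : k ≤ l) (hab : a ≤ b) (hl : (stage ω S l).time ≤ b)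
    (hk : k < l → a ≤ (stage ω S (k + 1)).time)
    (hM : ∀ j, k ≤ j → j ≤ l → (((stage ω S j).config x).numActive : ℝ) ≤ M) :
    (stage ω S l).progress ω x + ((stage ω S l).config x).numActive * (b - (stage ω S l).time) ≤
      (stage ω S k).progress ω x +
        ((stage ω S k).config x).numActive * (a - (stage ω S k).time) + M * (b - a) := by
  rcases hkl.eq_or_lt with rfl | hlt
  · have := mul_le_mul_of_nonneg_right (hM _ le_rfl le_rfl) (sub_nonneg.2 hab)
    linarith
  · have h1 := progress_le_add hω S x hlt
      (fun j h1 h2 => hM j ((Nat.le_succ _).trans h1) h2.le)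
    rw [progress_succ] at h1
    have h2 := mul_le_mul_of_nonneg_right (hM _ le_rfl hkl) (sub_nonneg.2 (hk hlt))
    have h3 := mul_le_mul_of_nonneg_right (hM _ hkl le_rfl) (sub_nonneg.2 hl)
    linarith

/-! ### Continuous time -/

/-- The number of the last stage up to time `t`. -/
def index (ω : Sample V) (S : Finset V) (t : ℝ) : ℕ := sSup {k : ℕ | (stage ω S k).time ≤ t}

/-- Only finitely many clocks ring in finite time. -/
def NonExplosive (ω : Sample V) (S : Finset V) : Prop := ∀ B : ℝ, ∃ k, B < (stage ω S k).time

/-- The number of instructions used at `x` up to time `t`. -/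
def usedAt (ω : Sample V) (S : Finset V) (t : ℝ) (x : V) : ℕ := (stage ω S (index ω S t)).used x

/-- How far the clock at `x` has advanced up to time `t`. -/
def progressAt (ω : Sample V) (S : Finset V) (t : ℝ) (x : V) : ℝ :=
  (stage ω S (index ω S t)).progress ω x +
    ((stage ω S (index ω S t)).config x).numActive * (t - (stage ω S (index ω S t)).time)

variable {S S' : Finset V}

theorem bddAbove_times (hω : Regular G ω) (hS : NonExplosive ω S) (t : ℝ) :
    BddAbove {k : ℕ | (stage ω S k).time ≤ t} := by
  obtain ⟨k, hk⟩ := hS t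
  refine ⟨k, fun l hl => ?_⟩
  by_contra h
  have := time_stage_mono hω S (not_le.1 h).le
  simp only [Set.mem_ofPred_eq] at this hl
  linarith

theorem le_index (hω : Regular G ω) (hS : NonExplosive ω S) {t : ℝ} {k : ℕ}
    (h : (stage ω S k).time ≤ t) : k ≤ index ω S t :=
  le_csSup (bddAbove_times hω hS t) h

theorem time_index_le (hω : Regular G ω) (hS : NonExplosive ω S) {t : ℝ} (ht : 0 ≤ t) :
    (stage ω S (index ω S t)).time ≤ t :=
  Nat.sSup_mem (s := {k : ℕ | (stage ω S k).time ≤ t}) ⟨0, by simpa [time_stage_zero] using ht⟩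
    (bddAbove_times hω hS t)

theorem lt_time_index_succ (hω : Regular G ω) (hS : NonExplosive ω S) (t : ℝ) :
    t < (stage ω S (index ω S t + 1)).time := by
  by_contra h
  have := le_index hω hS (not_lt.1 h)
  omega

theorem index_mono (hω : Regular G ω) (hS : NonExplosive ω S) {a b : ℝ} (ha : 0 ≤ a)
    (hab : a ≤ b) : index ω S a ≤ index ω S b :=
  le_index hω hS ((time_index_le hω hS ha).trans hab)

theorem usedAt_mono (hω : Regular G ω) (hS : NonExplosive ω S) {a b : ℝ} (ha : 0 ≤ a)
    (hab : a ≤ b) (x : V) : usedAt ω S a x ≤ usedAt ω S b x :=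
  used_stage_mono ω S x (index_mono hω hS ha hab)

theorem progressAt_eq (hω : Regular G ω) (hS : NonExplosive ω S) {t : ℝ} (ht : 0 ≤ t) {k : ℕ}
    (h1 : (stage ω S k).time ≤ t) (h2 : t ≤ (stage ω S (k + 1)).time) (x : V) :
    progressAt ω S t x = (stage ω S k).progress ω x +
      ((stage ω S k).config x).numActive * (t - (stage ω S k).time) := by
  have hk := le_index hω hS h1
  rcases hk.eq_or_lt with rfl | hlt
  · rfl
  -- Several clocks may ring at the same instant. All stages from `k + 1` to the last one then have
  -- time `t`, and progress does not change along them.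
  have e1 : (stage ω S (k + 1)).time ≤ (stage ω S (index ω S t)).time := time_stage_mono hω S hlt
  have e2 := time_index_le hω hS ht
  have e3 : (stage ω S (index ω S t)).time = t := le_antisymm e2 (h2.trans e1)
  have e4 : (stage ω S (k + 1)).time = t := le_antisymm (e1.trans e2) h2
  have e5 : (stage ω S (index ω S t)).progress ω x = (stage ω S (k + 1)).progress ω x := by
    refine le_antisymm ?_ (progress_mono hω S x hlt)
    have hb : ∀ j, k + 1 ≤ j → j < index ω S t → (((stage ω S j).config x).numActive : ℝ) ≤
        ∑ j ∈ Finset.range (index ω S t), (((stage ω S j).config x).numActive : ℝ) :=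
      fun j _ hj => Finset.single_le_sum
        (f := fun j => (((stage ω S j).config x).numActive : ℝ))
        (fun _ _ => Nat.cast_nonneg _) (Finset.mem_range.2 hj)
    have := progress_le_add hω S x hlt hb
    rw [e3, e4] at this
    simpa using this
  rw [progressAt, e3, e5, progress_succ, e4]
  ring

theorem progressAt_zero (hω : Regular G ω) (hS : NonExplosive ω S) (x : V) :
    progressAt ω S 0 x = 0 := by
  rw [progressAt_eq hω hS le_rfl (k := 0) (time_stage_zero ω S).le (by
    rw [← time_stage_zero ω S]; exact time_stage_le_succ hω S 0), progress_zero, time_stage_zero]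
  simp

theorem progressAt_mono (hω : Regular G ω) (hS : NonExplosive ω S) {a b : ℝ} (ha : 0 ≤ a)
    (hab : a ≤ b) (x : V) : progressAt ω S a x ≤ progressAt ω S b x := by
  have hi := index_mono hω hS ha hab
  have n1 := time_index_le hω hS ha
  have n2 := time_index_le hω hS (ha.trans hab)
  have n3 := lt_time_index_succ hω hS a
  rcases hi.eq_or_lt with he | hlt
  · rw [progressAt, progressAt, ← he]
    gcongr
  · have h1 := progress_mono hω S x hlt
    simp only [progress_succ] at h1
    have h2 := mul_le_mul_of_nonneg_left (sub_le_sub_right n3.le (stage ω S (index ω S a)).time)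
      (Nat.cast_nonneg (α := ℝ) ((stage ω S (index ω S a)).config x).numActive)
    have h3 := mul_nonneg (Nat.cast_nonneg (α := ℝ) ((stage ω S (index ω S b)).config x).numActive)
      (sub_nonneg.2 n2)
    rw [progressAt, progressAt]
    linarith

theorem progressAt_le_add (hω : Regular G ω) (hS : NonExplosive ω S) {a b : ℝ} (ha : 0 ≤ a)
    (hab : a ≤ b) (x : V) {M : ℝ} (hM : ∀ j, index ω S a ≤ j → j ≤ index ω S b →
      (((stage ω S j).config x).numActive : ℝ) ≤ M) :
    progressAt ω S b x ≤ progressAt ω S a x + M * (b - a) := by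
  exact extrapolate_le_add hω S x (index_mono hω hS ha hab) hab
    (time_index_le hω hS (ha.trans hab)) (fun _ => (lt_time_index_succ hω hS a).le) hM

theorem waitSum_le_progressAt (hω : Regular G ω) (hS : NonExplosive ω S) {t : ℝ} (ht : 0 ≤ t)
    (x : V) : waitSum ω x (usedAt ω S t x) ≤ progressAt ω S t x := by
  have := waitSum_le_progress hω S (index ω S t) x
  have h := mul_nonneg (Nat.cast_nonneg (α := ℝ) ((stage ω S (index ω S t)).config x).numActive)
    (sub_nonneg.2 (time_index_le hω hS ht))
  rw [usedAt, progressAt]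
  linarith

theorem progressAt_lt_waitSum (hω : Regular G ω) (hS : NonExplosive ω S) (t : ℝ) (x : V) : progressAt ω S t x < waitSum ω x (usedAt ω S t x + 1) := by
  rw [usedAt, progressAt, Stage.progress]
  have h1 := active_mul_le_clock hω S (index ω S t) x
  have h2 := lt_time_index_succ hω hS t
  by_cases h : ((stage ω S (index ω S t)).config x).numActive = 0
  · have := (inv_stage hω S (index ω S t)).clock_pos x h
    simp only [h]
    simpa using this
  · have h' : (0 : ℝ) < ((stage ω S (index ω S t)).config x).numActive := by
      exact_mod_cast Nat.pos_of_ne_zero h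
    have := mul_lt_mul_of_pos_left (sub_lt_sub_right h2 (stage ω S (index ω S t)).time) h'
    linarith

theorem usedAt_le_of_progressAt_le (hω : Regular G ω) (hS : NonExplosive ω S)
    (hS' : NonExplosive ω S') {t t' : ℝ} (ht : 0 ≤ t) {x : V}
    (h : progressAt ω S t x ≤ progressAt ω S' t' x) : usedAt ω S t x ≤ usedAt ω S' t' x := by
  have h1 := waitSum_le_progressAt hω hS ht x
  have h2 := progressAt_lt_waitSum hω hS' t' x
  have := (hω.waitSum_strictMono x).lt_iff_lt.1 ((h1.trans h).trans_lt h2)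
  omega

theorem continuousOn_progressAt (hω : Regular G ω) (hS : NonExplosive ω S) (B : ℝ) (x : V) :
    ContinuousOn (fun t => progressAt ω S t x) (Set.Icc 0 B) := by
  set M := ∑ j ∈ Finset.range (index ω S B + 1), (((stage ω S j).config x).numActive : ℝ) with hM
  have hM0 : 0 ≤ M := Finset.sum_nonneg fun _ _ => Nat.cast_nonneg _
  have key : ∀ a b, 0 ≤ a → a ≤ b → b ≤ B →
      dist (progressAt ω S a x) (progressAt ω S b x) ≤ M * dist a b := by
    intro a b ha hab hb
    have h1 := progressAt_mono hω hS ha hab x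
    have h2 := progressAt_le_add hω hS ha hab x (M := M) (fun j _ hj =>
      Finset.single_le_sum (f := fun j => (((stage ω S j).config x).numActive : ℝ))
        (fun _ _ => Nat.cast_nonneg _)
        (Finset.mem_range.2 (Nat.lt_succ_of_le (hj.trans (index_mono hω hS (ha.trans hab) hb)))))
    rw [dist_comm, Real.dist_eq, abs_of_nonneg (by linarith), dist_comm a b, Real.dist_eq,
      abs_of_nonneg (by linarith)]
    linarith
  have : LipschitzOnWith ⟨M, hM0⟩ (fun t => progressAt ω S t x) (Set.Icc 0 B) :=
    LipschitzOnWith.of_dist_le_mul fun a ha b hb => by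
      rcases le_total a b with h | h
      · exact key a b ha.1 h hb.2
      · rw [dist_comm, dist_comm a b]
        exact key b a hb.1 h ha.2
  exact this.continuousOn

/-- With more particles, every clock is at least as far advanced. -/
theorem progressAt_mono_set [G.LocallyFinite] (hω : Regular G ω) (hS : NonExplosive ω S)
    (hS' : NonExplosive ω S') (hSS : S ⊆ S') {t : ℝ} (ht : 0 ≤ t) (x : V) :
    progressAt ω S t x ≤ progressAt ω S' t x := by
  have hcl : IsClosed ({t | ∀ x, progressAt ω S t x ≤ progressAt ω S' t x} ∩ Set.Icc 0 t) := by
    have : {t | ∀ x, progressAt ω S t x ≤ progressAt ω S' t x} ∩ Set.Icc 0 t =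
        Set.Icc 0 t ∩ ⋂ x, {s ∈ Set.Icc 0 t | progressAt ω S s x ≤ progressAt ω S' s x} := by
      ext s
      simp only [Set.mem_inter_iff, Set.mem_ofPred_eq, Set.mem_iInter]
      exact ⟨fun h => ⟨h.2, fun i => ⟨h.2, h.1 i⟩⟩, fun h => ⟨fun i => (h.2 i).2, h.1⟩⟩
    rw [this]
    refine isClosed_Icc.inter (isClosed_iInter fun x => ?_)
    exact isClosed_Icc.isClosed_le (continuousOn_progressAt hω hS t x)
      (continuousOn_progressAt hω hS' t x)
  -- Continuous induction: the set of times at which the comparison holds at all vertices is closed,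
  -- and from each such time it extends to the right, up to the next ring of either evolution.
  refine hcl.Icc_subset_of_forall_exists_gt (a := 0) (b := t) ?_ ?_ ⟨ht, le_rfl⟩ x
  · intro x
    rw [progressAt_zero hω hS, progressAt_zero hω hS']
  · rintro a ⟨ha, ha0, -⟩ b hb
    have hb : a < b := hb
    have n1 := time_index_le hω hS ha0
    have n2 := lt_time_index_succ hω hS a
    have n1' := time_index_le hω hS' ha0
    have n2' := lt_time_index_succ hω hS' a
    set c := min b (min (stage ω S (index ω S a + 1)).time (stage ω S' (index ω S' a + 1)).time)
      with hc
    have hac : a < c := lt_min hb (lt_min n2 n2')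
    have hc1 : c ≤ (stage ω S (index ω S a + 1)).time := (min_le_right _ _).trans (min_le_left _ _)
    have hc2 : c ≤ (stage ω S' (index ω S' a + 1)).time :=
      (min_le_right _ _).trans (min_le_right _ _)
    have hc0 : 0 ≤ c := ha0.trans hac.le
    refine ⟨c, fun y => ?_, hac, min_le_left _ _⟩
    have hu : ∀ z, usedAt ω S a z ≤ usedAt ω S' a z := fun z =>
      usedAt_le_of_progressAt_le hω hS hS' ha0 (ha z)
    have hy := ha y
    have e1 := progressAt_eq hω hS hc0 (n1.trans hac.le) hc1 y
    have e2 := progressAt_eq hω hS' hc0 (n1'.trans hac.le) hc2 y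
    -- With equal counts at `y` the larger system has at least as many active particles there, hence
    -- at least the same speed. With a strictly smaller count, the clock of the smaller system
    -- cannot pass its next ring, and the larger system has already done so.
    rcases (hu y).eq_or_lt with he | hlt
    · have hle := (reach_stage ω S (index ω S a)).numActive_le hω.valid
        (reach_stage ω S' (index ω S' a)) (x := y) (initial_mono ω hSS y) hu he
      have hle' : (((stage ω S (index ω S a)).config y).numActive : ℝ) ≤
        ((stage ω S' (index ω S' a)).config y).numActive := by exact_mod_cast hle
      rw [progressAt, progressAt] at hy
      have := mul_le_mul_of_nonneg_right hle' (sub_nonneg.2 hac.le)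
      rw [e1, e2]
      linarith
    · have h1 : progressAt ω S c y ≤ waitSum ω y (usedAt ω S a y + 1) := by
        rw [e1, usedAt, Stage.progress]
        have h1 := active_mul_le_clock hω S (index ω S a) y
        have := mul_le_mul_of_nonneg_left
          (sub_le_sub_right hc1 (stage ω S (index ω S a)).time)
          (Nat.cast_nonneg (α := ℝ) ((stage ω S (index ω S a)).config y).numActive)
        linarith
      have h2 : waitSum ω y (usedAt ω S a y + 1) ≤ waitSum ω y (usedAt ω S' a y) :=
        (hω.waitSum_strictMono y).monotone hlt
      have h3 := waitSum_le_progressAt hω hS' ha0 y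
      have h4 := progressAt_mono hω hS' ha0 hac.le y
      linarith

theorem usedAt_mono_set [G.LocallyFinite] (hω : Regular G ω) (hS : NonExplosive ω S)
    (hS' : NonExplosive ω S') (hSS : S ⊆ S') {t : ℝ} (ht : 0 ≤ t) (x : V) :
    usedAt ω S t x ≤ usedAt ω S' t x :=
  usedAt_le_of_progressAt_le hω hS hS' ht (progressAt_mono_set hω hS hS' hSS ht x)

/-- The evolution performs at least as many topplings as any legal sequence. -/
theorem Reach.exists_le_used [G.LocallyFinite] (hω : Regular G ω) (hS : NonExplosive ω S)
    {c : V → SiteState} {u : V → ℕ} (h : Reach (initial ω S) ω.2.1 c u) :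
    ∃ k, ∀ x, u x ≤ (stage ω S k).used x := by
  induction h with
  | start => exact ⟨0, fun x => Nat.zero_le _⟩
  | @topple c u z h hz ih =>
    obtain ⟨k, hk⟩ := ih
    suffices ∃ l, k ≤ l ∧ u z < (stage ω S l).used z by
      obtain ⟨l, hkl, hl⟩ := this
      refine ⟨l, fun x => ?_⟩
      rw [Function.update_apply]
      split_ifs with hx
      · subst hx; omega
      · exact (hk x).trans (used_stage_mono ω S x hkl)
    -- If the evolution never used one more instruction at `z`, then from stage `k` on `z` would
    -- keep an active particle by monotonicity. Its clock would run at speed at least one for an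
    -- unbounded time, beyond the next waiting sum.
    by_contra hcon
    push Not at hcon
    have hu : ∀ l, k ≤ l → (stage ω S l).used z = u z := fun l hl =>
      le_antisymm (hcon l hl) ((hk z).trans (used_stage_mono ω S z hl))
    have hact : ∀ l, k ≤ l → 1 ≤ ((stage ω S l).config z).numActive := fun l hl =>
      le_trans hz (h.numActive_le hω.valid (reach_stage ω S l) le_rfl
        (fun y => (hk y).trans (used_stage_mono ω S y hl)) (hu l hl).symm)
    have hprog : ∀ l, k ≤ l → (stage ω S l).time - (stage ω S k).time ≤
        (stage ω S l).progress ω z - (stage ω S k).progress ω z := by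
      intro l hl
      induction l, hl using Nat.le_induction with
      | base => simp
      | succ l hl ih =>
        rw [progress_succ]
        have h1 : (1 : ℝ) ≤ ((stage ω S l).config z).numActive := by exact_mod_cast hact l hl
        have := mul_le_mul_of_nonneg_right h1 (sub_nonneg.2 (time_stage_le_succ hω S l))
        linarith
    obtain ⟨l, hl⟩ := hS ((stage ω S k).time + waitSum ω z (u z + 1) -
      (stage ω S k).progress ω z)
    have hl' := hl.trans_le (time_stage_mono hω S (le_max_right k l))
    have h1 := hprog (max k l) (le_max_left _ _)
    have h2 := (inv_stage hω S (max k l)).clock_nonneg z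
    have h3 : (stage ω S (max k l)).progress ω z =
        waitSum ω z (u z + 1) - (stage ω S (max k l)).clock z := by
      rw [Stage.progress, hu _ (le_max_left _ _)]
    linarith

/-- If `x` has no active particle at time `a`, its clock advances little until time `b` unless
instructions are used at `x` or at its neighbours. -/
theorem progressAt_le_add_of_inactive [G.LocallyFinite] (hω : Regular G ω) (hS : NonExplosive ω S)
    {a b : ℝ} (ha : 0 ≤ a) (hab : a ≤ b) {x : V}
    (hx : (finiteProcess ω S a x).numActive = 0) :
    progressAt ω S b x ≤ progressAt ω S a x +
      ((initial ω S x + ∑ y ∈ G.neighborFinset x, usedAt ω S b y : ℕ) : ℝ) *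
      ((usedAt ω S b x + ∑ y ∈ G.neighborFinset x, usedAt ω S b y : ℕ) -
        (usedAt ω S a x + ∑ y ∈ G.neighborFinset x, usedAt ω S a y : ℕ) : ℝ) * (b - a) := by
  have hle : ∀ y, usedAt ω S a y ≤ usedAt ω S b y := fun y => usedAt_mono hω hS ha hab y
  have hsum : ∑ y ∈ G.neighborFinset x, usedAt ω S a y ≤ ∑ y ∈ G.neighborFinset x, usedAt ω S b y :=
    Finset.sum_le_sum fun y _ => hle y
  refine progressAt_le_add hω hS ha hab x fun j hja hjb => ?_
  -- Without a new instruction at `x` or its neighbours the state stays inactive and the speed is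
  -- zero. Otherwise the difference of the counts is at least one, so the other factor alone bounds
  -- the speed.
  by_cases he : usedAt ω S a x + ∑ y ∈ G.neighborFinset x, usedAt ω S a y =
      usedAt ω S b x + ∑ y ∈ G.neighborFinset x, usedAt ω S b y
  · have h0 : ((stage ω S j).config x).numActive = 0 := by
      have hx1 : usedAt ω S a x = usedAt ω S b x := by have := hle x; omega
      have hy1 : ∀ y ∈ G.neighborFinset x, usedAt ω S a y = usedAt ω S b y :=
        (Finset.sum_eq_sum_iff_of_le fun y _ => hle y).1 (by omega)
      have hj : ∀ y, usedAt ω S a y = usedAt ω S b y →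
          (stage ω S (index ω S a)).used y = (stage ω S j).used y := fun y hy =>
        le_antisymm (used_stage_mono ω S y hja)
          ((used_stage_mono ω S y hjb).trans (le_of_eq hy.symm))
      rw [← (reach_stage ω S (index ω S a)).config_eq hω.valid (reach_stage ω S j) rfl
        (fun y hy => hj y (hy1 y hy)) (hj x hx1)]
      exact hx
    rw [h0, he]
    simp
  · have h1 : (((stage ω S j).config x).numActive : ℝ) ≤
        ((initial ω S x + ∑ y ∈ G.neighborFinset x, usedAt ω S b y : ℕ) : ℝ) := by
      have := (reach_stage ω S j).numActive_le_add hω.valid x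
      have h2 : ∑ y ∈ G.neighborFinset x, (stage ω S j).used y ≤
          ∑ y ∈ G.neighborFinset x, usedAt ω S b y :=
        Finset.sum_le_sum fun y _ => used_stage_mono ω S y hjb
      exact_mod_cast this.trans (by omega)
    have h2 : (1 : ℝ) ≤ (usedAt ω S b x + ∑ y ∈ G.neighborFinset x, usedAt ω S b y : ℕ) -
        (usedAt ω S a x + ∑ y ∈ G.neighborFinset x, usedAt ω S a y : ℕ) := by
      have := hle x
      rw [le_sub_iff_add_le]
      exact_mod_cast (by omega : 1 + (usedAt ω S a x + ∑ y ∈ G.neighborFinset x, usedAt ω S a y) ≤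
        usedAt ω S b x + ∑ y ∈ G.neighborFinset x, usedAt ω S b y)
    calc (((stage ω S j).config x).numActive : ℝ) ≤ _ * 1 := by rw [mul_one]; exact h1
      _ ≤ _ := mul_le_mul_of_nonneg_left h2 (Nat.cast_nonneg _)

end Stages

/-! ## Activity from infinitely many legal topplings -/

section Active

variable {V : Type*} {G : SimpleGraph V} [G.LocallyFinite] {ω : Sample V}

theorem eventually_usedAt_eq (hω : Regular G ω) (hne : ∀ S, NonExplosive ω S)
    (hfin : ∀ (x : V) (t : ℝ), 0 ≤ t → ∃ N, ∀ S, usedAt ω S t x ≤ N) {t : ℝ} (ht : 0 ≤ t) (x : V) :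
    ∃ n, ∀ᶠ S in (atTop : Filter (Finset V)), usedAt ω S t x = n := by
  have hb : BddAbove (Set.range fun S => usedAt ω S t x) := by
    obtain ⟨N, hN⟩ := hfin x t ht
    exact ⟨N, by rintro _ ⟨S, rfl⟩; exact hN S⟩
  obtain ⟨S₀, hS₀⟩ := Nat.sSup_mem (Set.range_nonempty fun S => usedAt ω S t x) hb
  refine ⟨usedAt ω S₀ t x, (eventually_ge_atTop S₀).mono fun S hS => le_antisymm ?_ ?_⟩
  · simp only at hS₀
    rw [hS₀]
    exact le_csSup hb ⟨S, rfl⟩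
  · exact usedAt_mono_set hω (hne _) (hne _) hS ht x

/-- The limit that defines the infinite system exists. -/
theorem eventually_finiteProcess_eq (hω : Regular G ω) (hne : ∀ S, NonExplosive ω S)
    (hfin : ∀ (x : V) (t : ℝ), 0 ≤ t → ∃ N, ∀ S, usedAt ω S t x ≤ N) {t : ℝ} (ht : 0 ≤ t) (x : V) :
    ∀ᶠ S in (atTop : Filter (Finset V)), finiteProcess ω S t x = process ω t x := by
  have h : ∃ s, ∀ᶠ S : Finset V in atTop, finiteProcess ω S t x = s := by
    choose n hn using fun y => eventually_usedAt_eq hω hne hfin ht y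
    have hall : ∀ᶠ S in (atTop : Filter (Finset V)), x ∈ S ∧ usedAt ω S t x = n x ∧
        ∀ y ∈ G.neighborFinset x, usedAt ω S t y = n y := by
      refine (((eventually_ge_atTop {x}).mono fun S hS => ?_).and
        ((hn x).and ((Filter.eventually_all_finset _).2 fun y _ => hn y)))
      exact hS (Finset.mem_singleton_self x)
    obtain ⟨S₀, hS₀⟩ := eventually_atTop.1 hall
    refine ⟨finiteProcess ω S₀ t x, eventually_atTop.2 ⟨S₀, fun S hS => ?_⟩⟩
    have h0 := hS₀ S₀ le_rfl
    have h1 := hS₀ S hS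
    refine (reach_stage ω S (index ω S t)).config_eq hω.valid (reach_stage ω S₀ (index ω S₀ t))
      ?_ (fun y hy => ?_) ?_
    · simp [initial, h0.1, h1.1]
    · exact (h1.2.2 y hy).trans (h0.2.2 y hy).symm
    · exact h1.2.1.trans h0.2.1.symm
  rw [process, dif_pos h]
  exact h.choose_spec

/-- The limit is known only at single times, so inactivity of `o` after `T` passes to a finite
system only on a finite grid. Between grid times the clock at `o` advances only in cells where an
instruction is used at `o` or a neighbour. The number of these instructions is bounded uniformly in
the finite set, so a fine mesh makes the total advance smaller than one prescribed waiting time,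
whereas many legal topplings at `o` force the clock through all of it. -/
theorem isActive_of_reach (hω : Regular G ω) (hne : ∀ S, NonExplosive ω S)
    (hfin : ∀ (x : V) (t : ℝ), 0 ≤ t → ∃ N, ∀ S, usedAt ω S t x ≤ N) (o : V)
    (hreach : ∀ N, ∃ S c u, Reach (initial ω S) ω.2.1 c u ∧ N ≤ u o) : IsActive ω := by
  intro hfix
  obtain ⟨T₀, hT₀⟩ := hfix o
  obtain ⟨T, hT0, hT⟩ : ∃ T : ℝ, 0 ≤ T ∧ ∀ t, T ≤ t → (process ω t o).numActive = 0 :=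
    ⟨max T₀ 0, le_max_right _ _, fun t ht => hT₀ t ((le_max_left _ _).trans ht)⟩
  obtain ⟨N, hN⟩ := hfin o T hT0
  obtain ⟨S₁, c, u, hr, hu⟩ := hreach (N + 2)
  obtain ⟨k, hk⟩ := hr.exists_le_used hω (hne S₁)
  set t := max T (stage ω S₁ k).time with ht
  have hTt : T ≤ t := le_max_left _ _
  have ht0 : 0 ≤ t := hT0.trans hTt
  have hut : N + 2 ≤ usedAt ω S₁ t o :=
    hu.trans ((hk o).trans (used_stage_mono ω S₁ o (le_index hω (hne S₁) (le_max_right _ _))))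
  choose n hn using fun y => hfin y t ht0
  set A := ω.1 o + ∑ y ∈ G.neighborFinset o, n y with hA
  set J := n o + ∑ y ∈ G.neighborFinset o, n y with hJ
  have hgap : 0 < ω.2.2 o (N + 1) := hω.wait_pos _ _
  -- `A` bounds the speed of the clock at `o`, and `J` bounds the number of instructions at `o` and
  -- its neighbours, both up to time `t` and for every finite set. The mesh has to be fixed before
  -- the set `S` is chosen, so it may depend only on such uniform bounds.
  obtain ⟨m, hm⟩ := exists_nat_gt (A * J * (t - T) / ω.2.2 o (N + 1))
  rw [div_lt_iff₀ hgap] at hm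
  set h := (t - T) / (m + 1) with hh
  have hm1 : (0 : ℝ) < m + 1 := by positivity
  have hh0 : 0 ≤ h := div_nonneg (sub_nonneg.2 hTt) hm1.le
  set g : ℕ → ℝ := fun i => T + i * h with hg
  have hgT : ∀ i, T ≤ g i := fun i => by
    have : 0 ≤ i * h := by positivity
    simp only [hg]; linarith
  have hgm : g (m + 1) = t := by
    simp only [hg, hh]; push_cast; field_simp; ring
  have hgmono : Monotone g := fun i j hij => by
    simp only [hg]; gcongr
  have hgt : ∀ i ≤ m + 1, g i ≤ t := fun i hi => hgm ▸ hgmono hi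
  have hev : ∀ᶠ S in (atTop : Filter (Finset V)), S₁ ⊆ S ∧
      ∀ i ∈ Finset.range (m + 1), finiteProcess ω S (g i) o = process ω (g i) o :=
    (eventually_ge_atTop S₁).and ((Filter.eventually_all_finset _).2 fun i _ =>
      eventually_finiteProcess_eq hω hne hfin (hT0.trans (hgT i)) o)
  obtain ⟨S, hS₁, hS⟩ := hev.exists
  set D : ℕ → ℝ := fun i => ((usedAt ω S (g i) o +
    ∑ y ∈ G.neighborFinset o, usedAt ω S (g i) y : ℕ) : ℝ) with hD
  have hDmono : ∀ i, D i ≤ D (i + 1) := fun i => by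
    have := hgmono (Nat.le_succ i)
    simp only [hD, Nat.cast_le]
    exact Nat.add_le_add (usedAt_mono hω (hne S) (hT0.trans (hgT i)) this o)
      (Finset.sum_le_sum fun y _ => usedAt_mono hω (hne S) (hT0.trans (hgT i)) this y)
  have hind : ∀ i ≤ m + 1, progressAt ω S (g i) o ≤
      progressAt ω S (g 0) o + A * (D i - D 0) * h := by
    intro i hi
    induction i with
    | zero => simp
    | succ i ih =>
      have h1 := ih (by omega)
      have h2 := progressAt_le_add_of_inactive hω (hne S) (hT0.trans (hgT i))
        (hgmono (Nat.le_succ i)) (x := o)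
        (by rw [hS i (Finset.mem_range.2 (by omega))]; exact hT _ (hgT i))
      have h3 : g (i + 1) - g i = h := by simp only [hg]; push_cast; ring
      have h4 : ((initial ω S o + ∑ y ∈ G.neighborFinset o, usedAt ω S (g (i + 1)) y : ℕ) : ℝ) ≤
          A := by
        rw [Nat.cast_le]
        refine Nat.add_le_add ?_ (Finset.sum_le_sum fun y _ => ?_)
        · unfold initial; split_ifs <;> simp
        · exact (usedAt_mono hω (hne S) (hT0.trans (hgT _)) (hgt _ hi) y).trans (hn y S)
      rw [h3] at h2
      have h5 := mul_le_mul_of_nonneg_right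
        (mul_le_mul_of_nonneg_right h4 (sub_nonneg.2 (hDmono i))) hh0
      simp only [hD] at h1 h2 h5 ⊢
      nlinarith
  have h1 := hind (m + 1) le_rfl
  have h2 : D (m + 1) - D 0 ≤ J := by
    have h3 : D (m + 1) ≤ J := by
      simp only [hD, hgm, Nat.cast_le, hJ]
      exact Nat.add_le_add (hn o S) (Finset.sum_le_sum fun y _ => hn y S)
    have : 0 ≤ D 0 := Nat.cast_nonneg _
    linarith
  have h3 : (A : ℝ) * (D (m + 1) - D 0) * h ≤ A * J * h := by gcongr
  have h4 : A * J * h < ω.2.2 o (N + 1) := by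
    rw [hh, ← mul_div_assoc, div_lt_iff₀ hm1]
    nlinarith
  -- At most `N` instructions by time `T` and at least `N + 2` by time `t`: in between the clock
  -- runs through the whole waiting time with index `N + 1`, whatever remained of the current one at
  -- `T`.
  have h5 : waitSum ω o (N + 2) ≤ progressAt ω S t o :=
    ((hω.waitSum_strictMono o).monotone hut).trans
      ((waitSum_le_progressAt hω (hne S₁) ht0 o).trans
        (progressAt_mono_set hω (hne S₁) (hne S) hS₁ ht0 o))
  have h6 : progressAt ω S T o < waitSum ω o (N + 1) :=
    (progressAt_lt_waitSum hω (hne S) T o).trans_le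
      ((hω.waitSum_strictMono o).monotone (Nat.succ_le_succ (hN S)))
  have h7 : g 0 = T := by simp [hg]
  rw [hgm, h7] at h1
  rw [waitSum_succ] at h5
  linarith

end Active

/-! ## Resampling one coordinate -/

section Resample

theorem measurable_update_pair {ι : Type*} {X : ι → Type*} [∀ i, MeasurableSpace (X i)] (i : ι) :
    Measurable fun p : (∀ i, X i) × X i => Function.update p.1 i p.2 := by
  refine measurable_pi_lambda _ fun j => ?_
  by_cases h : j = i
  · subst h; simpa using measurable_snd
  · simp only [Function.update_of_ne h]
    exact (measurable_pi_apply j).comp measurable_fst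

theorem map_update_infinitePi {ι : Type*} {X : ι → Type*} [∀ i, MeasurableSpace (X i)]
    (P : ∀ i, Measure (X i)) [∀ i, IsProbabilityMeasure (P i)] (i : ι) :
    ((Measure.infinitePi P).prod (P i)).map (fun p => Function.update p.1 i p.2) =
      Measure.infinitePi P := by
  have hm := measurable_update_pair (X := X) i
  refine Measure.eq_infinitePi _ fun s t ht => ?_
  have hms : MeasurableSet (Set.pi (s : Set ι) t) :=
    MeasurableSet.pi s.countable_toSet fun j _ => ht j
  rw [Measure.map_apply hm hms]
  by_cases hi : i ∈ s
  · have : (fun p : (∀ i, X i) × X i => Function.update p.1 i p.2) ⁻¹' Set.pi (s : Set ι) t =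
        (Set.pi (↑(s.erase i)) t) ×ˢ t i := by
      ext p
      simp only [Set.mem_preimage, Set.mem_pi, Finset.mem_coe, Set.mem_prod, Finset.mem_erase]
      constructor
      · intro h
        refine ⟨fun j hj => ?_, by simpa using h i hi⟩
        simpa [hj.1] using h j hj.2
      · rintro ⟨h1, h2⟩ j hj
        by_cases hji : j = i
        · subst hji; simpa using h2
        · simpa [hji] using h1 j ⟨hji, hj⟩
    rw [this, Measure.prod_prod, Measure.infinitePi_pi _ (fun j _ => ht j),
      Finset.prod_erase_mul _ _ hi]
  · have : (fun p : (∀ i, X i) × X i => Function.update p.1 i p.2) ⁻¹' Set.pi (s : Set ι) t =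
        (Set.pi (↑s) t) ×ˢ Set.univ := by
      ext p
      simp only [Set.mem_preimage, Set.mem_pi, Finset.mem_coe, Set.mem_prod, Set.mem_univ, and_true]
      refine forall₂_congr fun j hj => ?_
      have : j ≠ i := fun e => hi (e ▸ hj)
      simp [this]
    rw [this, Measure.prod_prod, Measure.infinitePi_pi _ (fun j _ => ht j)]
    simp

theorem lintegral_infinitePi_update {ι : Type*} {X : ι → Type*} [∀ i, MeasurableSpace (X i)]
    (P : ∀ i, Measure (X i)) [∀ i, IsProbabilityMeasure (P i)] (i : ι)
    {F : (∀ i, X i) → ℝ≥0∞} (hF : Measurable F) :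
    ∫⁻ ω, F ω ∂Measure.infinitePi P =
      ∫⁻ ω, ∫⁻ a, F (Function.update ω i a) ∂P i ∂Measure.infinitePi P := by
  conv_lhs => rw [← map_update_infinitePi P i]
  rw [lintegral_map hF (measurable_update_pair i), lintegral_prod]
  exact (hF.comp (measurable_update_pair i)).aemeasurable

/-- Replace the `j`-th entry of the stack at `x`. -/
def resample {V α : Type*} (I : V → ℕ → α) (x : V) (j : ℕ) (a : α) : V → ℕ → α :=
  Function.update I x (Function.update (I x) j a)

theorem resample_apply {V α : Type*} (I : V → ℕ → α) (x : V) (j : ℕ) (a : α) (y : V) (i : ℕ) :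
    resample I x j a y i = if y = x ∧ i = j then a else I y i := by
  unfold resample
  by_cases hy : y = x
  · subst hy
    by_cases hi : i = j
    · subst hi; simp
    · simp [hi]
  · simp [hy]

theorem measurable_resample {V α : Type*} [MeasurableSpace α] (x : V) (j : ℕ) :
    Measurable fun p : (V → ℕ → α) × α => resample p.1 x j p.2 := by
  refine measurable_pi_lambda _ fun y => measurable_pi_lambda _ fun i => ?_
  simp only [resample_apply]
  split_ifs
  · exact measurable_snd
  · exact (measurable_pi_apply i).comp ((measurable_pi_apply y).comp measurable_fst)

/-- Resampling one entry of independent stacks does not change their law. -/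
theorem lintegral_resample {V α : Type*} [MeasurableSpace α] (P : V → Measure α)
    [∀ x, IsProbabilityMeasure (P x)] (x : V) (j : ℕ) {F : (V → ℕ → α) → ℝ≥0∞}
    (hF : Measurable F) :
    ∫⁻ I, F I ∂Measure.infinitePi (fun y => Measure.infinitePi fun _ : ℕ => P y) =
      ∫⁻ I, ∫⁻ a, F (resample I x j a) ∂P x
        ∂Measure.infinitePi (fun y => Measure.infinitePi fun _ : ℕ => P y) := by
  have hG : Measurable fun I : V → ℕ → α => ∫⁻ a, F (resample I x j a) ∂P x :=
    (hF.comp (measurable_resample x j)).lintegral_prod_right'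
  rw [lintegral_infinitePi_update _ x hF, lintegral_infinitePi_update _ x hG]
  refine lintegral_congr fun I => ?_
  have hm : Measurable fun r : ℕ → α => Function.update I x r :=
    (measurable_update_pair (X := fun _ : V => ℕ → α) x).comp measurable_prodMk_left
  refine (lintegral_infinitePi_update (fun _ : ℕ => P x) j (hF.comp hm)).trans ?_
  refine lintegral_congr fun r => lintegral_congr fun a => ?_
  simp only [resample, Function.comp_apply, Function.update_self, Function.update_idem]
  congr!

end Resample

/-! ## Measurability of the evolution -/

section Measurability

theorem measurable_of_countable_cover {α β ι : Type*} [MeasurableSpace α] [MeasurableSpace β]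
    [Countable ι] {E : ι → Set α} (hE : ∀ i, MeasurableSet (E i)) (hcov : ∀ a, ∃ i, a ∈ E i)
    {f : α → β} {g : ι → α → β} (hg : ∀ i, Measurable (g i)) (hfg : ∀ i, ∀ a ∈ E i, f a = g i a) :
    Measurable f := by
  intro B hB
  have : f ⁻¹' B = ⋃ i, E i ∩ g i ⁻¹' B := by
    ext a
    simp only [Set.mem_preimage, Set.mem_iUnion, Set.mem_inter_iff]
    constructor
    · intro h
      obtain ⟨i, hi⟩ := hcov a
      exact ⟨i, hi, by rwa [← hfg i a hi]⟩
    · rintro ⟨i, hi, h⟩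
      rwa [hfg i a hi]
  rw [this]
  exact MeasurableSet.iUnion fun i => (hE i).inter (hg i hB)

theorem measurable_apply_of_countable {α β ι : Type*} [MeasurableSpace α] [MeasurableSpace β]
    [Countable ι] [MeasurableSpace ι] [MeasurableSingletonClass ι] {n : α → ι} (hn : Measurable n)
    {f : ι → α → β} (hf : ∀ i, Measurable (f i)) : Measurable fun a => f (n a) a :=
  measurable_of_countable_cover (E := fun i => {a | n a = i}) (g := f)
    (fun i => hn (measurableSet_singleton i)) (fun a => ⟨n a, rfl⟩) hf
    (fun i a ha => by rw [show n a = i from ha])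

instance : MeasurableSpace SiteState := ⊤

instance : Countable SiteState :=
  Function.Injective.countable (f := fun s : SiteState => match s with
    | .sleeping => none
    | .active n => some n) fun s s' h => by
      cases s <;> cases s' <;> simp_all

instance {V : Type*} [Countable V] : Countable (Instr V) :=
  Function.Injective.countable (f := fun s : Instr V => match s with
    | .sleep => none
    | .jump y => some y) fun s s' h => by
      cases s <;> cases s' <;> simp_all

instance : DiscreteMeasurableSpace SiteState := ⟨fun _ => trivial⟩

instance {V : Type*} : DiscreteMeasurableSpace (Instr V) := ⟨fun _ => trivial⟩

variable {V : Type*}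

/-- A stage that depends measurably on a parameter. -/
structure MeasurableStage {α : Type*} [MeasurableSpace α] (s : α → Stage V) : Prop where
  config : ∀ x, Measurable fun a => (s a).config x
  used : ∀ x, Measurable fun a => (s a).used x
  clock : ∀ x, Measurable fun a => (s a).clock x
  time : Measurable fun a => (s a).time

theorem MeasurableStage.of_cover {α ι : Type*} [MeasurableSpace α] [Countable ι] {E : ι → Set α}
    (hE : ∀ i, MeasurableSet (E i)) (hcov : ∀ a, ∃ i, a ∈ E i) {f : α → Stage V}
    {g : ι → α → Stage V} (hg : ∀ i, MeasurableStage (g i)) (hfg : ∀ i, ∀ a ∈ E i, f a = g i a) :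
    MeasurableStage f where
  config x := measurable_of_countable_cover hE hcov (fun i => (hg i).config x)
    fun i a ha => by rw [hfg i a ha]
  used x := measurable_of_countable_cover hE hcov (fun i => (hg i).used x)
    fun i a ha => by rw [hfg i a ha]
  clock x := measurable_of_countable_cover hE hcov (fun i => (hg i).clock x)
    fun i a ha => by rw [hfg i a ha]
  time := measurable_of_countable_cover hE hcov (fun i => (hg i).time)
    fun i a ha => by rw [hfg i a ha]

theorem MeasurableStage.numActive {α : Type*} [MeasurableSpace α] {s : α → Stage V}
    (hs : MeasurableStage s) (x : V) : Measurable fun a => ((s a).config x).numActive :=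
  (measurable_of_countable SiteState.numActive).comp (hs.config x)

theorem MeasurableStage.speed {α : Type*} [MeasurableSpace α] {s : α → Stage V}
    (hs : MeasurableStage s) (x : V) :
    Measurable fun a => (((s a).config x).numActive : ℝ) :=
  (measurable_of_countable (fun n : ℕ => (n : ℝ))).comp (hs.numActive x)

theorem measurable_wait (x : V) (j : ℕ) : Measurable fun ω : Sample V => ω.2.2 x j :=
  (measurable_pi_apply j).comp ((measurable_pi_apply x).comp
    (measurable_snd.comp measurable_snd))

theorem measurable_instr (x : V) (j : ℕ) : Measurable fun ω : Sample V => ω.2.1 x j :=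
  (measurable_pi_apply j).comp ((measurable_pi_apply x).comp
    (measurable_fst.comp measurable_snd))

theorem measurable_count (x : V) : Measurable fun ω : Sample V => ω.1 x :=
  (measurable_pi_apply x).comp measurable_fst

theorem choose_congr {α : Type*} {p q : α → Prop} (e : p = q) (h : ∃ x, p x) (h' : ∃ x, q x) :
    h.choose = h'.choose := by
  subst e; rfl

variable [Countable V]

theorem measurable_perform_apply {α : Type*} [MeasurableSpace α] {c : α → V → SiteState}
    {i : α → Instr V} (z y : V) (hc : ∀ x, Measurable fun a => c a x) (hi : Measurable i) :
    Measurable fun a => perform z (c a) (i a) y := by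
  let Ψ : SiteState × SiteState × Instr V → SiteState := fun p =>
    match p.2.2 with
    | .sleep => if y = z then p.1.tryToSleep else p.2.1
    | .jump w => if y = w then (if w = z then p.1.leave else p.2.1).arrive
        else if y = z then p.1.leave else p.2.1
  have e : (fun a => perform z (c a) (i a) y) = fun a => Ψ (c a z, c a y, i a) := by
    funext a
    rcases hia : i a with _ | w
    · simp only [perform, Ψ, Function.update_apply]
    · simp only [perform, Ψ, Function.update_apply]
      by_cases h : y = w
      · subst h; rfl
      · simp only [if_neg h]
  rw [e]
  exact (measurable_of_countable Ψ).comp ((hc z).prodMk ((hc y).prodMk hi))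

theorem MeasurableStage.measurableSet_ringsNext {α : Type*} [MeasurableSpace α] {s : α → Stage V}
    (hs : MeasurableStage s) (x : V) : MeasurableSet {a | (s a).RingsNext x} := by
  have hp : ∀ y, MeasurableSet {a | 0 < ((s a).config y).numActive} := fun y =>
    measurableSet_lt measurable_const (hs.numActive y)
  have e : {a | (s a).RingsNext x} = {a | 0 < ((s a).config x).numActive} ∩
      ⋂ y, ({a | 0 < ((s a).config y).numActive}ᶜ ∪
        {a | (s a).clock x / ((s a).config x).numActive ≤
          (s a).clock y / ((s a).config y).numActive}) := by
    ext a
    simp only [Stage.RingsNext, Set.mem_ofPred_eq, Set.mem_inter_iff, Set.mem_iInter, Set.mem_union,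
      Set.mem_compl_iff, imp_iff_not_or]
  rw [e]
  refine (hp x).inter (MeasurableSet.iInter fun y => (hp y).compl.union ?_)
  exact measurableSet_le ((hs.clock x).div (hs.speed x)) ((hs.clock y).div (hs.speed y))

theorem MeasurableStage.ring {s : Sample V → Stage V} (hs : MeasurableStage s) (x : V) :
    MeasurableStage fun ω => (s ω).ring ω x where
  config y := measurable_perform_apply x y hs.config
    (measurable_apply_of_countable (hs.used x) fun j => measurable_instr x j)
  used y := by
    simp only [Stage.ring, Function.update_apply]
    split_ifs
    · exact (measurable_of_countable fun n : ℕ => n + 1).comp (hs.used x)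
    · exact hs.used y
  clock y := by
    simp only [Stage.ring, Function.update_apply]
    split_ifs
    · exact measurable_apply_of_countable (hs.used x) fun j => measurable_wait x (j + 1)
    · exact (hs.clock y).sub ((hs.speed y).mul ((hs.clock x).div (hs.speed x)))
  time := hs.time.add ((hs.clock x).div (hs.speed x))

/-- The next vertex is picked by choice, but the choice depends only on the set of vertices whose
clock rings next. This set is finite, so there are countably many cases, and in each of them the
vertex is fixed. -/
theorem measurableStage_stage (S : Finset V) (k : ℕ) :
    MeasurableStage fun ω : Sample V => stage ω S k := by
  induction k with
  | zero =>
    refine ⟨fun x => ?_, fun x => measurable_const, fun x => measurable_wait x 0, measurable_const⟩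
    simp only [stage_zero, start]
    refine (measurable_of_countable SiteState.active).comp ?_
    split_ifs
    · exact measurable_count x
    · exact measurable_const
  | succ k ih =>
    simp only [stage_succ]
    refine MeasurableStage.of_cover (ι := Finset V)
      (E := fun F => {ω | ∀ x, x ∈ F ↔ (stage ω S k).RingsNext x})
      (g := fun F ω => if h : ∃ x, x ∈ F then (stage ω S k).ring ω h.choose
        else { stage ω S k with time := (stage ω S k).time + 1 }) ?_ ?_ ?_ ?_
    · intro F
      have e : {ω : Sample V | ∀ x, x ∈ F ↔ (stage ω S k).RingsNext x} =
          ⋂ x, {ω | x ∈ F ↔ (stage ω S k).RingsNext x} := by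
        ext ω; simp
      rw [e]
      refine MeasurableSet.iInter fun x => ?_
      by_cases hx : x ∈ F
      · simpa [hx] using ih.measurableSet_ringsNext x
      · simp only [hx, false_iff]
        exact (ih.measurableSet_ringsNext x).compl
    · intro ω
      have hf : {x | (stage ω S k).RingsNext x}.Finite :=
        (finite_active_stage ω S k).subset fun x hx => hx.1
      exact ⟨hf.toFinset, fun x => by simp⟩
    · intro F
      split_ifs with h
      · exact ih.ring _
      · exact ⟨ih.config, ih.used, ih.clock, ih.time.add measurable_const⟩
    · intro F ω hω
      have hω : ∀ x, x ∈ F ↔ (stage ω S k).RingsNext x := hω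
      have e : (stage ω S k).RingsNext = fun x => x ∈ F := funext fun x => propext (hω x).symm
      by_cases h : ∃ x, x ∈ F
      · have h' : ∃ x, (stage ω S k).RingsNext x := by rwa [e]
        simp only [dif_pos h]
        rw [Stage.next_of_ringsNext _ _ h', choose_congr e h' h]
      · have h' : ¬ ∃ x, (stage ω S k).RingsNext x := by rwa [e]
        simp only [dif_neg h]
        rw [Stage.next_of_not_ringsNext _ _ h']

end Measurability

/-! ## Almost sure regularity -/

section AlmostSure

variable {V : Type*} {G : SimpleGraph V} [G.LocallyFinite] {lam : ℝ≥0} {ν : Measure ℕ}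
  [IsProbabilityMeasure ν]

instance : IsProbabilityMeasure (law G lam ν) := by
  unfold law; infer_instance

theorem measurePreserving_count (x : V) :
    MeasurePreserving (fun ω : Sample V => ω.1 x) (law G lam ν) ν :=
  (measurePreserving_eval_infinitePi (fun _ : V => ν) x).comp measurePreserving_fst

theorem measurePreserving_instr (x : V) (j : ℕ) :
    MeasurePreserving (fun ω : Sample V => ω.2.1 x j) (law G lam ν)
      (instrLaw G lam x).toMeasure :=
  (measurePreserving_eval_infinitePi (fun _ : ℕ => (instrLaw G lam x).toMeasure) j).comp
    ((measurePreserving_eval_infinitePi (fun x : V => Measure.infinitePi fun _ : ℕ =>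
      (instrLaw G lam x).toMeasure) x).comp (measurePreserving_fst.comp measurePreserving_snd))

theorem measurePreserving_wait (x : V) (j : ℕ) :
    MeasurePreserving (fun ω : Sample V => ω.2.2 x j) (law G lam ν) (clockLaw lam) :=
  (measurePreserving_eval_infinitePi (fun _ : ℕ => clockLaw lam) j).comp
    ((measurePreserving_eval_infinitePi (fun _ : V => Measure.infinitePi fun _ : ℕ =>
      clockLaw lam) x).comp (measurePreserving_snd.comp measurePreserving_snd))

/-- The only property of the exponential law that matters below, apart from its being a probability:
waiting times are positive. -/
theorem clockLaw_Iic_zero (lam : ℝ≥0) : clockLaw lam (Set.Iic 0) = 0 := by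
  have hr : (0 : ℝ) < 1 + lam := by positivity
  have h := cdf_expMeasure_eq hr 0
  have : IsProbabilityMeasure (expMeasure (1 + (lam : ℝ))) := isProbabilityMeasure_expMeasure hr
  rw [cdf_eq_real] at h
  simp only [le_refl, if_true, mul_zero, neg_zero, Real.exp_zero, sub_self] at h
  exact (measureReal_eq_zero_iff).1 h

theorem ae_regular [Countable V] (hdeg : ∀ x, 0 < G.degree x) :
    ∀ᵐ ω ∂law G lam ν, Regular G ω := by
  have h1 : ∀ᵐ ω ∂law G lam ν, ∀ x j, ∀ y, ω.2.1 x j = .jump y → G.Adj x y := by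
    refine ae_all_iff.2 fun x => ae_all_iff.2 fun j => ?_
    have hs : (instrLaw G lam x).toMeasure {i | ¬ ∀ y, i = .jump y → G.Adj x y} = 0 := by
      rw [← lintegral_indicator_one (by trivial), lintegral_instrLaw G (hdeg x)]
      have : ∀ y ∈ G.neighborFinset x, ({i | ¬ ∀ y, i = Instr.jump y → G.Adj x y} :
          Set (Instr V)).indicator (1 : Instr V → ℝ≥0∞) (.jump y) = 0 := by
        intro y hy
        rw [Set.indicator_of_notMem]
        simpa using hy
      rw [Finset.sum_eq_zero fun y hy => by rw [this y hy, mul_zero]]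
      simp
    exact (measurePreserving_instr (ν := ν) x j).quasiMeasurePreserving.ae
      (p := fun i => ∀ y, i = .jump y → G.Adj x y) hs
  have h2 : ∀ᵐ ω ∂law G lam ν, ∀ x j, 0 < ω.2.2 x j := by
    refine ae_all_iff.2 fun x => ae_all_iff.2 fun j => ?_
    have hs : clockLaw lam {a | ¬ 0 < a} = 0 := by
      rw [← clockLaw_Iic_zero lam]
      congr 1
      ext a
      simp
    exact (measurePreserving_wait (G := G) (ν := ν) x j).quasiMeasurePreserving.ae
      (p := fun a : ℝ => 0 < a) hs
  filter_upwards [h1, h2] with ω h1 h2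
  exact ⟨h1, h2⟩

/-- Replace the `j`-th waiting time at `x`. -/
def setWait (ω : Sample V) (x : V) (j : ℕ) (a : ℝ) : Sample V := (ω.1, ω.2.1, resample ω.2.2 x j a)

theorem lintegral_setWait (x : V) (j : ℕ) {F : Sample V → ℝ≥0∞} (hF : Measurable F) :
    ∫⁻ ω, F ω ∂law G lam ν =
      ∫⁻ ω, ∫⁻ a, F (setWait ω x j a) ∂clockLaw lam ∂law G lam ν := by
  have hm : Measurable fun p : Sample V × ℝ => setWait p.1 x j p.2 :=
    (measurable_fst.comp measurable_fst).prodMk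
      (((measurable_fst.comp measurable_snd).comp measurable_fst).prodMk
        ((measurable_resample x j).comp
          (((measurable_snd.comp measurable_snd).comp measurable_fst).prodMk measurable_snd)))
  have hG : Measurable fun ω : Sample V => ∫⁻ a, F (setWait ω x j a) ∂clockLaw lam :=
    (hF.comp hm).lintegral_prod_right'
  rw [law, lintegral_prod _ hF.aemeasurable, lintegral_prod _ hG.aemeasurable]
  refine lintegral_congr fun η => ?_
  refine (lintegral_prod _ (hF.comp measurable_prodMk_left).aemeasurable).trans
    (Eq.trans ?_ (lintegral_prod _ (hG.comp measurable_prodMk_left).aemeasurable).symm)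
  refine lintegral_congr fun I => ?_
  exact lintegral_resample (fun _ : V => clockLaw lam) x j
    (hF.comp (measurable_prodMk_left.comp measurable_prodMk_left))

/-- A waiting time is independent of an event that is not affected by changing it. -/
theorem lintegral_wait_of_invariant (x : V) (j : ℕ) {A : Set (Sample V)} (hA : MeasurableSet A)
    (hinv : ∀ ω a, setWait ω x j a ∈ A ↔ ω ∈ A) {f : ℝ → ℝ≥0∞} (hf : Measurable f) :
    ∫⁻ ω, A.indicator 1 ω * f (ω.2.2 x j) ∂law G lam ν =
      law G lam ν A * ∫⁻ a, f a ∂clockLaw lam := by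
  have hi : Measurable (A.indicator (1 : Sample V → ℝ≥0∞)) := measurable_one.indicator hA
  refine (lintegral_setWait x j (hi.mul (hf.comp (measurable_wait x j)))).trans ?_
  have : ∀ ω : Sample V, ∫⁻ a, A.indicator 1 (setWait ω x j a) * f ((setWait ω x j a).2.2 x j)
      ∂clockLaw lam = A.indicator 1 ω * ∫⁻ a, f a ∂clockLaw lam := by
    intro ω
    rw [← lintegral_const_mul _ hf]
    refine lintegral_congr fun a => ?_
    congr 1
    · simp only [Set.indicator, hinv]
      rfl
    · simp [setWait, resample_apply]
  simp only [Pi.mul_apply, Function.comp_apply] at this ⊢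
  simp_rw [this]
  rw [lintegral_mul_const _ hi, lintegral_indicator_one hA]

end AlmostSure

/-! ## The waiting times that have started -/

section Started

variable {V : Type*}

/-- The clock at `x` has started to run for its `j`-th waiting time. -/
def Stage.Started (s : Stage V) (x : V) (j : ℕ) : Prop :=
  j < s.used x ∨ (s.used x = j ∧ 0 < (s.config x).numActive)

theorem Stage.Started.next (ω : Sample V) {s : Stage V} {x : V} {j : ℕ} (h : s.Started x j) :
    (s.next ω).Started x j := by
  rcases s.next_cases ω with ⟨z, hz, e⟩ | ⟨-, e⟩
  · rw [e]
    by_cases hx : x = z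
    · subst hx
      left
      simp only [Stage.ring, Function.update_self]
      rcases h with h | ⟨h, -⟩ <;> omega
    · rcases h with h | ⟨h, h'⟩
      · left
        simpa [Stage.ring, hx] using h
      · right
        refine ⟨by simpa [Stage.ring, hx] using h, h'.trans_le ?_⟩
        exact numActive_perform_ge z s.config _ hx
  · rw [e]
    exact h

theorem Stage.Started.mono {ω : Sample V} {S : Finset V} {x : V} {j k l : ℕ} (hkl : k ≤ l)
    (h : (stage ω S k).Started x j) : (stage ω S l).Started x j := by
  induction l, hkl using Nat.le_induction with
  | base => exact h
  | succ l _ ih => rw [stage_succ]; exact ih.next ω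

/-- The stages agree, except for the clock at `x` if it shows its `j`-th waiting time. -/
structure Stage.Agree (x : V) (j : ℕ) (s s' : Stage V) : Prop where
  config : s.config = s'.config
  used : s.used = s'.used
  time : s.time = s'.time
  clock : ∀ y, (y = x → s.used x ≠ j) → s.clock y = s'.clock y

/-- A waiting time is not consulted before it starts: the comparison of clocks involves only
vertices with active particles, and while the clock at `x` shows an unstarted waiting time, `x` has
none. -/
theorem Stage.Agree.next {x : V} {j : ℕ} {s s' : Stage V} (h : s.Agree x j s')
    (hs : ¬ s.Started x j) (ω : Sample V) (a : ℝ) :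
    (s.next ω).Agree x j (s'.next (setWait ω x j a)) := by
  have hact : ∀ y, 0 < (s.config y).numActive → s.clock y = s'.clock y := fun y hy =>
    h.clock y fun e hu => hs (Or.inr ⟨hu, e ▸ hy⟩)
  have hr : s.RingsNext = s'.RingsNext := by
    funext z
    refine propext ⟨fun hz => ⟨h.config ▸ hz.1, fun y hy => ?_⟩,
      fun hz => ⟨h.config ▸ hz.1, fun y hy => ?_⟩⟩
    · rw [← h.config] at hy ⊢
      rw [← hact z hz.1, ← hact y hy]
      exact hz.2 y hy
    · rw [hact z (h.config ▸ hz.1), hact y hy, h.config]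
      exact hz.2 y (h.config ▸ hy)
  by_cases he : ∃ z, s.RingsNext z
  · have he' : ∃ z, s'.RingsNext z := by rwa [← hr]
    rw [s.next_of_ringsNext ω he, s'.next_of_ringsNext _ he', ← choose_congr hr he he']
    have hz := he.choose_spec
    set z := he.choose
    refine ⟨?_, ?_, ?_, ?_⟩
    · simp only [Stage.ring, setWait, h.config, h.used]
    · simp only [Stage.ring, h.used]
    · simp only [Stage.ring, h.config, h.time, hact z hz.1]
    · intro y hy
      simp only [Stage.ring, Function.update_apply] at hy ⊢
      by_cases hyz : y = z
      · subst hyz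
        rw [if_pos rfl, if_pos rfl, h.used]
        simp only [setWait, resample_apply]
        rw [if_neg]
        rintro ⟨e, hj⟩
        refine hy e ?_
        rw [if_pos e.symm, h.used]
        exact hj
      · rw [if_neg hyz, if_neg hyz, h.config]
        have hcl : s.clock y = s'.clock y := by
          refine h.clock y fun e hu => ?_
          refine hy e ?_
          rw [if_neg (e ▸ hyz)]
          exact hu
        rw [hcl, hact z hz.1]
  · have he' : ¬ ∃ z, s'.RingsNext z := by rwa [← hr]
    rw [s.next_of_not_ringsNext ω he, s'.next_of_not_ringsNext _ he']
    exact ⟨h.config, h.used, by simp [h.time], h.clock⟩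

theorem agree_stage (ω : Sample V) (S : Finset V) (x : V) (j : ℕ) (a : ℝ) (k : ℕ)
    (h : ∀ i < k, ¬ (stage ω S i).Started x j) :
    (stage ω S k).Agree x j (stage (setWait ω x j a) S k) := by
  induction k with
  | zero =>
    refine ⟨rfl, rfl, rfl, fun y hy => ?_⟩
    simp only [stage_zero, start, setWait, resample_apply] at hy ⊢
    rw [if_neg]
    rintro ⟨e, hj⟩
    exact hy e hj
  | succ k ih =>
    rw [stage_succ, stage_succ]
    exact (ih fun i hi => h i (hi.trans (Nat.lt_succ_self k))).next (h k (Nat.lt_succ_self k)) ω a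

/-- The event that the `j`-th waiting time at `x` starts at one of the first `n` stages, before
time `t`. -/
def startedSet (S : Finset V) (n : ℕ) (t : ℝ) (x : V) (j : ℕ) : Set (Sample V) :=
  {ω | ∃ k ≤ n, (stage ω S k).Started x j ∧ ∀ i ≤ k, (stage ω S i).time ≤ t}

theorem setWait_setWait (ω : Sample V) (x : V) (j : ℕ) (a : ℝ) :
    setWait (setWait ω x j a) x j (ω.2.2 x j) = ω := by
  refine Prod.ext rfl (Prod.ext rfl ?_)
  funext y i
  simp only [setWait, resample_apply]
  split_ifs with h
  · rw [h.1, h.2]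
  · rfl

/-- Up to the first stage at which the waiting time has started, both evolutions agree in everything
but that clock; the converse follows by changing the value back. The times of all earlier stages are
part of the event because for an irregular sample they need not increase, and the invariance is
needed for every sample. -/
theorem setWait_mem_startedSet (S : Finset V) (n : ℕ) (t : ℝ) (x : V) (j : ℕ) (ω : Sample V)
    (a : ℝ) : setWait ω x j a ∈ startedSet S n t x j ↔ ω ∈ startedSet S n t x j := by
  have key : ∀ ω a, ω ∈ startedSet S n t x j → setWait ω x j a ∈ startedSet S n t x j := by
    rintro ω a ⟨k, hk, hs, ht⟩
    have hex : ∃ k, (stage ω S k).Started x j := ⟨k, hs⟩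
    have hle : Nat.find hex ≤ k := Nat.find_min' hex hs
    have hag : ∀ i ≤ Nat.find hex, (stage ω S i).Agree x j (stage (setWait ω x j a) S i) :=
      fun i hi => agree_stage ω S x j a i fun l hl => Nat.find_min hex (hl.trans_le hi)
    refine ⟨Nat.find hex, hle.trans hk, ?_, fun i hi => ?_⟩
    · have h := Nat.find_spec hex
      have h' := hag _ le_rfl
      generalize Nat.find hex = l at h h'
      rcases h with h | ⟨h, h1⟩
      · exact Or.inl (h'.used ▸ h)
      · exact Or.inr ⟨h'.used ▸ h, h'.config ▸ h1⟩
    · rw [← (hag i hi).time]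
      exact ht i (hi.trans hle)
  refine ⟨fun h => ?_, key ω a⟩
  have := key _ (ω.2.2 x j) h
  rwa [setWait_setWait] at this

theorem measurableSet_started [Countable V] (S : Finset V) (k : ℕ) (x : V) (j : ℕ) :
    MeasurableSet {ω : Sample V | (stage ω S k).Started x j} := by
  have h := measurableStage_stage S k
  exact (measurableSet_lt measurable_const (h.used x)).union
    ((h.used x (measurableSet_singleton j)).inter
      (measurableSet_lt measurable_const (h.numActive x)))

theorem measurableSet_startedSet [Countable V] (S : Finset V) (n : ℕ) (t : ℝ) (x : V) (j : ℕ) :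
    MeasurableSet (startedSet S n t x j) := by
  have e : startedSet S n t x j = ⋃ k ∈ Set.Iic n, {ω | (stage ω S k).Started x j} ∩
      ⋂ i ∈ Set.Iic k, {ω | (stage ω S i).time ≤ t} := by
    ext ω
    simp only [startedSet, Set.mem_ofPred_eq, Set.mem_iUnion, Set.mem_inter_iff, Set.mem_iInter,
      Set.mem_Iic, exists_prop]
  rw [e]
  refine MeasurableSet.biUnion (Set.to_countable _) fun k _ =>
    (measurableSet_started S k x j).inter (MeasurableSet.biInter (Set.to_countable _) fun i _ => ?_)
  exact measurableSet_le (measurableStage_stage S i).time measurable_const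

/-! ## Truncation at a stage -/

/-- The last of the first `n` stages up to time `t`. -/
def lastStage (ω : Sample V) (S : Finset V) (n : ℕ) (t : ℝ) : ℕ :=
  Nat.findGreatest (fun k => (stage ω S k).time ≤ t) n

/-- The number of instructions used at `x` in the first `n` stages up to time `t`. -/
def usedUpTo (ω : Sample V) (S : Finset V) (n : ℕ) (t : ℝ) (x : V) : ℕ :=
  (stage ω S (lastStage ω S n t)).used x

variable {G : SimpleGraph V} {ω : Sample V} {S : Finset V} {n : ℕ} {t : ℝ}

theorem lastStage_le : lastStage ω S n t ≤ n := Nat.findGreatest_le _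

theorem time_lastStage_le (ht : 0 ≤ t) : (stage ω S (lastStage ω S n t)).time ≤ t :=
  Nat.findGreatest_spec (P := fun k => (stage ω S k).time ≤ t) (Nat.zero_le n)
    (by simpa [time_stage_zero] using ht)

theorem le_lastStage {k : ℕ} (hk : k ≤ n) (h : (stage ω S k).time ≤ t) : k ≤ lastStage ω S n t :=
  Nat.le_findGreatest hk h

theorem lt_time_of_lastStage_lt {k : ℕ} (hk : lastStage ω S n t < k) (hn : k ≤ n) :
    t < (stage ω S k).time :=
  not_le.1 (Nat.findGreatest_is_greatest hk hn)

theorem lastStage_mono_time {t' : ℝ} (h : t ≤ t') : lastStage ω S n t ≤ lastStage ω S n t' :=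
  Nat.findGreatest_mono_left (fun _ hk => le_trans hk h) n

theorem usedUpTo_mono (ω : Sample V) (S : Finset V) (t : ℝ) (x : V) :
    Monotone fun n => usedUpTo ω S n t x := fun _ _ h =>
  used_stage_mono ω S x (Nat.findGreatest_mono_right _ h)

theorem used_stage_le (ω : Sample V) (S : Finset V) (k : ℕ) (x : V) :
    (stage ω S k).used x ≤ k := by
  induction k with
  | zero => exact le_rfl
  | succ k ih =>
    rw [stage_succ]
    rcases (stage ω S k).next_cases ω with ⟨z, -, e⟩ | ⟨-, e⟩
    · rw [e]
      simp only [Stage.ring, Function.update_apply]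
      split_ifs with h
      · subst h; omega
      · omega
    · rw [e]
      exact ih.trans (Nat.le_succ k)

theorem iSup_usedUpTo {ω : Sample V} (hω : Regular G ω) {S : Finset V} (hS : NonExplosive ω S)
    {t : ℝ} (ht : 0 ≤ t) (x : V) :
    ⨆ n, (usedUpTo ω S n t x : ℝ≥0∞) = usedAt ω S t x := by
  refine le_antisymm (iSup_le fun n => ?_) (le_iSup_of_le (index ω S t) ?_)
  · exact_mod_cast used_stage_mono ω S x (le_index hω hS (time_lastStage_le ht))
  · exact_mod_cast used_stage_mono ω S x (le_lastStage le_rfl (time_index_le hω hS ht))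

theorem mem_startedSet_iff (hω : Regular G ω) (ht : 0 ≤ t) (x : V) (j : ℕ) :
    ω ∈ startedSet S n t x j ↔ (stage ω S (lastStage ω S n t)).Started x j := by
  constructor
  · rintro ⟨k, hk, hs, h⟩
    exact hs.mono (le_lastStage hk (h k le_rfl))
  · intro h
    exact ⟨_, lastStage_le, h, fun i hi => (time_stage_mono hω S hi).trans (time_lastStage_le ht)⟩

/-- The waiting times that have started are those of the instructions already used and, if `x` is
active, the one now running. Sums of expectations over `j` thereby become expectations of random
sums. -/
theorem sum_startedSet (hω : Regular G ω) (ht : 0 ≤ t) (x : V) (f : ℕ → ℝ≥0∞) :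
    ∑ j ∈ Finset.range (n + 1), (startedSet S n t x j).indicator 1 ω * f j =
      ∑ j ∈ Finset.range (usedUpTo ω S n t x), f j +
        if 0 < ((stage ω S (lastStage ω S n t)).config x).numActive
          then f (usedUpTo ω S n t x) else 0 := by
  have hle : usedUpTo ω S n t x ≤ n := (used_stage_le _ _ _ _).trans lastStage_le
  have e : ∀ j, (startedSet S n t x j).indicator 1 ω * f j =
      if (stage ω S (lastStage ω S n t)).Started x j then f j else 0 := by
    intro j
    simp only [Set.indicator, mem_startedSet_iff hω ht]
    split_ifs <;> simp
  simp_rw [e]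
  rw [← Finset.sum_filter]
  by_cases ha : 0 < ((stage ω S (lastStage ω S n t)).config x).numActive
  · rw [if_pos ha, ← Finset.sum_range_succ]
    congr 1
    ext j
    simp only [Finset.mem_filter, Finset.mem_range, Stage.Started, ha, and_true]
    unfold usedUpTo at hle ⊢
    omega
  · rw [if_neg ha, add_zero]
    congr 1
    ext j
    simp only [Finset.mem_filter, Finset.mem_range, Stage.Started, ha, and_false, or_false]
    unfold usedUpTo at hle ⊢
    omega

/-- The completed waiting times are covered by the progress of the clock. The running one overshoots
it, and truncation at `δ` keeps this overshoot under control. -/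
theorem sum_wait_le (hω : Regular G ω) (S : Finset V) (n : ℕ) (ht : 0 ≤ t) (x : V) {δ : ℝ} :
    ∑ j ∈ Finset.range (n + 1),
        (startedSet S n t x j).indicator 1 ω * ENNReal.ofReal (min (ω.2.2 x j) δ) ≤
      ENNReal.ofReal ((stage ω S (lastStage ω S n t)).progress ω x) +
        if 0 < ((stage ω S (lastStage ω S n t)).config x).numActive
          then ENNReal.ofReal δ else 0 := by
  rw [sum_startedSet hω ht]
  refine add_le_add ?_ ?_
  · refine le_trans ?_ (ENNReal.ofReal_le_ofReal (waitSum_le_progress hω S (lastStage ω S n t) x))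
    rw [waitSum, ENNReal.ofReal_sum_of_nonneg fun j _ => (hω.wait_pos x j).le]
    exact Finset.sum_le_sum fun j _ => ENNReal.ofReal_le_ofReal (min_le_left _ _)
  · split_ifs
    · exact ENNReal.ofReal_le_ofReal (min_le_right _ _)
    · exact le_rfl

theorem numActive_le_usedUpTo [G.LocallyFinite] (hω : Regular G ω) {k : ℕ}
    (hk : k ≤ lastStage ω S n t) (x : V) : ((stage ω S k).config x).numActive ≤
      initial ω S x + ∑ y ∈ G.neighborFinset x, usedUpTo ω S n t y := by
  refine ((reach_stage ω S k).numActive_le_add hω.valid x).trans ?_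
  gcongr with y hy
  exact used_stage_mono ω S y hk

/-- The clock at `x` advances at most at the speed given by the particles that have been at `x`. -/
theorem progress_le_sum [G.LocallyFinite] (hω : Regular G ω) (S : Finset V) (n : ℕ) {h : ℝ}
    (hh : 0 ≤ h) (x : V) (i : ℕ) :
    (stage ω S (lastStage ω S n (i * h))).progress ω x +
      ((stage ω S (lastStage ω S n (i * h))).config x).numActive *
        (i * h - (stage ω S (lastStage ω S n (i * h))).time) ≤
      ∑ l ∈ Finset.range i, h * ((initial ω S x +
        ∑ y ∈ G.neighborFinset x, usedUpTo ω S n ((l + 1 : ℕ) * h) y : ℕ) : ℝ) := by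
  induction i with
  | zero =>
    have h0 : (stage ω S (lastStage ω S n 0)).time = 0 :=
      le_antisymm (time_lastStage_le le_rfl) (time_stage_mono hω S (Nat.zero_le _))
    have h1 := progress_le_add hω S x (Nat.zero_le (lastStage ω S n 0))
      (M := ((initial ω S x + ∑ y ∈ G.neighborFinset x, usedUpTo ω S n 0 y : ℕ) : ℝ))
      fun j _ hj => by exact_mod_cast numActive_le_usedUpTo hω hj.le x
    rw [progress_zero, h0, time_stage_zero] at h1
    simp only [Nat.cast_zero, zero_mul, h0, sub_zero, mul_zero, add_zero, Finset.range_zero,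
      Finset.sum_empty]
    simpa using h1
  | succ i ih =>
    have hi : (i : ℝ) * h ≤ (i + 1 : ℕ) * h := by gcongr; omega
    have hi0 : 0 ≤ (i : ℝ) * h := by positivity
    rw [Finset.sum_range_succ]
    have h1 := extrapolate_le_add hω S x (lastStage_mono_time (n := n) hi) hi
      (time_lastStage_le (hi0.trans hi))
      (fun hlt => (lt_time_of_lastStage_lt (Nat.lt_succ_self _)
        (Nat.succ_le_of_lt (hlt.trans_le lastStage_le))).le)
      (M := ((initial ω S x +
        ∑ y ∈ G.neighborFinset x, usedUpTo ω S n ((i + 1 : ℕ) * h) y : ℕ) : ℝ))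
      fun j _ hj => by exact_mod_cast numActive_le_usedUpTo hω hj x
    have h2 : ((i + 1 : ℕ) : ℝ) * h - i * h = h := by push_cast; ring
    rw [h2] at h1
    linarith

theorem measurable_lastStage [Countable V] (S : Finset V) (n : ℕ) (t : ℝ) :
    Measurable fun ω : Sample V => lastStage ω S n t :=
  measurable_findGreatest fun k _ =>
    measurableSet_le (measurableStage_stage S k).time measurable_const

theorem measurable_usedUpTo [Countable V] (S : Finset V) (n : ℕ) (t : ℝ) (x : V) :
    Measurable fun ω : Sample V => usedUpTo ω S n t x :=
  measurable_apply_of_countable (measurable_lastStage S n t)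
    fun k => (measurableStage_stage S k).used x

theorem measurableSet_active [Countable V] (S : Finset V) (n : ℕ) (t : ℝ) (x : V) :
    MeasurableSet {ω : Sample V |
      0 < ((stage ω S (lastStage ω S n t)).config x).numActive} :=
  measurableSet_lt measurable_const (measurable_apply_of_countable (measurable_lastStage S n t)
    fun k => (measurableStage_stage S k).numActive x)

theorem measurable_progress [Countable V] (S : Finset V) (n : ℕ) (t : ℝ) (x : V) :
    Measurable fun ω : Sample V => (stage ω S (lastStage ω S n t)).progress ω x :=
  measurable_apply_of_countable (measurable_lastStage S n t)
    fun k => (measurable_apply_of_countable ((measurableStage_stage S k).used x)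
      fun j => Finset.measurable_sum (Finset.range (j + 1)) fun i _ => measurable_wait x i).sub
        ((measurableStage_stage S k).clock x)

theorem measurable_natCast {α : Type*} [MeasurableSpace α] {f : α → ℕ} (hf : Measurable f) :
    Measurable fun a => (f a : ℝ≥0∞) :=
  (measurable_of_countable fun n : ℕ => (n : ℝ≥0∞)).comp hf

theorem measurable_initial (S : Finset V) (x : V) :
    Measurable fun ω : Sample V => initial ω S x := by
  unfold initial
  split_ifs
  · exact measurable_count x
  · exact measurable_const

end Started

/-! ## Bounds in the mean -/

section Mean

variable {V : Type*} {G : SimpleGraph V} [G.LocallyFinite] {lam : ℝ≥0} {ν : Measure ℕ}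
  [IsProbabilityMeasure ν]

/-- The mean number of instructions used at `x` in the first `n` stages up to time `t`. -/
def meanUsed (G : SimpleGraph V) [G.LocallyFinite] (lam : ℝ≥0) (ν : Measure ℕ)
    [IsProbabilityMeasure ν] (S : Finset V) (n : ℕ) (t : ℝ) (x : V) : ℝ≥0∞ :=
  ∫⁻ ω, (usedUpTo ω S n t x : ℝ≥0∞) ∂law G lam ν

/-- The mean initial number of particles at `x`, if only those in `S` are present. -/
def meanInitial (ν : Measure ℕ) (S : Finset V) (x : V) : ℝ≥0∞ :=
  if x ∈ S then ∫⁻ k, (k : ℝ≥0∞) ∂ν else 0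

theorem lintegral_initial (S : Finset V) (x : V) :
    ∫⁻ ω, (initial ω S x : ℝ≥0∞) ∂law G lam ν = meanInitial ν S x := by
  unfold initial meanInitial
  split_ifs with h
  · exact (measurePreserving_count x).lintegral_comp
      (f := fun k : ℕ => (k : ℝ≥0∞)) (measurable_of_countable _)
  · simp

theorem lintegral_initial_add_usedUpTo [Countable V]
    (S : Finset V) (n : ℕ) (t : ℝ) (x : V) :
    ∫⁻ ω, ((initial ω S x + ∑ y ∈ G.neighborFinset x, usedUpTo ω S n t y : ℕ) : ℝ≥0∞)
      ∂law G lam ν = meanInitial ν S x + ∑ y ∈ G.neighborFinset x, meanUsed G lam ν S n t y := by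
  push_cast
  rw [lintegral_add_left (measurable_natCast (measurable_initial S x)), lintegral_initial,
    lintegral_finsetSum _ fun y _ => measurable_natCast (measurable_usedUpTo S n t y)]
  rfl

/-- Markov's inequality: an active vertex received a particle from the start or from an instruction
used at a neighbour. -/
theorem law_active_le [Countable V] (hreg : ∀ᵐ ω ∂law G lam ν, Regular G ω)
    (S : Finset V) (n : ℕ) (t : ℝ) (x : V) :
    law G lam ν {ω | 0 < ((stage ω S (lastStage ω S n t)).config x).numActive} ≤
      meanInitial ν S x + ∑ y ∈ G.neighborFinset x, meanUsed G lam ν S n t y := by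
  rw [← lintegral_initial_add_usedUpTo, ← lintegral_indicator_one (measurableSet_active S n t x)]
  refine lintegral_mono_ae (hreg.mono fun ω hω => ?_)
  by_cases h : 0 < ((stage ω S (lastStage ω S n t)).config x).numActive
  · rw [Set.indicator_of_mem (by exact h)]
    have := numActive_le_usedUpTo hω (le_refl (lastStage ω S n t)) x
    rw [Pi.one_apply]
    exact_mod_cast h.trans_le this
  · rw [Set.indicator_of_notMem (by exact h)]
    exact zero_le

/-- Wald's identity for the started waiting times, as an inequality. -/
theorem mul_meanUsed_le [Countable V] (hreg : ∀ᵐ ω ∂law G lam ν, Regular G ω) (S : Finset V)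
    (n : ℕ) {δ h : ℝ} (hh : 0 ≤ h) {m r : ℝ≥0∞}
    (hm : m = ∫⁻ a, ENNReal.ofReal (min a δ) ∂clockLaw lam) (hmr : ENNReal.ofReal δ ≤ m + r)
    (hm' : m ≠ ∞) (i : ℕ) (x : V) :
    m * meanUsed G lam ν S n (i * h) x ≤
      ∑ l ∈ Finset.range i, ENNReal.ofReal h * (meanInitial ν S x +
        ∑ y ∈ G.neighborFinset x, meanUsed G lam ν S n ((l + 1 : ℕ) * h) y) +
      r * (meanInitial ν S x + ∑ y ∈ G.neighborFinset x, meanUsed G lam ν S n (i * h) y) := by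
  set t : ℝ := i * h with htdef
  have ht : 0 ≤ t := by positivity
  set P := law G lam ν {ω | 0 < ((stage ω S (lastStage ω S n t)).config x).numActive} with hP
  have hP1 : P ≠ ∞ := measure_ne_top _ _
  have hf : Measurable fun a : ℝ => ENNReal.ofReal (min a δ) := by fun_prop
  have hact : ∀ c : ℝ≥0∞, ∫⁻ ω, (if 0 < ((stage ω S (lastStage ω S n t)).config x).numActive
      then c else 0) ∂law G lam ν = c * P := fun c => by
    have := lintegral_indicator_const (μ := law G lam ν) (measurableSet_active S n t x) c
    rw [← this]
    refine lintegral_congr fun ω => ?_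
    simp only [Set.indicator, Set.mem_ofPred_eq]
  have hs := fun j => measurableSet_startedSet S n t x j
  have h1 : ∑ j ∈ Finset.range (n + 1), law G lam ν (startedSet S n t x j) =
      meanUsed G lam ν S n t x + P := by
    have e : ∀ᵐ ω ∂law G lam ν, ∑ j ∈ Finset.range (n + 1),
        (startedSet S n t x j).indicator 1 ω = (usedUpTo ω S n t x : ℝ≥0∞) +
          if 0 < ((stage ω S (lastStage ω S n t)).config x).numActive then 1 else 0 := by
      filter_upwards [hreg] with ω hω
      have := sum_startedSet (S := S) (n := n) hω ht x fun _ => 1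
      simpa using this
    calc _ = ∫⁻ ω, ∑ j ∈ Finset.range (n + 1), (startedSet S n t x j).indicator 1 ω
          ∂law G lam ν := by
            rw [lintegral_finsetSum _ fun j _ => measurable_one.indicator (hs j)]
            exact Finset.sum_congr rfl fun j _ => (lintegral_indicator_one (hs j)).symm
      _ = _ := by
            rw [lintegral_congr_ae e,
              lintegral_add_left (measurable_natCast (measurable_usedUpTo S n t x)), hact, one_mul]
            rfl
  have h2 : ∑ j ∈ Finset.range (n + 1), law G lam ν (startedSet S n t x j) * m ≤
      ∫⁻ ω, ENNReal.ofReal ((stage ω S (lastStage ω S n t)).progress ω x) ∂law G lam ν +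
        ENNReal.ofReal δ * P := by
    rw [← hact, ← lintegral_add_left (measurable_progress S n t x).ennreal_ofReal]
    have e : ∀ j, law G lam ν (startedSet S n t x j) * m = ∫⁻ ω,
        (startedSet S n t x j).indicator 1 ω * ENNReal.ofReal (min (ω.2.2 x j) δ)
          ∂law G lam ν := fun j => by
      rw [hm, lintegral_wait_of_invariant x j (hs j)
        (fun ω a => setWait_mem_startedSet S n t x j ω a) hf]
    simp_rw [e]
    refine (lintegral_finsetSum (Finset.range (n + 1)) fun j _ => (measurable_one.indicator
      (hs j)).mul (hf.comp (measurable_wait x j))).symm.trans_le ?_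
    exact lintegral_mono_ae (hreg.mono fun ω hω => sum_wait_le hω S n ht x)
  have h3 : ∫⁻ ω, ENNReal.ofReal ((stage ω S (lastStage ω S n t)).progress ω x) ∂law G lam ν ≤
      ∑ l ∈ Finset.range i, ENNReal.ofReal h * (meanInitial ν S x +
        ∑ y ∈ G.neighborFinset x, meanUsed G lam ν S n ((l + 1 : ℕ) * h) y) := by
    have hmeas : ∀ l : ℕ, Measurable fun ω : Sample V => ((initial ω S x +
        ∑ y ∈ G.neighborFinset x, usedUpTo ω S n ((l + 1 : ℕ) * h) y : ℕ) : ℝ≥0∞) := fun l =>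
      measurable_natCast ((measurable_initial S x).add
        (Finset.measurable_sum _ fun y _ => measurable_usedUpTo S n _ y))
    calc _ ≤ ∫⁻ ω, ∑ l ∈ Finset.range i, ENNReal.ofReal h * ((initial ω S x +
          ∑ y ∈ G.neighborFinset x, usedUpTo ω S n ((l + 1 : ℕ) * h) y : ℕ) : ℝ≥0∞)
            ∂law G lam ν := by
          refine lintegral_mono_ae (hreg.mono fun ω hω => ?_)
          have h1 := progress_le_sum hω S n hh x i
          have h2 : 0 ≤ (((stage ω S (lastStage ω S n (i * h))).config x).numActive : ℝ) *
              (i * h - (stage ω S (lastStage ω S n (i * h))).time) :=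
            mul_nonneg (Nat.cast_nonneg _) (sub_nonneg.2 (time_lastStage_le ht))
          refine (ENNReal.ofReal_le_ofReal (by linarith :
            (stage ω S (lastStage ω S n t)).progress ω x ≤ _)).trans_eq ?_
          rw [ENNReal.ofReal_sum_of_nonneg fun l _ => mul_nonneg hh (Nat.cast_nonneg _)]
          refine Finset.sum_congr rfl fun l _ => ?_
          rw [ENNReal.ofReal_mul hh, ENNReal.ofReal_natCast]
      _ = _ := by
          rw [lintegral_finsetSum _ fun l _ => (hmeas l).const_mul _]
          refine Finset.sum_congr rfl fun l _ => ?_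
          rw [lintegral_const_mul _ (hmeas l), lintegral_initial_add_usedUpTo]
  rw [← Finset.sum_mul, h1] at h2
  -- Wald's identity counts the running waiting time as well, which contributes `m * P` on the left.
  -- The overshoot on the right is at most `(m + r) * P`, so after cancelling the finite `m * P`
  -- only the small `r * P` remains.
  have h4 : m * meanUsed G lam ν S n t x + m * P ≤
      (∫⁻ ω, ENNReal.ofReal ((stage ω S (lastStage ω S n t)).progress ω x) ∂law G lam ν +
        r * P) + m * P := by
    calc m * meanUsed G lam ν S n t x + m * P = (meanUsed G lam ν S n t x + P) * m := by ring
      _ ≤ _ := h2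
      _ ≤ ∫⁻ ω, ENNReal.ofReal ((stage ω S (lastStage ω S n t)).progress ω x) ∂law G lam ν +
          (m + r) * P := by gcongr
      _ = _ := by ring
  have h5 := (ENNReal.add_le_add_iff_right (ENNReal.mul_ne_top hm' hP1)).1 h4
  exact h5.trans (add_le_add h3 (by gcongr; exact law_active_le hreg S n t x))

end Mean

/-! ## A Gronwall bound, uniform in the finite set of particles -/

section Gronwall

/-- A positive waiting time exceeds `δ` with probability near one if `δ` is small, so its truncation
at `δ` has mean `m` close to `δ`, and `r = δ - m` is small compared with `m`. The two factors `1/4`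
leave half of `m` for the absorption in `gronwall`. -/
theorem exists_clock_constants (lam D : ℝ≥0) : ∃ (δ h : ℝ) (m r : ℝ≥0∞), 0 < h ∧
    m = ∫⁻ a, ENNReal.ofReal (min a δ) ∂clockLaw lam ∧ m ≠ 0 ∧ m ≠ ∞ ∧ r ≠ ∞ ∧
    ENNReal.ofReal δ ≤ m + r ∧ r * D ≤ m / 4 ∧ ENNReal.ofReal h * D ≤ m / 4 := by
  have hmono : Monotone fun n : ℕ => Set.Ici (1 / ((n : ℝ) + 1)) := fun a b hab =>
    Set.Ici_subset_Ici.2 (one_div_le_one_div_of_le (by positivity) (by gcongr))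
  have hU : (⋃ n : ℕ, Set.Ici (1 / ((n : ℝ) + 1))) = Set.Ioi 0 := by
    ext a
    simp only [Set.mem_iUnion, Set.mem_Ici, Set.mem_Ioi]
    constructor
    · rintro ⟨n, hn⟩
      exact lt_of_lt_of_le (by positivity) hn
    · intro ha
      obtain ⟨n, hn⟩ := exists_nat_one_div_lt ha
      exact ⟨n, hn.le⟩
  have h1 : clockLaw lam (Set.Ioi 0) = 1 := by
    have := prob_compl_eq_one_sub (μ := clockLaw lam) (measurableSet_Iic (a := (0 : ℝ)))
    rwa [Set.compl_Iic, clockLaw_Iic_zero, tsub_zero] at this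
  have hlim := tendsto_measure_iUnion_atTop (μ := clockLaw lam) hmono
  rw [hU, h1] at hlim
  have hlim' := (ENNReal.tendsto_toReal ENNReal.one_ne_top).comp hlim
  have hD : (0 : ℝ) ≤ D := D.2
  -- With `p` the probability of exceeding `δ`, the condition `p > 1 - 1 / (4 D + 1)` says `4 (1 -
  -- p) D < p`; multiplied by `δ` it bounds `4 r D` by `m`.
  have hlt : 1 - 1 / (4 * (D : ℝ) + 1) < (1 : ℝ≥0∞).toReal := by
    have : (0 : ℝ) < 1 / (4 * (D : ℝ) + 1) := by positivity
    simp only [ENNReal.toReal_one]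
    linarith
  obtain ⟨n, hn⟩ := (hlim'.eventually_const_lt hlt).exists
  simp only [Function.comp_apply] at hn
  set δ : ℝ := 1 / ((n : ℝ) + 1) with hδ
  have hδ0 : 0 < δ := by positivity
  set p : ℝ := (clockLaw lam (Set.Ici δ)).toReal with hp
  have hp0 : 0 < p := by
    refine lt_of_le_of_lt ?_ hn
    have : 1 / (4 * (D : ℝ) + 1) ≤ 1 := by
      rw [div_le_one (by positivity)]; linarith
    linarith
  set m : ℝ≥0∞ := ∫⁻ a, ENNReal.ofReal (min a δ) ∂clockLaw lam with hm
  have hmle : m ≤ ENNReal.ofReal δ := by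
    calc m ≤ ∫⁻ _, ENNReal.ofReal δ ∂clockLaw lam :=
          lintegral_mono fun a => ENNReal.ofReal_le_ofReal (min_le_right _ _)
      _ = _ := by simp
  have hmt : m ≠ ∞ := ne_top_of_le_ne_top ENNReal.ofReal_ne_top hmle
  have hmge : ENNReal.ofReal (δ * p) ≤ m := by
    calc ENNReal.ofReal (δ * p) = ∫⁻ a in Set.Ici δ, ENNReal.ofReal δ ∂clockLaw lam := by
          rw [setLIntegral_const, ENNReal.ofReal_mul hδ0.le, hp,
            ENNReal.ofReal_toReal (measure_ne_top _ _)]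
      _ ≤ ∫⁻ a in Set.Ici δ, ENNReal.ofReal (min a δ) ∂clockLaw lam := by
          refine setLIntegral_mono (by fun_prop) fun a ha => ?_
          rw [min_eq_right ha]
      _ ≤ m := setLIntegral_le_lintegral _ _
  set M := m.toReal with hM
  have hmM : m = ENNReal.ofReal M := (ENNReal.ofReal_toReal hmt).symm
  have hM1 : δ * p ≤ M := by
    rwa [hmM, ENNReal.ofReal_le_ofReal_iff ENNReal.toReal_nonneg] at hmge
  have hM0 : 0 < M := lt_of_lt_of_le (by positivity) hM1
  have hM4 : m / 4 = ENNReal.ofReal (M / 4) := by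
    rw [hmM, ENNReal.ofReal_div_of_pos (by norm_num)]
    norm_num
  have hDD : (D : ℝ≥0∞) = ENNReal.ofReal D := (ENNReal.ofReal_coe_nnreal).symm
  refine ⟨δ, M / (4 * (D + 1)), m, ENNReal.ofReal (δ - M), by positivity, rfl, ?_, hmt,
    ENNReal.ofReal_ne_top, ?_, ?_, ?_⟩
  · rw [hmM]; simpa using hM0
  · rw [hmM, ← ENNReal.ofReal_add hM0.le]
    · simp
    · rw [hmM, ENNReal.ofReal_le_ofReal_iff hδ0.le] at hmle
      linarith
  · rw [hM4, hDD, ← ENNReal.ofReal_mul' hD]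
    refine ENNReal.ofReal_le_ofReal ?_
    have h3 : (1 - p) * (4 * D + 1) ≤ 1 := by
      have h4 : 1 - p ≤ 1 / (4 * (D : ℝ) + 1) := by linarith
      rwa [le_div_iff₀ (by positivity)] at h4
    have h5 : 4 * (δ * (1 - p) * D) ≤ δ * p := by nlinarith
    have h6 : (δ - M) * D ≤ δ * (1 - p) * D := by
      refine mul_le_mul_of_nonneg_right ?_ hD
      linarith
    linarith
  · rw [hM4, hDD, ← ENNReal.ofReal_mul' hD]
    refine ENNReal.ofReal_le_ofReal ?_
    rw [div_mul_eq_mul_div, div_le_div_iff₀ (by positivity) (by norm_num)]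
    nlinarith

variable {V : Type*} {G : SimpleGraph V} [G.LocallyFinite]

/-- The adjacency operator is symmetric, so the sum over neighbours can be moved onto the weight. -/
theorem tsum_mul_sum_neighbor_le {w : V → ℝ≥0∞} {D : ℝ≥0∞}
    (hw : ∀ y, ∑ x ∈ G.neighborFinset y, w x ≤ D * w y) (e : V → ℝ≥0∞) :
    ∑' x, w x * ∑ y ∈ G.neighborFinset x, e y ≤ D * ∑' y, w y * e y := by
  have h1 : ∀ (f : V → ℝ≥0∞) (x : V),
      ∑ y ∈ G.neighborFinset x, f y = ∑' y, if G.Adj x y then f y else 0 := by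
    intro f x
    rw [tsum_eq_sum (s := G.neighborFinset x)]
    · exact Finset.sum_congr rfl fun y hy => by
        rw [if_pos ((G.mem_neighborFinset x y).1 hy)]
    · intro y hy
      rw [if_neg fun h => hy ((G.mem_neighborFinset x y).2 h)]
  calc ∑' x, w x * ∑ y ∈ G.neighborFinset x, e y
      = ∑' x, ∑' y, (if G.Adj y x then w x else 0) * e y := by
        refine tsum_congr fun x => ?_
        rw [h1, ← ENNReal.tsum_mul_left]
        refine tsum_congr fun y => ?_
        simp only [G.adj_comm x y]
        split_ifs <;> simp
    _ = ∑' y, (∑ x ∈ G.neighborFinset y, w x) * e y := by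
        rw [ENNReal.tsum_comm]
        refine tsum_congr fun y => ?_
        rw [ENNReal.tsum_mul_right, h1]
    _ ≤ ∑' y, D * (w y * e y) := by
        refine ENNReal.tsum_le_tsum fun y => ?_
        rw [← mul_assoc]
        gcongr
        exact hw y
    _ = _ := ENNReal.tsum_mul_left

theorem tsum_used_ring (s : Stage V) (ω : Sample V) (z : V) :
    ∑' x, ((s.ring ω z).used x : ℝ≥0∞) = ∑' x, (s.used x : ℝ≥0∞) + 1 := by
  have : ∀ x, ((s.ring ω z).used x : ℝ≥0∞) = s.used x + if x = z then 1 else 0 := by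
    intro x
    simp only [Stage.ring, Function.update_apply]
    split_ifs with h
    · subst h; push_cast; rfl
    · simp
  simp_rw [this]
  rw [ENNReal.tsum_add, tsum_ite_eq]

theorem tsum_used_stage_le (ω : Sample V) (S : Finset V) (k : ℕ) :
    ∑' x, ((stage ω S k).used x : ℝ≥0∞) ≤ k := by
  induction k with
  | zero => simp [stage_zero, start]
  | succ k ih =>
    rw [stage_succ]
    rcases (stage ω S k).next_cases ω with ⟨z, -, e⟩ | ⟨-, e⟩
    · rw [e, tsum_used_ring]
      push_cast
      gcongr
    · rw [e]
      exact ih.trans (by simp)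

/-- Once no clock rings the evolution idles for ever and time grows by one per stage. Bounded times
thus mean that every stage is a ring and uses exactly one instruction. -/
theorem tsum_used_stage_eq (ω : Sample V) (S : Finset V) {B : ℝ}
    (hB : ∀ k, (stage ω S k).time ≤ B) (k : ℕ) :
    ∑' x, ((stage ω S k).used x : ℝ≥0∞) = k := by
  have hring : ∀ k, ∃ z, (stage ω S k).RingsNext z := by
    intro k
    by_contra h
    have hk : ∀ i : ℕ, stage ω S (k + i) =
        { stage ω S k with time := (stage ω S k).time + i } := by
      intro i
      induction i with
      | zero => simp
      | succ i ih =>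
        rw [← add_assoc, stage_succ, Stage.next_of_not_ringsNext, ih]
        · push_cast
          simp [add_assoc]
        · rw [ih]
          exact h
    obtain ⟨i, hi⟩ := exists_nat_gt (B - (stage ω S k).time)
    have := hB (k + i)
    rw [hk] at this
    simp only at this
    linarith
  induction k with
  | zero => simp [stage_zero, start]
  | succ k ih =>
    rw [stage_succ, Stage.next_of_ringsNext _ _ (hring k), tsum_used_ring, ih]
    push_cast
    rfl

theorem tsum_meanInitial (ν : Measure ℕ) (S : Finset V) :
    ∑' x, meanInitial ν S x = S.card * ∫⁻ k, (k : ℝ≥0∞) ∂ν := by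
  unfold meanInitial
  rw [tsum_eq_sum (s := S) fun x hx => if_neg hx, Finset.sum_ite_mem]
  simp

/-- The weight of `x` in the discounted Green function of the graph at `o`. -/
def greenTerm (G : SimpleGraph V) [G.LocallyFinite] (d : ℕ) (o : V) : ℕ → V → ℝ≥0∞
  | 0 => fun x => if x = o then 1 else 0
  | n + 1 => fun x => (2 * d : ℝ≥0∞)⁻¹ * ∑ y ∈ G.neighborFinset x, greenTerm G d o n y

/-- The Green function of simple random walk with survival probability `1/2` per step: its total
mass is a geometric series, and dropping the zeroth term gives the inequality for neighbour sums. It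
is a summable weight that charges `o`. -/
theorem exists_weight {d : ℕ} (hd : ∀ x, G.degree x = d) (hd0 : 0 < d) (o : V) :
    ∃ w : V → ℝ≥0∞, 1 ≤ w o ∧ ∑' x, w x ≤ 2 ∧
      ∀ y, ∑ x ∈ G.neighborFinset y, w x ≤ (2 * d : ℝ≥0∞) * w y := by
  have hd1 : (d : ℝ≥0∞) ≠ 0 := by exact_mod_cast hd0.ne'
  have hd2 : (2 * d : ℝ≥0∞) ≠ 0 := mul_ne_zero two_ne_zero hd1
  have hd3 : (2 * d : ℝ≥0∞) ≠ ∞ := ENNReal.mul_ne_top ENNReal.ofNat_ne_top (ENNReal.natCast_ne_top d)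
  refine ⟨fun x => ∑' n, greenTerm G d o n x, ?_, ?_, fun y => ?_⟩
  · refine le_trans ?_ (ENNReal.le_tsum 0)
    simp [greenTerm]
  · rw [ENNReal.tsum_comm]
    have : ∀ n, ∑' x, greenTerm G d o n x ≤ 2⁻¹ ^ n := by
      intro n
      induction n with
      | zero => simp [greenTerm, tsum_ite_eq]
      | succ n ih =>
        simp only [greenTerm]
        rw [ENNReal.tsum_mul_left]
        have h := tsum_mul_sum_neighbor_le (G := G) (w := fun _ => 1) (D := d)
          (fun y => by simp [hd]) (greenTerm G d o n)
        simp only [one_mul] at h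
        calc _ ≤ (2 * d : ℝ≥0∞)⁻¹ * (d * 2⁻¹ ^ n) := by
              gcongr
              exact h.trans (by gcongr)
          _ = _ := by
              rw [ENNReal.mul_inv (by simp) (by simp), mul_assoc, ← mul_assoc _ (d : ℝ≥0∞),
                ENNReal.inv_mul_cancel hd1 (ENNReal.natCast_ne_top d), one_mul, pow_succ']
    calc _ ≤ ∑' n, (2⁻¹ : ℝ≥0∞) ^ n := ENNReal.tsum_le_tsum this
      _ = 2 := by rw [ENNReal.tsum_geometric, ENNReal.one_sub_inv_two, inv_inv]
  · rw [← Summable.tsum_finsetSum fun _ _ => ENNReal.summable]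
    calc ∑' n, ∑ x ∈ G.neighborFinset y, greenTerm G d o n x
        = ∑' n, (2 * d : ℝ≥0∞) * greenTerm G d o (n + 1) y := by
          refine tsum_congr fun n => ?_
          rw [greenTerm, ← mul_assoc, ENNReal.mul_inv_cancel hd2 hd3, one_mul]
      _ = (2 * d : ℝ≥0∞) * ∑' n, greenTerm G d o (n + 1) y := ENNReal.tsum_mul_left
      _ ≤ _ := by
          gcongr
          exact ENNReal.tsum_comp_le_tsum_of_injective (Nat.succ_injective) _

variable [Countable V] {lam : ℝ≥0} {ν : Measure ℕ} [IsProbabilityMeasure ν]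

theorem tsum_meanUsed (S : Finset V) (n : ℕ) (t : ℝ) :
    ∑' x, meanUsed G lam ν S n t x =
      ∫⁻ ω, ∑' x, (usedUpTo ω S n t x : ℝ≥0∞) ∂law G lam ν :=
  (lintegral_tsum fun x => (measurable_natCast (measurable_usedUpTo S n t x)).aemeasurable).symm

theorem tsum_meanUsed_le (S : Finset V) (n : ℕ) (t : ℝ) :
    ∑' x, meanUsed G lam ν S n t x ≤ n := by
  rw [tsum_meanUsed]
  calc _ ≤ ∫⁻ _, (n : ℝ≥0∞) ∂law G lam ν := lintegral_mono fun ω =>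
        (tsum_used_stage_le ω S _).trans (by exact_mod_cast lastStage_le)
    _ = n := by simp

/-- Summing Wald's inequality against `w` closes it into a scalar inequality for `W i = ∑' x, w x *
meanUsed … (i * h) x`, in which the newest term `W i` also stands on the right, with coefficient at
most `m / 2`, and is absorbed. The constant `K` depends on neither `w`, `S` nor `n`, which later
permits `n → ∞` and then `S` to grow. -/
theorem gronwall (hreg : ∀ᵐ ω ∂law G lam ν, Regular G ω) (D : ℝ≥0) :
    ∃ h : ℝ, 0 < h ∧ ∀ i : ℕ, ∃ K : ℝ≥0∞, K ≠ ∞ ∧ ∀ (w : V → ℝ≥0∞) (B : ℝ≥0∞), B ≠ ∞ →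
      (∀ x, w x ≤ B) → (∀ y, ∑ x ∈ G.neighborFinset y, w x ≤ D * w y) → ∀ S n,
        ∑' x, w x * meanUsed G lam ν S n (i * h) x ≤ K * ∑' x, w x * meanInitial ν S x := by
  obtain ⟨δ, h, m, r, hh, hm, hm0, hmt, hrt, hδ, hrD, hhD⟩ := exists_clock_constants lam D
  refine ⟨h, hh, ?_⟩
  suffices ∀ i : ℕ, ∃ K : ℝ≥0∞, K ≠ ∞ ∧ ∀ (w : V → ℝ≥0∞) (B : ℝ≥0∞), B ≠ ∞ →
      (∀ x, w x ≤ B) → (∀ y, ∑ x ∈ G.neighborFinset y, w x ≤ D * w y) → ∀ S n, ∀ l < i,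
        ∑' x, w x * meanUsed G lam ν S n (l * h) x ≤ K * ∑' x, w x * meanInitial ν S x by
    intro i
    obtain ⟨K, hK, H⟩ := this (i + 1)
    exact ⟨K, hK, fun w B hB hwB hw S n => H w B hB hwB hw S n i (Nat.lt_succ_self i)⟩
  intro i
  induction i with
  | zero => exact ⟨0, ENNReal.zero_ne_top, fun _ _ _ _ _ _ _ l hl => absurd hl (Nat.not_lt_zero l)⟩
  | succ i ih =>
    obtain ⟨K, hK, H⟩ := ih
    have hm2 : m / 2 ≠ 0 := ENNReal.div_ne_zero.2 ⟨hm0, by norm_num⟩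
    have hm2t : m / 2 ≠ ∞ := ENNReal.div_ne_top hmt (by norm_num)
    have hm4t : m / 4 ≠ ∞ := ENNReal.div_ne_top hmt (by norm_num)
    refine ⟨max K ((i * ENNReal.ofReal h + r + m / 4 * (i * K)) / (m / 2)), ?_, ?_⟩
    · refine (max_lt hK.lt_top (ENNReal.div_lt_top ?_ hm2)).ne
      exact ENNReal.add_ne_top.2 ⟨ENNReal.add_ne_top.2 ⟨ENNReal.mul_ne_top (ENNReal.natCast_ne_top i)
        ENNReal.ofReal_ne_top, hrt⟩, ENNReal.mul_ne_top hm4t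
          (ENNReal.mul_ne_top (ENNReal.natCast_ne_top i) hK)⟩
    intro w B hB hwB hw S n l hl
    have H' := H w B hB hwB hw S n
    rcases Nat.lt_succ_iff_lt_or_eq.1 hl with hl | rfl
    · exact (H' l hl).trans (by gcongr; exact le_max_left _ _)
    set A := ∑' x, w x * meanInitial ν S x with hA
    set W : ℕ → ℝ≥0∞ := fun l => ∑' x, w x * meanUsed G lam ν S n (l * h) x with hW
    -- Absorption needs a finite term. This is the reason for cutting off after `n` stages and for a
    -- bounded weight.
    have hWt : ∀ l, W l ≠ ∞ := fun l => by
      refine ne_top_of_le_ne_top (ENNReal.mul_ne_top hB (ENNReal.natCast_ne_top n)) ?_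
      calc W l ≤ ∑' x, B * meanUsed G lam ν S n (l * h) x :=
            ENNReal.tsum_le_tsum fun x => by gcongr; exact hwB x
        _ ≤ _ := by rw [ENNReal.tsum_mul_left]; gcongr; exact tsum_meanUsed_le S n _
    have hnb : ∀ i : ℕ, ∑' x, w x * (meanInitial ν S x +
        ∑ y ∈ G.neighborFinset x, meanUsed G lam ν S n (i * h) y) ≤ A + D * W i := fun i => by
      simp_rw [mul_add]
      rw [ENNReal.tsum_add]
      gcongr
      exact tsum_mul_sum_neighbor_le hw _
    have key : m * W l ≤ ∑ j ∈ Finset.range l, ENNReal.ofReal h * (A + D * W (j + 1)) +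
        r * (A + D * W l) := by
      calc m * W l = ∑' x, w x * (m * meanUsed G lam ν S n (l * h) x) := by
            rw [hW, ← ENNReal.tsum_mul_left]
            exact tsum_congr fun x => by ring
        _ ≤ ∑' x, w x * (∑ j ∈ Finset.range l, ENNReal.ofReal h * (meanInitial ν S x +
              ∑ y ∈ G.neighborFinset x, meanUsed G lam ν S n ((j + 1 : ℕ) * h) y) +
            r * (meanInitial ν S x +
              ∑ y ∈ G.neighborFinset x, meanUsed G lam ν S n (l * h) y)) := by
            refine ENNReal.tsum_le_tsum fun x => ?_
            gcongr
            exact mul_meanUsed_le hreg S n hh.le hm hδ hmt l x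
        _ = ∑ j ∈ Finset.range l, ENNReal.ofReal h * (∑' x, w x * (meanInitial ν S x +
              ∑ y ∈ G.neighborFinset x, meanUsed G lam ν S n ((j + 1 : ℕ) * h) y)) +
            r * ∑' x, w x * (meanInitial ν S x +
              ∑ y ∈ G.neighborFinset x, meanUsed G lam ν S n (l * h) y) := by
            simp_rw [← ENNReal.tsum_mul_left]
            rw [← Summable.tsum_finsetSum fun _ _ => ENNReal.summable, ← ENNReal.tsum_add]
            refine tsum_congr fun x => ?_
            rw [mul_add, Finset.mul_sum]
            congr 1
            · exact Finset.sum_congr rfl fun j _ => by ring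
            · ring
        _ ≤ _ := by
            gcongr with j hj
            · exact hnb (j + 1)
            · exact hnb l
    have hsum : ∑ j ∈ Finset.range l, W (j + 1) ≤ ∑ j ∈ Finset.range l, W j + W l := by
      rw [← Finset.sum_range_succ, Finset.sum_range_succ' W]
      exact le_self_add
    have hW' : ∑ j ∈ Finset.range l, W j ≤ l * (K * A) := by
      calc _ ≤ ∑ _j ∈ Finset.range l, K * A :=
            Finset.sum_le_sum fun j hj => H' j (Finset.mem_range.1 hj)
        _ = _ := by simp
    have h2 : m / 2 * W l + m / 2 * W l ≤
        (l * ENNReal.ofReal h + r + m / 4 * (l * K)) * A + m / 2 * W l := by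
      calc m / 2 * W l + m / 2 * W l = m * W l := by rw [← add_mul, ENNReal.add_halves]
        _ ≤ _ := key
        _ = l * ENNReal.ofReal h * A + (ENNReal.ofReal h * D) * ∑ j ∈ Finset.range l, W (j + 1) +
            (r * A + (r * D) * W l) := by
            simp_rw [mul_add, Finset.sum_add_distrib, Finset.mul_sum]
            simp only [Finset.sum_const, Finset.card_range, nsmul_eq_mul, mul_assoc]
        _ ≤ l * ENNReal.ofReal h * A + (m / 4) * (l * (K * A) + W l) +
            (r * A + (m / 4) * W l) := by
            gcongr
            exact hsum.trans (by gcongr)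
        _ = (l * ENNReal.ofReal h + r + m / 4 * (l * K)) * A + (m / 4 + m / 4) * W l := by ring
        _ = _ := by
            congr 2
            rw [← ENNReal.add_div, ← two_mul, show (4 : ℝ≥0∞) = 2 * 2 by norm_num,
              ENNReal.mul_div_mul_left _ _ (by norm_num) (by norm_num)]
    have h3 := (ENNReal.add_le_add_iff_right (ENNReal.mul_ne_top hm2t (hWt l))).1 h2
    have h4 : W l ≤ (l * ENNReal.ofReal h + r + m / 4 * (l * K)) / (m / 2) * A := by
      rw [mul_comm, ← ENNReal.le_div_iff_mul_le (Or.inl hm2) (Or.inl hm2t)] at h3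
      rwa [ENNReal.mul_div_right_comm] at h3
    exact h4.trans (by gcongr; exact le_max_right _ _)

/-- On the event that all stages come before time `i * h`, the first `n` stages use `n`
instructions. With constant weight the mean of their number is bounded independently of `n`, so the
event is null. -/
theorem ae_nonExplosive (hreg : ∀ᵐ ω ∂law G lam ν, Regular G ω) {d : ℕ}
    (hd : ∀ x, G.degree x = d) (hν : ∫⁻ k, (k : ℝ≥0∞) ∂ν ≠ ∞) :
    ∀ᵐ ω ∂law G lam ν, ∀ S, NonExplosive ω S := by
  obtain ⟨h, hh, H⟩ := gronwall hreg (d : ℝ≥0)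
  refine ae_all_iff.2 fun S => ?_
  have key : ∀ i : ℕ, ∀ᵐ ω ∂law G lam ν, ¬ ∀ k, (stage ω S k).time ≤ i * h := by
    intro i
    obtain ⟨K, hK, HK⟩ := H i
    set E := {ω : Sample V | ∀ k, (stage ω S k).time ≤ i * h} with hE
    have hEm : MeasurableSet E := by
      have : E = ⋂ k, {ω | (stage ω S k).time ≤ i * h} := by ext ω; simp [hE]
      rw [this]
      exact MeasurableSet.iInter fun k =>
        measurableSet_le (measurableStage_stage S k).time measurable_const
    have hb : ∀ n : ℕ, (n : ℝ≥0∞) * law G lam ν E ≤ K * (S.card * ∫⁻ k, (k : ℝ≥0∞) ∂ν) := by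
      intro n
      have h1 := HK (fun _ => 1) 1 ENNReal.one_ne_top (fun _ => le_rfl) (fun y => by simp [hd]) S n
      simp only [one_mul] at h1
      rw [tsum_meanInitial ν, tsum_meanUsed] at h1
      refine le_trans ?_ h1
      rw [← lintegral_indicator_const hEm]
      refine lintegral_mono fun ω => ?_
      by_cases hω : ω ∈ E
      · have hl : lastStage ω S n (i * h) = n :=
          le_antisymm lastStage_le (le_lastStage le_rfl (hω n))
        simp only [Set.indicator_of_mem hω, usedUpTo, hl]
        rw [tsum_used_stage_eq ω S hω]
      · simp [Set.indicator_of_notMem hω]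
    rw [ae_iff]
    simp only [not_not]
    by_contra hne
    obtain ⟨n, hn⟩ := ENNReal.exists_nat_mul_gt hne
      (ENNReal.mul_ne_top hK (ENNReal.mul_ne_top (ENNReal.natCast_ne_top S.card) hν))
    exact absurd (hb n) (not_le.2 hn)
  filter_upwards [ae_all_iff.2 key] with ω hω B
  obtain ⟨i, hi⟩ := exists_nat_gt (B / h)
  rw [div_lt_iff₀ hh] at hi
  have := hω i
  push Not at this
  obtain ⟨k, hk⟩ := this
  exact ⟨k, hi.trans hk⟩

/-- With a weight of finite total mass the Gronwall bound does not see the size of `S`. Along a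
cofinal sequence of finite sets the counts increase, so monotone convergence bounds the mean of
their supremum. -/
theorem ae_usedAt_bounded (hreg : ∀ᵐ ω ∂law G lam ν, Regular G ω) {d : ℕ}
    (hd : ∀ x, G.degree x = d) (hd0 : 0 < d) (hν : ∫⁻ k, (k : ℝ≥0∞) ∂ν ≠ ∞) :
    ∀ᵐ ω ∂law G lam ν, ∀ (x : V) (t : ℝ), 0 ≤ t → ∃ N, ∀ S, usedAt ω S t x ≤ N := by
  obtain ⟨h, hh, H⟩ := gronwall hreg (2 * d : ℝ≥0)
  have hne := ae_nonExplosive hreg hd hν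
  obtain ⟨T, hT, hTlim⟩ := exists_seq_monotone_tendsto_atTop_atTop (Finset V)
  have key : ∀ (x : V) (i : ℕ), ∀ᵐ ω ∂law G lam ν,
      ⨆ j, ⨆ n, (usedUpTo ω (T j) n (i * h) x : ℝ≥0∞) < ∞ := by
    intro x i
    have hi : 0 ≤ (i : ℝ) * h := by positivity
    obtain ⟨K, hK, HK⟩ := H i
    obtain ⟨w, hw1, hw2, hw3⟩ := exists_weight hd hd0 x
    have hm : ∀ S n, Measurable fun ω : Sample V => (usedUpTo ω S n (i * h) x : ℝ≥0∞) :=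
      fun S n => measurable_natCast (measurable_usedUpTo S n _ x)
    have hb : ∀ S n, meanUsed G lam ν S n (i * h) x ≤ K * (2 * ∫⁻ k, (k : ℝ≥0∞) ∂ν) := by
      intro S n
      have h1 := HK w 2 ENNReal.ofNat_ne_top (fun y => (ENNReal.le_tsum y).trans hw2)
        (fun y => by simpa using hw3 y) S n
      have h2 : meanUsed G lam ν S n (i * h) x ≤ ∑' y, w y * meanUsed G lam ν S n (i * h) y := by
        refine le_trans ?_ (ENNReal.le_tsum x)
        exact le_mul_of_one_le_left zero_le hw1
      refine h2.trans (h1.trans ?_)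
      gcongr
      calc ∑' x, w x * meanInitial ν S x ≤ ∑' x, w x * ∫⁻ k, (k : ℝ≥0∞) ∂ν := by
            refine ENNReal.tsum_le_tsum fun x => ?_
            gcongr
            unfold meanInitial
            split_ifs
            · exact le_rfl
            · exact zero_le
        _ ≤ _ := by rw [ENNReal.tsum_mul_right]; gcongr
    refine ae_lt_top (Measurable.iSup fun j => Measurable.iSup fun n => hm (T j) n) ?_
    have hmono : ∀ᵐ ω ∂law G lam ν,
        Monotone fun j => ⨆ n, (usedUpTo ω (T j) n (i * h) x : ℝ≥0∞) := by
      filter_upwards [hreg, hne] with ω hω hS a b hab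
      simp only [iSup_usedUpTo hω (hS _) hi]
      exact_mod_cast usedAt_mono_set hω (hS _) (hS _) (hT hab) hi x
    rw [lintegral_iSup' (fun j => (Measurable.iSup fun n => hm (T j) n).aemeasurable) hmono]
    have hb' : K * (2 * ∫⁻ k, (k : ℝ≥0∞) ∂ν) ≠ ∞ :=
      ENNReal.mul_ne_top hK (ENNReal.mul_ne_top (by norm_num) hν)
    refine ne_top_of_le_ne_top hb' (iSup_le fun j => ?_)
    rw [lintegral_iSup (hm (T j)) fun a b hab ω => by
      exact_mod_cast usedUpTo_mono ω (T j) (i * h) x hab]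
    exact iSup_le fun n => hb (T j) n
  filter_upwards [hreg, hne, ae_all_iff.2 fun x => ae_all_iff.2 (key x)] with ω hω hS hf x t ht
  obtain ⟨i, hi⟩ := exists_nat_gt (t / h)
  rw [div_lt_iff₀ hh] at hi
  obtain ⟨N, hN⟩ := ENNReal.exists_nat_gt (hf x i).ne
  refine ⟨N, fun S => ?_⟩
  obtain ⟨j, hj⟩ := (hTlim.eventually_ge_atTop S).exists
  have h1 := usedAt_mono_set hω (hS S) (hS (T j)) hj ht x
  have h2 := usedAt_mono hω (hS (T j)) ht hi.le x
  have h3 : (usedAt ω (T j) (i * h) x : ℝ≥0∞) ≤ N := by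
    rw [← iSup_usedUpTo hω (hS (T j)) (by positivity)]
    exact (le_iSup (fun j => ⨆ n, (usedUpTo ω (T j) n (i * h) x : ℝ≥0∞)) j).trans hN.le
  exact h1.trans (h2.trans (by exact_mod_cast h3))

end Gronwall

/-! ## Toppling strategies -/

section Strategy

variable {V : Type*}

/-- `Bounded G lam o c ρ b`: if at every vertex `y` at least `ρ y` particles are active, then there
is a toppling strategy such that `E[(1 - c) ^ N] ≤ b` for the final number `N` of active particles
at `o`. -/
inductive Bounded (G : SimpleGraph V) [G.LocallyFinite] (lam : ℝ≥0) (o : V) (c : ℝ) :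
    (V → ℕ) → ℝ → Prop
  | halt (ρ : V → ℕ) : Bounded G lam o c ρ ((1 - c) ^ ρ o)
  | mono {ρ ρ' : V → ℕ} {b b' : ℝ} (h : Bounded G lam o c ρ b) (hρ : ρ ≤ ρ') (hb : b ≤ b') :
      Bounded G lam o c ρ' b'
  -- `σ` counts the particles other than the one toppled. A sleep instruction takes effect only if
  -- that particle is alone, which is possible only when `σ z = 0`; otherwise both remain active.
  | topple (σ : V → ℕ) (z : V) (βs : ℝ) (β : V → ℝ)
      (hs : Bounded G lam o c (if 0 < σ z then σ + Pi.single z 1 else σ) βs)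
      (hj : ∀ w ∈ G.neighborFinset z, Bounded G lam o c (σ + Pi.single w 1) (β w)) :
      Bounded G lam o c (σ + Pi.single z 1)
        ((lam * βs + (∑ w ∈ G.neighborFinset z, β w) / G.degree z) / (1 + lam))

/-- The law of the instructions. -/
abbrev instrMeasure (G : SimpleGraph V) [G.LocallyFinite] (lam : ℝ≥0) :
    Measure (V → ℕ → Instr V) :=
  Measure.infinitePi fun x : V => Measure.infinitePi fun _ : ℕ => (instrLaw G lam x).toMeasure

theorem le_numActive_perform_jump {σ : V → ℕ} {cfg : V → SiteState} {z w : V} (hwz : w ≠ z)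
    (h : ∀ y, (σ + Pi.single z 1 : V → ℕ) y ≤ (cfg y).numActive) (y : V) :
    (σ + Pi.single w 1 : V → ℕ) y ≤ (perform z cfg (.jump w) y).numActive := by
  have hy := h y
  rw [perform_jump_apply _ _ _ hwz]
  simp only [Pi.add_apply, Pi.single_apply] at hy ⊢
  split_ifs with h1 h2
  · subst h1
    rw [if_neg hwz] at hy
    rcases hc : cfg y with _ | k <;> simp only [hc, SiteState.numActive, SiteState.arrive] at hy ⊢
      <;> omega
  · subst h2
    rw [if_pos rfl] at hy
    rcases hc : cfg y with _ | k <;> simp only [hc, SiteState.numActive, SiteState.leave] at hy ⊢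
      <;> omega
  · rw [if_neg h2] at hy
    exact hy

theorem le_numActive_perform_sleep {σ : V → ℕ} {cfg : V → SiteState} {z : V}
    (h : ∀ y, (σ + Pi.single z 1 : V → ℕ) y ≤ (cfg y).numActive) (y : V) :
    (if 0 < σ z then σ + Pi.single z 1 else σ : V → ℕ) y ≤ (perform z cfg .sleep y).numActive := by
  have hy := h y
  rw [perform_sleep_apply]
  by_cases hyz : y = z
  · subst hyz
    simp only [Pi.add_apply, Pi.single_apply, if_true] at hy ⊢
    rcases hc : cfg y with _ | k
    · simp [hc, SiteState.numActive] at hy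
    · simp only [hc, SiteState.numActive] at hy
      rcases k with _ | _ | k
      · omega
      · have : σ y = 0 := by omega
        simp [this]
      · split_ifs <;> simp only [Pi.add_apply, Pi.single_eq_same, SiteState.tryToSleep,
          SiteState.numActive] <;> omega
  · simp only [if_neg hyz]
    refine le_trans ?_ hy
    split_ifs
    · exact le_rfl
    · exact Nat.le_add_right _ _

theorem Bounded.nonneg {G : SimpleGraph V} [G.LocallyFinite] {lam : ℝ≥0} {o : V} {c : ℝ}
    (hc1 : c ≤ 1) {ρ : V → ℕ} {b : ℝ} (h : Bounded G lam o c ρ b) : 0 ≤ b := by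
  induction h with
  | halt ρ => exact pow_nonneg (by linarith) _
  | mono _ _ hb ih => exact ih.trans hb
  | topple σ z βs β _ _ ihs ihj =>
    have := Finset.sum_nonneg ihj
    positivity

/-- A strategy can be carried out, whatever instructions have been used before. -/
theorem Bounded.exists_realization [Countable V] {G : SimpleGraph V} [G.LocallyFinite]
    (hdeg : ∀ x, 0 < G.degree x) {lam : ℝ≥0} {o : V} {c : ℝ} (hc0 : 0 ≤ c) (hc1 : c ≤ 1)
    {ρ : V → ℕ} {b : ℝ} (h : Bounded G lam o c ρ b) (u : V → ℕ) :
    ∃ K : (V → ℕ → Instr V) → ℝ≥0∞, Measurable K ∧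
      (∀ I z j a, j < u z → K (resample I z j a) = K I) ∧
      (∀ η I cfg, Reach η I cfg u → (∀ y, ρ y ≤ (cfg y).numActive) →
        ∃ cfg' u', Reach η I cfg' u' ∧ ENNReal.ofReal ((1 - c) ^ (cfg' o).numActive) ≤ K I) ∧
      ∫⁻ I, K I ∂instrMeasure G lam ≤ ENNReal.ofReal b := by
  have hpow : ∀ k l : ℕ, k ≤ l → ENNReal.ofReal ((1 - c) ^ l) ≤ ENNReal.ofReal ((1 - c) ^ k) :=
    fun k l hkl => ENNReal.ofReal_le_ofReal
      (pow_le_pow_of_le_one (by linarith) (by linarith) hkl)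
  induction h generalizing u with
  | halt ρ =>
    refine ⟨fun _ => ENNReal.ofReal ((1 - c) ^ ρ o), measurable_const, fun _ _ _ _ _ => rfl,
      fun η I cfg hr hρ => ⟨cfg, u, hr, hpow _ _ (hρ o)⟩, ?_⟩
    rw [lintegral_const, measure_univ, mul_one]
  | mono _ hρ hb ih =>
    obtain ⟨K, hK, hi, hr, hle⟩ := ih u
    exact ⟨K, hK, hi, fun η I cfg h hy => hr η I cfg h fun y => (hρ y).trans (hy y),
      hle.trans (ENNReal.ofReal_le_ofReal hb)⟩
  | topple σ z βs β hs hj ihs ihj =>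
    set u' := Function.update u z (u z + 1) with hu'
    obtain ⟨Ks, hKs, his, hrs, hles⟩ := ihs u'
    have hex : ∀ w, ∃ K : (V → ℕ → Instr V) → ℝ≥0∞, Measurable K ∧
        (∀ I z j a, j < u' z → K (resample I z j a) = K I) ∧
        (∀ η I cfg, Reach η I cfg u' →
          (w ∈ G.neighborFinset z → ∀ y, (σ + Pi.single w 1 : V → ℕ) y ≤ (cfg y).numActive) →
          ∃ cfg' u', Reach η I cfg' u' ∧ ENNReal.ofReal ((1 - c) ^ (cfg' o).numActive) ≤ K I) ∧
        (w ∈ G.neighborFinset z → ∫⁻ I, K I ∂instrMeasure G lam ≤ ENNReal.ofReal (β w)) := by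
      intro w
      by_cases hw : w ∈ G.neighborFinset z
      · obtain ⟨K, hK, hi, hr, hle⟩ := ihj w hw u'
        exact ⟨K, hK, hi, fun η I cfg h hy => hr η I cfg h (hy hw), fun _ => hle⟩
      -- The law of the instruction does not charge jumps to non-neighbours; the strategy halts
      -- there with the trivial bound.
      · refine ⟨fun _ => 1, measurable_const, fun _ _ _ _ _ => rfl,
          fun η I cfg h _ => ⟨cfg, u', h, ?_⟩, fun h => absurd h hw⟩
        simpa using hpow 0 _ (Nat.zero_le _)
    choose K hK hi hr hle using hex
    let F : Instr V → (V → ℕ → Instr V) → ℝ≥0∞ := fun i => match i with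
      | .sleep => Ks
      | .jump w => K w
    have hFm : ∀ i, Measurable (F i) := fun i => by
      cases i with
      | sleep => exact hKs
      | jump w => exact hK w
    have hFi : ∀ i I z j a, j < u' z → F i (resample I z j a) = F i I := fun i => by
      cases i with
      | sleep => exact his
      | jump w => exact hi w
    have hm : Measurable fun I : V → ℕ → Instr V => F (I z (u z)) I :=
      measurable_apply_of_countable
        ((measurable_pi_apply (u z)).comp (measurable_pi_apply z)) hFm
    refine ⟨fun I => F (I z (u z)) I, hm, ?_, ?_, ?_⟩
    · intro I y j a hj
      have h1 : j < u' y := by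
        rw [hu', Function.update_apply]
        split_ifs with h
        · subst h; omega
        · exact hj
      have h2 : resample I y j a z (u z) = I z (u z) := by
        rw [resample_apply, if_neg]
        rintro ⟨rfl, h⟩
        omega
      simp only [h2, hFi _ _ _ _ _ h1]
    · intro η I cfg h hy
      have hz : 0 < (cfg z).numActive := lt_of_lt_of_le (by simp) (hy z)
      have ht := h.topple z hz
      rcases hiz : I z (u z) with _ | w
      · rw [hiz] at ht
        simp only [hiz]
        exact hrs η I _ ht (le_numActive_perform_sleep hy)
      · rw [hiz] at ht
        simp only [hiz]
        refine hr w η I _ ht fun hw => le_numActive_perform_jump ?_ hy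
        rintro rfl
        simp at hw
    · have hres : ∀ I (i : Instr V), F (resample I z (u z) i z (u z)) (resample I z (u z) i) =
          F i I := fun I i => by
        rw [resample_apply, if_pos ⟨rfl, rfl⟩, hFi]
        simp [hu']
      have hdz := hdeg z
      have hd0 : (0 : ℝ) < G.degree z := by exact_mod_cast hdz
      refine (lintegral_resample (fun x => (instrLaw G lam x).toMeasure) z (u z) hm).trans_le ?_
      simp only [hres, lintegral_instrLaw G hdz, F]
      rw [lintegral_add_left (hKs.const_mul _), lintegral_const_mul _ hKs,
        lintegral_const_mul _ (Finset.measurable_sum _ fun w _ => (hK w).const_mul _),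
        lintegral_finsetSum _ fun w _ => (hK w).const_mul _]
      have hβ : ∀ w ∈ G.neighborFinset z, 0 ≤ β w := fun w hw => (hj w hw).nonneg hc1
      have hβs : 0 ≤ βs := hs.nonneg hc1
      have e1 : ((lam / (1 + lam) : ℝ≥0) : ℝ≥0∞) = ENNReal.ofReal (lam / (1 + lam)) := by
        rw [← ENNReal.ofReal_coe_nnreal]; push_cast; rfl
      have e2 : ((1 / (1 + lam) : ℝ≥0) : ℝ≥0∞) = ENNReal.ofReal (1 / (1 + lam)) := by
        rw [← ENNReal.ofReal_coe_nnreal]; push_cast; rfl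
      have e3 : (G.degree z : ℝ≥0∞)⁻¹ = ENNReal.ofReal ((G.degree z : ℝ)⁻¹) := by
        rw [ENNReal.ofReal_inv_of_pos hd0, ENNReal.ofReal_natCast]
      calc _ ≤ ENNReal.ofReal (lam / (1 + lam)) * ENNReal.ofReal βs +
            ENNReal.ofReal (1 / (1 + lam)) * ∑ w ∈ G.neighborFinset z,
              ENNReal.ofReal ((G.degree z : ℝ)⁻¹) * ENNReal.ofReal (β w) := by
            rw [e1, e2, e3]
            gcongr with w hw
            rw [lintegral_const_mul _ (hK w)]
            gcongr
            exact hle w hw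
        _ = ENNReal.ofReal (lam / (1 + lam) * βs + 1 / (1 + lam) *
              ∑ w ∈ G.neighborFinset z, (G.degree z : ℝ)⁻¹ * β w) := by
            have h1 : ∀ w ∈ G.neighborFinset z, ENNReal.ofReal ((G.degree z : ℝ)⁻¹) *
                ENNReal.ofReal (β w) = ENNReal.ofReal ((G.degree z : ℝ)⁻¹ * β w) := fun w _ =>
              (ENNReal.ofReal_mul (by positivity)).symm
            have h2 : ∀ w ∈ G.neighborFinset z, 0 ≤ (G.degree z : ℝ)⁻¹ * β w := fun w hw =>
              mul_nonneg (by positivity) (hβ w hw)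
            have h3 := Finset.sum_nonneg h2
            rw [Finset.sum_congr rfl h1, ← ENNReal.ofReal_sum_of_nonneg h2,
              ← ENNReal.ofReal_mul (by positivity), ← ENNReal.ofReal_mul (by positivity),
              ← ENNReal.ofReal_add (by positivity) (by positivity)]
        _ = _ := by
            congr 1
            rw [← Finset.mul_sum]
            field_simp

end Strategy

/-! ## The strategy that moves the particles to the root -/

section Potential

variable {V : Type*} (G : SimpleGraph V) [G.LocallyFinite] (lam : ℝ≥0) (o : V)

/-- The probability that a particle reaches `o` within `T` topplings, if it is stopped outside the
ball of radius `L` and when it is told to sleep at distance at least `n` from `o`. -/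
def walkValue (L n : ℕ) : ℕ → V → ℝ
  | 0 => fun z => if z = o then 1 else 0
  | T + 1 => fun z => if z = o then 1 else if L < G.dist o z then 0 else
      (lam * (if G.dist o z < n then walkValue L n T z else 0) +
        (∑ w ∈ G.neighborFinset z, walkValue L n T w) / G.degree z) / (1 + lam)

/-- `h` is a nonnegative function, at most one, that is superharmonic in the ball of radius `L`
except at `o`, where it is one. -/
structure IsHitBound (L : ℕ) (h : V → ℝ) : Prop where
  root : h o = 1
  nonneg : ∀ z, 0 ≤ h z
  le_one : ∀ z, h z ≤ 1
  super : ∀ z, z ≠ o → G.dist o z ≤ L → (∑ w ∈ G.neighborFinset z, h w) / G.degree z ≤ h z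

variable {G lam o}

theorem walkValue_nonneg (L n T : ℕ) (z : V) : 0 ≤ walkValue G lam o L n T z := by
  induction T generalizing z with
  | zero => simp only [walkValue]; split_ifs <;> norm_num
  | succ T ih =>
    have h1 := Finset.sum_nonneg fun w (_ : w ∈ G.neighborFinset z) => ih w
    have h2 := ih z
    simp only [walkValue]
    split_ifs <;> positivity

theorem walkValue_root (L n T : ℕ) : walkValue G lam o L n T o = 1 := by
  cases T <;> simp [walkValue]

theorem IsHitBound.walkValue_le {L : ℕ} {h : V → ℝ} (hh : IsHitBound G o L h) (n T : ℕ) (z : V) :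
    walkValue G lam o L n T z ≤ h z := by
  induction T generalizing z with
  | zero =>
    simp only [walkValue]
    split_ifs with hz
    · rw [hz, hh.root]
    · exact hh.nonneg z
  | succ T ih =>
    simp only [walkValue]
    split_ifs with hz hL hn
    · rw [hz, hh.root]
    · exact hh.nonneg z
    all_goals
      rw [div_le_iff₀ (by positivity)]
      have h1 : (∑ w ∈ G.neighborFinset z, walkValue G lam o L n T w) / G.degree z ≤ h z := by
        refine le_trans ?_ (hh.super z hz (not_lt.1 hL))
        gcongr with w hw
        exact ih w
      have h2 := mul_le_mul_of_nonneg_left (ih z) lam.2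
      have h3 := mul_nonneg lam.2 (hh.nonneg z)
      simp only [NNReal.val_eq_coe] at h2 h3
      linarith

/-- `Θ ρ` is the bound if the walking particle is given up, and `κ` holds particles that wait at the
starting vertex and do not enter `Θ`. One toppling reproduces the recursion of `walkValue`, because
the factor `1 - c * walkValue` is affine in it. The hypotheses `hroot` and `hfill` are the gains at
`o` and at a hole; the gain `h z` at a hole is enough since it dominates the value of walking on. -/
theorem Bounded.walk (hdeg : ∀ x, 0 < G.degree x) {L n : ℕ} {c : ℝ} (hc0 : 0 ≤ c)
    {h : V → ℝ} (hh : IsHitBound G o L h) {κ : V → ℕ} {Θ : (V → ℕ) → ℝ}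
    (hΘ : ∀ ρ, Bounded G lam o c (ρ + κ) (Θ ρ)) (hΘ0 : ∀ ρ, 0 ≤ Θ ρ)
    (hroot : ∀ ρ, Θ (ρ + Pi.single o 1) ≤ (1 - c) * Θ ρ)
    (hfill : ∀ z, z ≠ o → G.dist o z ≤ L → G.dist o z < n → ∀ ρ, ρ z = 0 →
      Θ (ρ + Pi.single z 1) ≤ (1 - c * h z) * Θ ρ) (T : ℕ) (z : V) (ρ : V → ℕ) :
    Bounded G lam o c (ρ + κ + Pi.single z 1) ((1 - c * walkValue G lam o L n T z) * Θ ρ) := by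
  have hdrop : ∀ (z : V) (ρ : V → ℕ), Bounded G lam o c (ρ + κ + Pi.single z 1) (Θ ρ) :=
    fun z ρ => (hΘ ρ).mono (fun y => Nat.le_add_right _ _) le_rfl
  have hstay : ∀ (z : V) (ρ : V → ℕ),
      Bounded G lam o c (ρ + κ + Pi.single z 1) (Θ (ρ + Pi.single z 1)) := fun z ρ => by
    have := hΘ (ρ + Pi.single z 1)
    rwa [add_right_comm] at this
  induction T generalizing z ρ with
  | zero =>
    by_cases hz : z = o
    · subst hz
      simpa [walkValue] using (hstay z ρ).mono le_rfl (hroot ρ)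
    · simpa [walkValue, hz] using hdrop z ρ
  | succ T ih =>
    by_cases hz : z = o
    · subst hz
      simpa [walkValue] using (hstay z ρ).mono le_rfl (hroot ρ)
    by_cases hL : L < G.dist o z
    · simpa [walkValue, hz, hL] using hdrop z ρ
    by_cases hf : G.dist o z < n ∧ ρ z = 0
    · refine (hstay z ρ).mono le_rfl ((hfill z hz (not_lt.1 hL) hf.1 ρ hf.2).trans ?_)
      refine mul_le_mul_of_nonneg_right ?_ (hΘ0 ρ)
      have := mul_le_mul_of_nonneg_left (hh.walkValue_le (lam := lam) n (T + 1) z) hc0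
      linarith
    have hd0 : (0 : ℝ) < G.degree z := by exact_mod_cast hdeg z
    have key := Bounded.topple (G := G) (lam := lam) (o := o) (c := c) (ρ + κ) z
      ((1 - c * if G.dist o z < n then walkValue G lam o L n T z else 0) * Θ ρ)
      (fun w => (1 - c * walkValue G lam o L n T w) * Θ ρ) ?_ fun w _ => ih w ρ
    · refine key.mono le_rfl (le_of_eq ?_)
      simp only [walkValue, if_neg hz, if_neg hL]
      rw [← Finset.sum_mul, Finset.sum_sub_distrib, ← Finset.mul_sum]
      simp only [Finset.sum_const, SimpleGraph.card_neighborFinset_eq_degree, nsmul_eq_mul, mul_one]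
      have h1 : (1 : ℝ) + lam ≠ 0 := by positivity
      field_simp
      ring
    -- Nearer than `n` the vertex is occupied, so the sleep instruction is lost and the walk goes
    -- on. At distance at least `n` the particle is given up, whether it really falls asleep or has
    -- company.
    · by_cases hn : G.dist o z < n
      · have hρz : 0 < (ρ + κ) z := by
          have : ρ z ≠ 0 := fun h0 => hf ⟨hn, h0⟩
          simp only [Pi.add_apply]; omega
        rw [if_pos hρz, if_pos hn]
        exact ih z ρ
      · rw [if_neg hn]
        simp only [mul_zero, sub_zero, one_mul]
        split_ifs
        · exact hdrop z ρ
        · exact hΘ ρ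

/-- The factor of a vertex with `k` initial particles, for the values `f` of a particle and `h` of
a hole. -/
def siteFactor (c f h : ℝ) (k : ℕ) : ℝ :=
  if k = 0 then (1 - c * f) / (1 - c * h) else (1 - c * f) ^ k

/-- The bound for the particles `ρ` when those in `U` have not been moved. -/
def potential (G : SimpleGraph V) [G.LocallyFinite] (lam : ℝ≥0) (o : V) (L T : ℕ) (c : ℝ)
    (h : V → ℝ) (U : Finset V) (ρ : V → ℕ) : ℝ :=
  (1 - c) ^ ρ o * ∏ y ∈ U, siteFactor c (walkValue G lam o L (G.dist o y) T y) (h y) (ρ y)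

/-- Induction that strips off a farthest vertex `a` of `U`. Any hole met by a particle from `a` at a
smaller distance lies in the rest of `U` by `hUL`; filling it changes its factor from `(1 - c f) /
(1 - c h)` to `1 - c f`, which is exactly the factor `1 - c h` that `Bounded.walk` asks for. The
factor for a hole is chosen for this. -/
theorem bounded_potential (hdeg : ∀ x, 0 < G.degree x) {L : ℕ} (T : ℕ) {c : ℝ} (hc0 : 0 ≤ c)
    (hc1 : c < 1) {h : V → ℝ} (hh : IsHitBound G o L h) (U : Finset V) (hoU : o ∉ U)
    (hUL : ∀ z, z ≠ o → G.dist o z ≤ L → ∀ y ∈ U, G.dist o z < G.dist o y → z ∈ U) (ρ : V → ℕ) :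
    (∀ y ∈ U, G.dist o y ≤ L) → Bounded G lam o c ρ (potential G lam o L T c h U ρ) := by
  have hch : ∀ z, 0 < 1 - c * h z := fun z => by
    have := mul_le_mul_of_nonneg_left (hh.le_one z) hc0
    linarith
  set f : V → ℝ := fun y => walkValue G lam o L (G.dist o y) T y with hf
  have hfh : ∀ z, f z ≤ h z := fun z => hh.walkValue_le _ T z
  have hcf : ∀ z, 1 - c * h z ≤ 1 - c * f z := fun z => by
    have := mul_le_mul_of_nonneg_left (hfh z) hc0
    linarith
  have hcf0 : ∀ z, 0 < 1 - c * f z := fun z => (hch z).trans_le (hcf z)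
  have hsf : ∀ z k, 0 < siteFactor c (f z) (h z) k := fun z k => by
    unfold siteFactor
    split_ifs
    · exact div_pos (hcf0 z) (hch z)
    · exact pow_pos (hcf0 z) k
  revert ρ
  induction U using Finset.induction_on_max_value (f := G.dist o) with
  | empty => intro ρ _; simpa [potential] using Bounded.halt (G := G) (lam := lam) (o := o) (c := c) ρ
  | insert a U ha hmax ih =>
    intro ρ hL
    have hao : a ≠ o := fun e => hoU (e ▸ Finset.mem_insert_self a U)
    have hoU' : o ∉ U := fun e => hoU (Finset.mem_insert_of_mem e)
    have ih' : ∀ ρ, Bounded G lam o c ρ (potential G lam o L T c h U ρ) := fun ρ =>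
      ih hoU' (fun z hz hzL y hy hzy => by
        rcases Finset.mem_insert.1 (hUL z hz hzL y (Finset.mem_insert_of_mem hy) hzy) with e | e
        · subst e
          exact absurd hzy (not_lt.2 (hmax y hy))
        · exact e) ρ fun y hy => hL y (Finset.mem_insert_of_mem hy)
    have hpos : ∀ ρ, 0 ≤ potential G lam o L T c h U ρ := fun ρ =>
      mul_nonneg (pow_nonneg (by linarith) _) (Finset.prod_nonneg fun y _ => (hsf y _).le)
    -- The `k` particles at `a` are moved one after another, each contributing a factor `1 - c * f
    -- a`; those still waiting form `κ`.
    have hQ : ∀ (k : ℕ) (ρ : V → ℕ), Bounded G lam o c (ρ + k • Pi.single a 1)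
        ((1 - c * f a) ^ k * potential G lam o L T c h U ρ) := by
      intro k
      induction k with
      | zero => intro ρ; simpa using ih' ρ
      | succ k ihk =>
        intro ρ
        have hw := Bounded.walk hdeg (lam := lam) (n := G.dist o a) hc0 hh (κ := k • Pi.single a 1)
          (Θ := fun ρ => (1 - c * f a) ^ k * potential G lam o L T c h U ρ) ihk
          (fun ρ => mul_nonneg (pow_nonneg (hcf0 a).le k) (hpos ρ)) ?_ ?_ T a ρ
        · rw [succ_nsmul, ← add_assoc, pow_succ', mul_assoc]
          exact hw
        · intro ρ
          have : ∏ y ∈ U, siteFactor c (f y) (h y) ((ρ + Pi.single o 1 : V → ℕ) y) =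
              ∏ y ∈ U, siteFactor c (f y) (h y) (ρ y) :=
            Finset.prod_congr rfl fun y hy => by
              have : y ≠ o := fun e => hoU' (e ▸ hy)
              simp [this]
          simp only [potential, hf] at this ⊢
          rw [this, Pi.add_apply, Pi.single_eq_same, pow_succ]
          exact le_of_eq (by ring)
        · intro z hz hzL hza ρ hρz
          have hzU : z ∈ U := by
            rcases Finset.mem_insert.1 (hUL z hz hzL a (Finset.mem_insert_self a U) hza) with e | e
            · subst e; exact absurd hza (lt_irrefl _)
            · exact e
          have : ∏ y ∈ U, siteFactor c (f y) (h y) ((ρ + Pi.single z 1 : V → ℕ) y) =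
              (1 - c * h z) * ∏ y ∈ U, siteFactor c (f y) (h y) (ρ y) := by
            rw [← Finset.mul_prod_erase _ _ hzU, ← Finset.mul_prod_erase _ _ hzU, ← mul_assoc]
            congr 1
            · have := (hch z).ne'
              simp only [siteFactor, Pi.add_apply, hρz, Pi.single_eq_same]
              simp
              field_simp
            · refine Finset.prod_congr rfl fun y hy => ?_
              simp [Finset.ne_of_mem_erase hy]
          simp only [potential, hf] at this ⊢
          rw [this, Pi.add_apply, Pi.single_apply, if_neg hz.symm, add_zero]
          exact le_of_eq (by ring)
    -- All particles at `a` are put into `κ`. The potential of the remaining vertices does not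
    -- involve `a`.
    have h1 := hQ (ρ a) (Function.update ρ a 0)
    have e1 : Function.update ρ a 0 + ρ a • Pi.single a 1 = ρ := by
      funext y
      by_cases hy : y = a
      · subst hy; simp
      · simp [hy]
    have e2 : potential G lam o L T c h U (Function.update ρ a 0) =
        potential G lam o L T c h U ρ := by
      unfold potential
      rw [Function.update_of_ne hao.symm]
      congr 1
      refine Finset.prod_congr rfl fun y hy => ?_
      rw [Function.update_of_ne]
      rintro rfl
      exact ha hy
    rw [e1, e2] at h1
    refine h1.mono le_rfl ?_
    have e3 : potential G lam o L T c h (insert a U) ρ =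
        siteFactor c (f a) (h a) (ρ a) * potential G lam o L T c h U ρ := by
      unfold potential
      rw [Finset.prod_insert ha]
      ring
    rw [e3]
    refine mul_le_mul_of_nonneg_right ?_ (hpos ρ)
    -- If `a` is still empty at its turn, no particle is moved, and the factor `1` is at most the
    -- reserved `(1 - c f) / (1 - c h)`.
    unfold siteFactor
    split_ifs with h0
    · rw [h0, pow_zero, one_le_div (hch a)]
      exact hcf a
    · exact le_rfl

end Potential

/-! ## The occupation measure of the marked walk -/

section Alive

variable {V : Type*} (G : SimpleGraph V) (o : V)

/-- Up to time `t`, the walk has not left the ball of radius `L`, returned to `o`, or met a sleep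
mark at distance at least `n` from `o`. -/
def Alive (L n : ℕ) (X : ℕ → V) (Y : ℕ → Bool) (t : ℕ) : Prop :=
  ∀ s ≤ t, G.dist o (X s) ≤ L ∧ (1 ≤ s → X s ≠ o ∧ (n ≤ G.dist o (X s) → Y s = false))

variable {G o}

theorem lt_firstTime {p : ℕ → Prop} {t : ℕ} : (t : ℕ∞) < firstTime p ↔ ∀ s ≤ t, ¬ p s := by
  have h : (t : ℕ∞) < firstTime p ↔ ((t + 1 : ℕ) : ℕ∞) ≤ firstTime p := by
    rw [Nat.cast_add, Nat.cast_one]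
    exact (ENat.add_one_le_iff (ENat.natCast_ne_top t)).symm
  rw [h, firstTime]
  simp only [le_iInf_iff, Nat.cast_le]
  exact ⟨fun h s hs hp => by have := h s hp; omega,
    fun h s hp => by by_contra hlt; exact h s (by omega) hp⟩

theorem lt_times_iff_alive {L n t : ℕ} {X : ℕ → V} {Y : ℕ → Bool} :
    (t : ℕ∞) < exitTime G o L X ⊓ returnTime o X ⊓ killTime G o n X Y ↔ Alive G o L n X Y t := by
  simp only [lt_inf_iff, exitTime, returnTime, killTime, lt_firstTime, Alive]
  constructor
  · rintro ⟨⟨h1, h2⟩, h3⟩ s hs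
    refine ⟨not_lt.1 (h1 s hs), fun h => ⟨fun e => h2 s hs ⟨h, e⟩, fun hn => ?_⟩⟩
    have := h3 s hs
    simpa [h, hn] using this
  · intro h
    refine ⟨⟨fun s hs => not_lt.2 (h s hs).1, fun s hs e => ((h s hs).2 e.1).1 e.2⟩,
      fun s hs e => ?_⟩
    have := ((h s hs).2 e.1).2 e.2.1
    simp [this] at e

/-- Inside the ball no vertex has distance `L + 1`, so the value `n = L + 1` switches off killing.
The walk without killing thus needs no separate treatment. -/
theorem lt_exitTime_inf_returnTime_iff_alive {L t : ℕ} {X : ℕ → V} (Y : ℕ → Bool) :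
    (t : ℕ∞) < exitTime G o L X ⊓ returnTime o X ↔ Alive G o L (L + 1) X Y t := by
  rw [← lt_times_iff_alive, lt_inf_iff (b := exitTime G o L X ⊓ returnTime o X)]
  refine ⟨fun h => ⟨h, ?_⟩, fun h => h.1⟩
  rw [lt_inf_iff] at h
  have h1 := lt_firstTime.1 h.1
  exact lt_firstTime.2 fun s hs e => h1 s hs e.2.1

theorem alive_succ {L n t : ℕ} {X : ℕ → V} {Y : ℕ → Bool} :
    Alive G o L n X Y (t + 1) ↔ Alive G o L n X Y t ∧ G.dist o (X (t + 1)) ≤ L ∧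
      X (t + 1) ≠ o ∧ (n ≤ G.dist o (X (t + 1)) → Y (t + 1) = false) := by
  constructor
  · intro h
    have := h (t + 1) le_rfl
    exact ⟨fun s hs => h s (by omega), this.1, this.2 (by omega)⟩
  · rintro ⟨h, h1, h2⟩ s hs
    rcases Nat.lt_or_ge t s with hts | hts
    · obtain rfl : s = t + 1 := by omega
      exact ⟨h1, fun _ => h2⟩
    · exact h s hts

end Alive

/-! ### The law of the killed walk -/

section MarkedWalk

variable {V : Type*} (G : SimpleGraph V) [G.LocallyFinite] (lam : ℝ≥0) (o : V)

/-- The probability that the walk is at `y` at time `t`, without having left the ball of radius `L`,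
having returned to `o`, or having met a sleep mark at distance at least `n` from `o`. -/
def walkMass (L n : ℕ) : ℕ → V → ℝ≥0
  | 0 => fun y => if y = o then 1 else 0
  | t + 1 => fun y => if y ≠ o ∧ G.dist o y ≤ L then
      (if n ≤ G.dist o y then 1 / (1 + lam) else 1) *
        ((∑ w ∈ G.neighborFinset y, walkMass L n t w) / G.degree y) else 0

variable {G lam o}

variable {Ω : Type*} [MeasurableSpace Ω] {Q : Measure Ω} {X : ℕ → Ω → V} {Y : ℕ → Ω → Bool}

theorem IsMarkedWalk.measurableSet_prefix [Countable V] (hXY : IsMarkedWalk Q G lam o X Y) (t : ℕ)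
    (P : (Fin (t + 1) → V × Bool) → Prop) :
    MeasurableSet {ω | P fun s => (X s ω, Y s ω)} := by
  let _ : MeasurableSpace (Fin (t + 1) → V × Bool) := ⊤
  have h : Measurable fun ω => (fun s : Fin (t + 1) => (X s ω, Y s ω)) := by
    refine measurable_to_countable' fun q => ?_
    have : (fun ω => (fun s : Fin (t + 1) => (X s ω, Y s ω))) ⁻¹' {q} =
        ⋂ s : Fin (t + 1), {ω | X s ω = (q s).1} ∩ {ω | Y s ω = (q s).2} := by
      ext ω
      simp [funext_iff, Prod.ext_iff]
    rw [this]
    exact MeasurableSet.iInter fun s =>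
      (hXY.measurableSet_walk _ _).inter (hXY.measurableSet_mark _ _)
  exact h (MeasurableSpace.measurableSet_top (s := {q | P q}))

theorem IsMarkedWalk.measurableSet_alive [Countable V] (hXY : IsMarkedWalk Q G lam o X Y)
    (L n t : ℕ) (p : V → Prop) :
    MeasurableSet {ω | p (X t ω) ∧ Alive G o L n (fun s => X s ω) (fun s => Y s ω) t} := by
  have := hXY.measurableSet_prefix t fun q => p (q (Fin.last t)).1 ∧ ∀ s : Fin (t + 1),
    G.dist o (q s).1 ≤ L ∧ (1 ≤ s.1 → (q s).1 ≠ o ∧ (n ≤ G.dist o (q s).1 → (q s).2 = false))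
  convert this using 3
  simp only [Fin.val_last, Fin.forall_iff, Alive, Nat.lt_succ_iff]

/-- An event of the past is a countable union of cylinders, and one more step multiplies the
probability of each cylinder by one transition and one mark. Prefixes that do not start at `o` are
null. -/
theorem IsMarkedWalk.markov [Countable V] (hXY : IsMarkedWalk Q G lam o X Y) (t : ℕ)
    (P : (Fin (t + 1) → V × Bool) → Prop) (w y : V) (b : Bool) :
    Q {ω | (P (fun s => (X s ω, Y s ω)) ∧ X t ω = w) ∧ X (t + 1) ω = y ∧ Y (t + 1) ω = b} =
      Q {ω | P (fun s => (X s ω, Y s ω)) ∧ X t ω = w} * (stepLaw G w y * markLaw lam b) := by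
  set F : Ω → (Fin (t + 1) → V × Bool) := fun ω s => (X s ω, Y s ω) with hF
  set E : Set Ω := {ω | X (t + 1) ω = y ∧ Y (t + 1) ω = b} with hE
  set A : Set (Fin (t + 1) → V × Bool) := {q | P q ∧ (q (Fin.last t)).1 = w} with hA
  have hFm : ∀ q, MeasurableSet (F ⁻¹' {q}) := fun q => hXY.measurableSet_prefix t fun q' => q' = q
  have hEm : MeasurableSet E := (hXY.measurableSet_walk _ _).inter (hXY.measurableSet_mark _ _)
  have h1 : {ω | (P (fun s => (X s ω, Y s ω)) ∧ X t ω = w) ∧ X (t + 1) ω = y ∧ Y (t + 1) ω = b} =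
      F ⁻¹' A ∩ E := rfl
  have h2 : {ω | P (fun s => (X s ω, Y s ω)) ∧ X t ω = w} = F ⁻¹' A := rfl
  rw [h1, h2, ← Measure.restrict_apply' hEm,
    ← tsum_measure_preimage_singleton (Set.to_countable A) fun q _ => hFm q,
    ← tsum_measure_preimage_singleton (Set.to_countable A) fun q _ => hFm q,
    ← ENNReal.tsum_mul_right]
  refine tsum_congr fun ⟨q, hq⟩ => ?_
  rw [Measure.restrict_apply' hEm]
  by_cases h0 : (q 0).1 = o
  · let p : ℕ → V := fun k => if h : k < t + 1 then (q ⟨k, h⟩).1 else y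
    let b' : ℕ → Bool := fun k => if h : k < t + 1 then (q ⟨k, h⟩).2 else b
    have e1 : F ⁻¹' {q} = {ω | ∀ k ≤ t, X k ω = p k ∧ Y k ω = b' k} := by
      ext ω
      simp only [Set.mem_preimage, Set.mem_singleton_iff, funext_iff, Fin.forall_iff, hF,
        Prod.ext_iff, Set.mem_ofPred_eq, Nat.lt_succ_iff]
      refine forall₂_congr fun k hk => ?_
      simp [p, b', hk]
    have e2 : F ⁻¹' {q} ∩ E = {ω | ∀ k ≤ t + 1, X k ω = p k ∧ Y k ω = b' k} := by
      rw [e1]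
      ext ω
      have hp : p (t + 1) = y := by simp [p]
      have hb : b' (t + 1) = b := by simp [b']
      simp only [Set.mem_inter_iff, Set.mem_ofPred_eq, hE]
      constructor
      · rintro ⟨h, h'⟩ k hk
        rcases Nat.lt_or_ge t k with htk | htk
        · obtain rfl : k = t + 1 := by omega
          rw [hp, hb]
          exact h'
        · exact h k htk
      · intro h
        have := h (t + 1) le_rfl
        rw [hp, hb] at this
        exact ⟨fun k hk => h k (by omega), this⟩
    have hp0 : p 0 = o := by simpa [p] using h0
    rw [e2, e1, hXY.cylinder _ _ _ hp0, hXY.cylinder _ _ _ hp0, Finset.prod_range_succ,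
      Finset.prod_range_succ _ (t + 1)]
    have hpt : p t = w := by
      have : p t = (q (Fin.last t)).1 := by simp [p, Fin.last]
      rw [this, hq.2]
    have hp : p (t + 1) = y := by simp [p]
    have hb : b' (t + 1) = b := by simp [b']
    rw [hpt, hp, hb]
    ring
  · have hz : Q (F ⁻¹' {q}) = 0 := by
      refine measure_mono_null ?_ hXY.start_eq
      intro ω hω h
      simp only [Set.mem_preimage, Set.mem_singleton_iff] at hω
      exact h0 (by rw [← hω]; simpa [hF] using h)
    rw [hz, zero_mul]
    exact measure_mono_null Set.inter_subset_left hz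

/-- Decomposition by the last step. Since all degrees equal `d`, the step law is symmetric, and the
sum over predecessors of `y` is the average over its neighbours. -/
theorem IsMarkedWalk.measure_alive [Countable V] [IsProbabilityMeasure Q]
    (hXY : IsMarkedWalk Q G lam o X Y) {d : ℕ} (hd : ∀ x, G.degree x = d) (hd0 : 0 < d)
    (L n t : ℕ) (y : V) :
    Q {ω | X t ω = y ∧ Alive G o L n (fun s => X s ω) (fun s => Y s ω) t} =
      walkMass G lam o L n t y := by
  induction t generalizing y with
  | zero =>
    simp only [walkMass]
    split_ifs with hy
    · rw [ENNReal.coe_one, ← measure_univ (μ := Q)]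
      refine measure_congr ?_
      filter_upwards [hXY.start_eq] with ω hω
      refine eq_true ⟨by rw [hω, hy], fun s hs => ?_⟩
      obtain rfl : s = 0 := by omega
      simp [hω]
    · refine measure_mono_null ?_ hXY.start_eq
      rintro ω ⟨h, -⟩ h'
      exact hy (h.symm.trans h')
  | succ t ih =>
    by_cases hy : y ≠ o ∧ G.dist o y ≤ L
    swap
    · simp only [walkMass, if_neg hy, ENNReal.coe_zero]
      refine measure_mono_null (t := ∅) ?_ measure_empty
      rintro ω ⟨rfl, h⟩
      have := h (t + 1) le_rfl
      exact hy ⟨(this.2 (by omega)).1, this.1⟩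
    set A : Set Ω := {ω | X (t + 1) ω = y ∧ Alive G o L n (fun s => X s ω) (fun s => Y s ω) (t + 1)}
      with hA
    have hAm : MeasurableSet A := hXY.measurableSet_alive L n (t + 1) fun v => v = y
    have hstep : ∀ w, Q (A ∩ {ω | X t ω = w}) = walkMass G lam o L n t w * stepLaw G w y *
        ((if n ≤ G.dist o y then 1 / (1 + lam) else 1 : ℝ≥0) : ℝ≥0∞) := by
      intro w
      have hm : ∀ b, Q ({ω | X t ω = w ∧ Alive G o L n (fun s => X s ω) (fun s => Y s ω) t} ∩
          {ω | X (t + 1) ω = y ∧ Y (t + 1) ω = b}) =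
          walkMass G lam o L n t w * (stepLaw G w y * markLaw lam b) := by
        intro b
        rw [← ih w]
        have := hXY.markov t (fun q => ∀ s : Fin (t + 1), G.dist o (q s).1 ≤ L ∧
          (1 ≤ s.1 → (q s).1 ≠ o ∧ (n ≤ G.dist o (q s).1 → (q s).2 = false))) w y b
        simp only [Fin.forall_iff, Nat.lt_succ_iff] at this
        convert this using 2
        · ext ω
          simp only [Set.mem_inter_iff, Set.mem_ofPred_eq, Alive, and_comm]
        · congr 1
          ext ω
          simp only [Set.mem_ofPred_eq, Alive, and_comm]
      have hU : (⋃ b : Bool, (A ∩ {ω | X t ω = w}) ∩ {ω | Y (t + 1) ω = b}) =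
          A ∩ {ω | X t ω = w} := by
        rw [← Set.inter_iUnion]
        exact Set.inter_eq_left.2 fun ω _ => Set.mem_iUnion.2 ⟨Y (t + 1) ω, rfl⟩
      rw [← hU, measure_iUnion, tsum_bool]
      · have hb : ∀ b, (A ∩ {ω | X t ω = w}) ∩ {ω | Y (t + 1) ω = b} =
            if n ≤ G.dist o y ∧ b = true then ∅ else
            ({ω | X t ω = w ∧ Alive G o L n (fun s => X s ω) (fun s => Y s ω) t} ∩
              {ω | X (t + 1) ω = y ∧ Y (t + 1) ω = b}) := by
          intro b
          ext ω
          simp only [hA, Set.mem_inter_iff, Set.mem_ofPred_eq, alive_succ]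
          split_ifs with hb
          · simp only [Set.mem_empty_iff_false, iff_false]
            rintro ⟨⟨⟨h1, -, -, -, h2⟩, -⟩, h3⟩
            rw [h1, h3, hb.2] at h2
            simpa using h2 hb.1
          · simp only [Set.mem_inter_iff, Set.mem_ofPred_eq]
            constructor
            · rintro ⟨⟨⟨h1, h2, -⟩, h3⟩, h4⟩
              exact ⟨⟨h3, h2⟩, h1, h4⟩
            · rintro ⟨⟨h3, h2⟩, h1, h4⟩
              refine ⟨⟨⟨h1, h2, h1 ▸ hy.2, h1 ▸ hy.1, fun hn => ?_⟩, h3⟩, h4⟩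
              rw [h1] at hn
              rw [h4]
              simpa [hn] using hb
        rw [hb, hb, if_neg (by simp), hm false]
        split_ifs with h1 h2 h2
        · rw [measure_empty, add_zero, markLaw_apply]
          simp [mul_assoc]
        · simp at h1; exact absurd h1 h2
        · simp at h1; omega
        · rw [hm, markLaw_apply, markLaw_apply, ← mul_add, ← mul_add, ← ENNReal.coe_add]
          simp only [if_true, Bool.false_eq_true, if_false]
          rw [← add_div, div_self (by positivity)]
          simp
      · intro b b' hbb
        refine Set.disjoint_left.2 fun ω h h' => hbb (h.2.symm.trans h'.2)
      · exact fun b => (hAm.inter (hXY.measurableSet_walk _ _)).inter (hXY.measurableSet_mark _ _)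
    have hU : (⋃ w, A ∩ {ω | X t ω = w}) = A := by
      rw [← Set.inter_iUnion]
      exact Set.inter_eq_left.2 fun ω _ => Set.mem_iUnion.2 ⟨X t ω, rfl⟩
    rw [← hU, measure_iUnion]
    · simp only [hstep, walkMass, if_pos hy]
      rw [ENNReal.tsum_mul_right, tsum_eq_sum (s := G.neighborFinset y), mul_comm,
        ENNReal.coe_mul]
      · congr 1
        rw [hd, ENNReal.coe_div (by positivity), div_eq_mul_inv, ENNReal.ofNNReal_finsetSum,
          Finset.sum_mul]
        refine Finset.sum_congr rfl fun w hw => ?_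
        rw [stepLaw_apply G (by rw [hd]; exact hd0), if_pos, hd, ENNReal.coe_natCast]
        exact ((G.mem_neighborFinset _ _).1 hw).symm
      · intro w hw
        rw [stepLaw_apply G (by rw [hd]; exact hd0), if_neg, mul_zero]
        exact fun h => hw ((G.mem_neighborFinset _ _).2 h.symm)
    · intro w w' hww
      exact Set.disjoint_left.2 fun ω h h' => hww (h.2.symm.trans h'.2)
    · exact fun w => hAm.inter (hXY.measurableSet_walk _ _)

theorem coe_encard_eq_tsum (s : Set ℕ) : (s.encard : ℝ≥0∞) = ∑' t, s.indicator 1 t := by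
  rw [← ENNReal.tsum_set_one, tsum_subtype s fun _ => (1 : ℝ≥0∞)]
  rfl

/-- The expected number of visits to `y`. -/
theorem IsMarkedWalk.lintegral_visits [Countable V] [IsProbabilityMeasure Q] (hconn : G.Connected)
    (hXY : IsMarkedWalk Q G lam o X Y) {d : ℕ} (hd : ∀ x, G.degree x = d) (hd0 : 0 < d)
    (L n m : ℕ) :
    ∫⁻ ω, (Set.encard {t | G.dist o (X t ω) = m ∧
        Alive G o L n (fun s => X s ω) (fun s => Y s ω) t} : ℝ≥0∞) ∂Q =
      ∑ y ∈ ball G hconn o L with G.dist o y = m, ∑' t, (walkMass G lam o L n t y : ℝ≥0∞) := by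
  have hm : ∀ t, MeasurableSet {ω | G.dist o (X t ω) = m ∧
      Alive G o L n (fun s => X s ω) (fun s => Y s ω) t} := fun t =>
    hXY.measurableSet_alive L n t fun v => G.dist o v = m
  simp only [coe_encard_eq_tsum]
  have e : ∀ ω t, Set.indicator {t | G.dist o (X t ω) = m ∧
      Alive G o L n (fun s => X s ω) (fun s => Y s ω) t} (1 : ℕ → ℝ≥0∞) t =
      Set.indicator {ω | G.dist o (X t ω) = m ∧
      Alive G o L n (fun s => X s ω) (fun s => Y s ω) t} 1 ω := fun ω t => by
    simp only [Set.indicator_apply, Set.mem_ofPred_eq, Pi.one_apply]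
  simp only [e]
  rw [lintegral_tsum fun t => (measurable_one.indicator (hm t)).aemeasurable]
  simp only [lintegral_indicator_one (hm _)]
  rw [← Summable.tsum_finsetSum fun _ _ => ENNReal.summable]
  refine tsum_congr fun t => ?_
  have hU : {ω | G.dist o (X t ω) = m ∧ Alive G o L n (fun s => X s ω) (fun s => Y s ω) t} =
      ⋃ y ∈ (ball G hconn o L).filter fun y => G.dist o y = m,
        {ω | X t ω = y ∧ Alive G o L n (fun s => X s ω) (fun s => Y s ω) t} := by
    ext ω
    simp only [Set.mem_ofPred_eq, Set.mem_iUnion, Finset.mem_filter, mem_ball, exists_prop]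
    constructor
    · rintro ⟨h1, h2⟩
      exact ⟨X t ω, ⟨(h2 t le_rfl).1, h1⟩, rfl, h2⟩
    · rintro ⟨y, ⟨-, h1⟩, rfl, h2⟩
      exact ⟨h1, h2⟩
  rw [hU, measure_biUnion_finset]
  · exact Finset.sum_congr rfl fun y _ => hXY.measure_alive hd hd0 L n t y
  · intro w _ w' _ hww
    exact Set.disjoint_left.2 fun ω h h' => hww (h.1.symm.trans h'.1)
  · exact fun y _ => hXY.measurableSet_alive L n t fun v => v = y

end MarkedWalk

/-! ## Comparison of the walk and the strategy -/

section HitProb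

variable {V : Type*} (G : SimpleGraph V) [G.LocallyFinite] (lam : ℝ≥0) (o : V)

/-- The expected number of visits to `y` up to time `T`, while the walk is counted in `walkMass`.
By reversibility it is the probability that a walk from `y` reaches `o`. -/
def hitMass (L n T : ℕ) (y : V) : ℝ := ∑ t ∈ Finset.range (T + 1), (walkMass G lam o L n t y : ℝ)

/-- The limit of `hitMass` for large times. -/
def hitProb (L n : ℕ) (y : V) : ℝ := ⨆ T, hitMass G lam o L n T y

variable {G lam o}

theorem hitMass_zero (L n : ℕ) (y : V) : hitMass G lam o L n 0 y = if y = o then 1 else 0 := by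
  simp [hitMass, walkMass, apply_ite]

/-- Summed over time, the forward equation for visits to `y` from `o` becomes the backward equation
for hitting `o` from `y`: this is where reversibility enters. A mark met on arrival at `y` becomes
the first instruction used by the particle at `y`. -/
theorem hitMass_succ (L n T : ℕ) (y : V) :
    hitMass G lam o L n (T + 1) y = if y = o then 1 else if L < G.dist o y then 0 else
      (if n ≤ G.dist o y then 1 / (1 + lam : ℝ) else 1) *
        ((∑ w ∈ G.neighborFinset y, hitMass G lam o L n T w) / G.degree y) := by
  rw [hitMass, Finset.sum_range_succ']
  simp only [walkMass]
  by_cases hy : y = o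
  · simp [hy]
  by_cases hL : L < G.dist o y
  · simp [hy, hL, not_le.2 hL]
  · simp only [hy, not_false_eq_true, not_lt.1 hL, and_self, if_true, if_false, hL, ne_eq,
      NNReal.coe_zero, add_zero, hitMass]
    rw [Finset.sum_comm, Finset.sum_div, Finset.mul_sum]
    refine Finset.sum_congr rfl fun t _ => ?_
    push_cast
    congr 1
    split_ifs <;> simp

theorem hitMass_nonneg (L n T : ℕ) (y : V) : 0 ≤ hitMass G lam o L n T y :=
  Finset.sum_nonneg fun _ _ => NNReal.coe_nonneg _

theorem hitMass_mono (L n : ℕ) (y : V) : Monotone fun T => hitMass G lam o L n T y :=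
  monotone_nat_of_le_succ fun T => by
    simp only [hitMass]
    rw [Finset.sum_range_succ _ (T + 1)]
    exact le_add_of_nonneg_right (NNReal.coe_nonneg _)

theorem average_le_one {f : V → ℝ} (hf : ∀ w, f w ≤ 1) (y : V) :
    (∑ w ∈ G.neighborFinset y, f w) / G.degree y ≤ 1 := by
  refine div_le_one_of_le₀ ?_ (Nat.cast_nonneg _)
  refine (Finset.sum_le_sum fun w _ => hf w).trans ?_
  simp

theorem hitMass_le_one (L n T : ℕ) (y : V) : hitMass G lam o L n T y ≤ 1 := by
  induction T generalizing y with
  | zero => rw [hitMass_zero]; split_ifs <;> norm_num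
  | succ T ih =>
    have h0 : 0 ≤ (∑ w ∈ G.neighborFinset y, hitMass G lam o L n T w) / G.degree y :=
      div_nonneg (Finset.sum_nonneg fun w _ => hitMass_nonneg L n T w) (Nat.cast_nonneg _)
    have h1 := average_le_one (G := G) ih y
    rw [hitMass_succ]
    split_ifs
    · exact le_rfl
    · norm_num
    · refine mul_le_one₀ ?_ h0 h1
      exact div_le_one_of_le₀ (le_add_of_nonneg_right lam.2) (by positivity)
    · rwa [one_mul]

theorem tendsto_hitMass (L n : ℕ) (y : V) :
    Tendsto (fun T => hitMass G lam o L n T y) atTop (𝓝 (hitProb G lam o L n y)) :=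
  tendsto_atTop_ciSup (hitMass_mono L n y) ⟨1, by rintro _ ⟨T, rfl⟩; exact hitMass_le_one L n T y⟩

theorem hitMass_le_hitProb (L n T : ℕ) (y : V) :
    hitMass G lam o L n T y ≤ hitProb G lam o L n y :=
  (hitMass_mono L n y).ge_of_tendsto (tendsto_hitMass L n y) T

theorem hitProb_nonneg (L n : ℕ) (y : V) : 0 ≤ hitProb G lam o L n y :=
  (hitMass_nonneg L n 0 y).trans (hitMass_le_hitProb L n 0 y)

theorem tsum_walkMass (L n : ℕ) (y : V) :
    ∑' t, (walkMass G lam o L n t y : ℝ≥0∞) = ENNReal.ofReal (hitProb G lam o L n y) := by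
  refine tendsto_nhds_unique ((tendsto_add_atTop_iff_nat 1).2 (ENNReal.tendsto_nat_tsum _)) ?_
  refine ((ENNReal.continuous_ofReal.tendsto _).comp (tendsto_hitMass L n y)).congr fun T => ?_
  simp only [Function.comp_apply, hitMass]
  rw [ENNReal.ofReal_sum_of_nonneg fun _ _ => NNReal.coe_nonneg _]
  simp

theorem isHitBound_hitProb (L : ℕ) : IsHitBound G o L (hitProb G lam o L (L + 1)) where
  root := tendsto_nhds_unique (tendsto_hitMass L (L + 1) o) <|
    tendsto_const_nhds.congr fun T => by cases T <;> simp [hitMass_zero, hitMass_succ]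
  nonneg := hitProb_nonneg L (L + 1)
  le_one z := le_of_tendsto' (tendsto_hitMass L (L + 1) z) fun T => hitMass_le_one L (L + 1) T z
  super z hz hL := by
    refine le_of_tendsto' ((tendsto_finsetSum _ fun w _ =>
      tendsto_hitMass L (L + 1) w).div_const _) fun T => ?_
    have := hitMass_le_hitProb (G := G) (lam := lam) (o := o) L (L + 1) (T + 1) z
    rwa [hitMass_succ, if_neg hz, if_neg (not_lt.2 hL), if_neg (by omega), one_mul] at this

theorem walkValue_le_one (L n T : ℕ) (z : V) : walkValue G lam o L n T z ≤ 1 :=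
  IsHitBound.walkValue_le (h := fun _ => 1) ⟨rfl, fun _ => zero_le_one, fun _ => le_rfl,
    fun z _ _ => average_le_one (fun _ => le_rfl) z⟩ n T z

theorem walkValue_mono (L n : ℕ) (z : V) : Monotone fun T => walkValue G lam o L n T z := by
  refine monotone_nat_of_le_succ fun T => ?_
  induction T generalizing z with
  | zero =>
    by_cases hz : z = o
    · simp [walkValue, hz]
    · have := walkValue_nonneg (G := G) (lam := lam) (o := o) L n 1 z
      simpa [walkValue, hz] using this
  | succ T ih =>
    rw [walkValue, walkValue]
    dsimp only
    split_ifs with h1 h2 h3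
    · exact le_rfl
    · exact le_rfl
    · have := ih z
      gcongr with w hw
      exact ih w
    · gcongr with w hw
      exact ih w

theorem tendsto_walkValue (L n : ℕ) (z : V) :
    Tendsto (fun T => walkValue G lam o L n T z) atTop (𝓝 (⨆ T, walkValue G lam o L n T z)) :=
  tendsto_atTop_ciSup (walkValue_mono L n z)
    ⟨1, by rintro _ ⟨T, rfl⟩; exact walkValue_le_one L n T z⟩

/-- Ineffective sleep instructions only delay the particle. In the limit of many topplings
`walkValue` solves the equation without these delays, and `hitMass` is its iteration from below. -/
theorem hitProb_le_iSup_walkValue (L n : ℕ) (z : V) :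
    hitProb G lam o L n z ≤ ⨆ T, walkValue G lam o L n T z := by
  set v : V → ℝ := fun z => ⨆ T, walkValue G lam o L n T z with hv
  have hle : ∀ T z, walkValue G lam o L n T z ≤ v z := fun T z =>
    (walkValue_mono L n z).ge_of_tendsto (tendsto_walkValue L n z) T
  have hfix : ∀ z, z ≠ o → G.dist o z ≤ L → v z = (lam * (if G.dist o z < n then v z else 0) +
      (∑ w ∈ G.neighborFinset z, v w) / G.degree z) / (1 + lam) := by
    intro z hz hL
    refine tendsto_nhds_unique ((tendsto_add_atTop_iff_nat 1).2 (tendsto_walkValue L n z)) ?_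
    simp only [walkValue, if_neg hz, if_neg (not_lt.2 hL)]
    refine ((Tendsto.const_mul _ ?_).add
      ((tendsto_finsetSum _ fun w _ => tendsto_walkValue L n w).div_const _)).div_const _
    split_ifs
    · exact tendsto_walkValue L n z
    · exact tendsto_const_nhds
  refine le_of_tendsto' (tendsto_hitMass L n z) fun T => ?_
  have hlam : (0 : ℝ) < 1 + lam := by positivity
  induction T generalizing z with
  | zero =>
    rw [hitMass_zero]
    simpa [walkValue] using hle 0 z
  | succ T ih =>
    rw [hitMass_succ]
    by_cases hz : z = o
    · rw [if_pos hz]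
      simpa [walkValue, hz] using hle 0 z
    rw [if_neg hz]
    split_ifs with hL hn
    · exact (walkValue_nonneg L n 0 z).trans (hle 0 z)
    · change _ ≤ v z
      rw [hfix z hz (not_lt.1 hL), if_neg (not_lt.2 hn), mul_zero, zero_add, one_div,
        div_eq_inv_mul _ (1 + (lam : ℝ))]
      gcongr with w hw
      exact ih w
    · have h1 := hfix z hz (not_lt.1 hL)
      rw [if_pos (not_le.1 hn), eq_div_iff hlam.ne'] at h1
      -- The self-loop of weight `lam / (1 + lam)` cancels from the limiting equation.
      have h2 : v z = (∑ w ∈ G.neighborFinset z, v w) / G.degree z := by linarith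
      change _ ≤ v z
      rw [h2, one_mul]
      gcongr with w hw
      exact ih w

theorem exists_le_sum_walkValue (L : ℕ) (U : Finset V) {ε : ℝ} (hε : 0 < ε) :
    ∃ T, ∑ y ∈ U, hitProb G lam o L (G.dist o y) y - ε ≤
      ∑ y ∈ U, walkValue G lam o L (G.dist o y) T y := by
  have h := tendsto_finsetSum U fun y _ =>
    tendsto_walkValue (G := G) (lam := lam) (o := o) L (G.dist o y) y
  have h1 : ∑ y ∈ U, hitProb G lam o L (G.dist o y) y - ε <
      ∑ y ∈ U, ⨆ T, walkValue G lam o L (G.dist o y) T y :=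
    (sub_lt_self _ hε).trans_le (Finset.sum_le_sum fun y _ => hitProb_le_iSup_walkValue _ _ y)
  obtain ⟨T, hT⟩ := (h.eventually (lt_mem_nhds h1)).exists
  exact ⟨T, hT.le⟩

variable {Ω : Type*} [MeasurableSpace Ω] {Q : Measure Ω} {X : ℕ → Ω → V} {Y : ℕ → Ω → Bool}

theorem lintegral_natCast_sum {s : Finset ℕ} {F : ℕ → Ω → ℕ∞}
    (hF : ∀ n ∈ s, Measurable fun ω => (F n ω : ℝ≥0∞)) :
    ∫⁻ ω, ((∑ n ∈ s, F n ω : ℕ∞) : ℝ≥0∞) ∂Q = ∑ n ∈ s, ∫⁻ ω, (F n ω : ℝ≥0∞) ∂Q := by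
  rw [← lintegral_finsetSum' _ fun n hn => (hF n hn).aemeasurable]
  refine lintegral_congr fun ω => ?_
  exact map_sum ENat.toENNRealRingHom _ _

theorem IsMarkedWalk.measurable_encard [Countable V] (hXY : IsMarkedWalk Q G lam o X Y)
    (L n m : ℕ) : Measurable fun ω => (Set.encard {t | G.dist o (X t ω) = m ∧
      Alive G o L n (fun s => X s ω) (fun s => Y s ω) t} : ℝ≥0∞) := by
  simp only [coe_encard_eq_tsum]
  refine Measurable.tsum fun t => ?_
  have hm := hXY.measurableSet_alive L n t fun v => G.dist o v = m
  simp only [Set.indicator_apply, Pi.one_apply]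
  exact Measurable.ite hm measurable_const measurable_const

theorem IsMarkedWalk.lintegral_sum_visits [Countable V] [IsProbabilityMeasure Q]
    (hconn : G.Connected) (hXY : IsMarkedWalk Q G lam o X Y) {d : ℕ} (hd : ∀ x, G.degree x = d)
    (hd0 : 0 < d) (L : ℕ) (n : ℕ → ℕ) :
    ∫⁻ ω, ((∑ m ∈ Finset.range (L + 1), Set.encard {t | G.dist o (X t ω) = m ∧
        Alive G o L (n m) (fun s => X s ω) (fun s => Y s ω) t} : ℕ∞) : ℝ≥0∞) ∂Q =
      ENNReal.ofReal (∑ y ∈ ball G hconn o L, hitProb G lam o L (n (G.dist o y)) y) := by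
  rw [lintegral_natCast_sum fun m _ => hXY.measurable_encard L (n m) m]
  simp only [hXY.lintegral_visits hconn hd hd0, tsum_walkMass]
  rw [ENNReal.ofReal_sum_of_nonneg fun y _ => hitProb_nonneg _ _ y,
    ← Finset.sum_fiberwise_of_maps_to (s := ball G hconn o L) (t := Finset.range (L + 1))
      (g := G.dist o) fun y hy => Finset.mem_range.2 (Nat.lt_succ_of_le ((mem_ball G).1 hy))]
  refine Finset.sum_congr rfl fun m _ => Finset.sum_congr rfl fun y hy => ?_
  rw [(Finset.mem_filter.1 hy).2]

theorem IsMarkedWalk.meanVisits_eq [Countable V] [IsProbabilityMeasure Q]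
    (hconn : G.Connected) (hXY : IsMarkedWalk Q G lam o X Y) {d : ℕ} (hd : ∀ x, G.degree x = d)
    (hd0 : 0 < d) (L : ℕ) : meanVisits Q G o X L =
      ENNReal.ofReal (∑ y ∈ ball G hconn o L, hitProb G lam o L (L + 1) y) := by
  rw [← hXY.lintegral_sum_visits hconn hd hd0 L fun _ => L + 1]
  refine lintegral_congr fun ω => ?_
  simp only [totalVisits, visits, lt_exitTime_inf_returnTime_iff_alive fun t => Y t ω]

theorem IsMarkedWalk.meanVisitsKilled_eq [Countable V] [IsProbabilityMeasure Q]
    (hconn : G.Connected) (hXY : IsMarkedWalk Q G lam o X Y) {d : ℕ} (hd : ∀ x, G.degree x = d)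
    (hd0 : 0 < d) (L : ℕ) : meanVisitsKilled Q G o X Y L =
      ENNReal.ofReal (∑ y ∈ ball G hconn o L, hitProb G lam o L (G.dist o y) y) := by
  rw [← hXY.lintegral_sum_visits hconn hd hd0 L fun m => m]
  refine lintegral_congr fun ω => ?_
  simp only [totalVisitsKilled, visits, lt_times_iff_alive]

end HitProb

/-! ## The number of active particles at the root -/

section SiteBound

/-- An upper bound for `siteFactor` that is affine in `f`. -/
def siteBound (c f h : ℝ) (k : ℕ) : ℝ :=
  1 - f * (1 - (1 - c) ^ k) + c * (h - f) / (1 - c) * Set.indicator {0} (fun _ => 1) k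

/-- For `k ≥ 1`, `1 - c f` is the convex combination of `1` and `1 - c` with weight `f`, and `t ^ k`
is convex. For a hole the quotient is `1 + c (h - f) / (1 - c h)`, and `1 - c h ≥ 1 - c`. -/
theorem siteFactor_le_siteBound {c f h : ℝ} (hc0 : 0 ≤ c) (hc1 : c < 1) (hf0 : 0 ≤ f) (hfh : f ≤ h)
    (hh : h ≤ 1) (k : ℕ) : siteFactor c f h k ≤ siteBound c f h k := by
  have h1 : 0 < 1 - c := by linarith
  have hch : c * h ≤ c * 1 := mul_le_mul_of_nonneg_left hh hc0
  have h2 : 0 < 1 - c * h := by linarith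
  unfold siteFactor siteBound
  split_ifs with hk
  · subst hk
    simp only [pow_zero, sub_self, mul_zero, sub_zero, Set.mem_singleton_iff, Set.indicator_of_mem,
      mul_one]
    have h3 : 0 ≤ c * (h - f) := mul_nonneg hc0 (by linarith)
    have h4 : (1 - c * f) / (1 - c * h) = 1 + c * (h - f) / (1 - c * h) := by
      field_simp
      ring
    rw [h4]
    gcongr
    linarith
  · rw [Set.indicator_of_notMem (by simpa using hk), mul_zero, add_zero]
    have := (convexOn_pow k).2 (show (1 : ℝ) ∈ Set.Ici 0 by simp)
      (show 1 - c ∈ Set.Ici 0 from h1.le) (show 0 ≤ 1 - f by linarith) hf0 (by ring)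
    simp only [smul_eq_mul, one_pow] at this
    rw [show 1 - c * f = (1 - f) * 1 + f * (1 - c) by ring]
    refine this.trans (le_of_eq ?_)
    ring

theorem siteFactor_nonneg {c f h : ℝ} (hc0 : 0 ≤ c) (hc1 : c ≤ 1) (hf : f ≤ 1) (hh : h ≤ 1) (k : ℕ) :
    0 ≤ siteFactor c f h k := by
  have hf' := mul_le_mul_of_nonneg_left hf hc0
  have hh' := mul_le_mul_of_nonneg_left hh hc0
  unfold siteFactor
  split_ifs
  · exact div_nonneg (by linarith) (by linarith)
  · exact pow_nonneg (by linarith) k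

theorem siteBound_one (c : ℝ) (k : ℕ) : siteBound c 1 1 k = (1 - c) ^ k := by
  simp [siteBound]

variable {ν : Measure ℕ} [IsProbabilityMeasure ν]

theorem integrable_one_sub_pow {c : ℝ} (hc0 : 0 ≤ c) (hc1 : c ≤ 1) :
    Integrable (fun k : ℕ => (1 - c) ^ k) ν := by
  refine (integrable_const (1 : ℝ)).mono' (by fun_prop) (ae_of_all _ fun k => ?_)
  rw [Real.norm_of_nonneg (pow_nonneg (by linarith) k)]
  exact pow_le_one₀ (by linarith) (by linarith)

theorem lintegral_siteBound_le {c f h : ℝ} (hc0 : 0 ≤ c) (hc1 : c < 1) (hfh : f ≤ h) (hf1 : f ≤ 1) :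
    ∫⁻ k, ENNReal.ofReal (siteBound c f h k) ∂ν ≤ ENNReal.ofReal (Real.exp
      (-(f * (1 - ∫ k : ℕ, (1 - c) ^ k ∂ν)) + c * (h - f) / (1 - c) * ν.real {0})) := by
  have hq := integrable_one_sub_pow (ν := ν) hc0 hc1.le
  have hi : Integrable (Set.indicator {0} fun _ : ℕ => (1 : ℝ)) ν :=
    (integrable_const 1).indicator (by measurability)
  have hq' : Integrable (fun k : ℕ => 1 - (1 - c) ^ k) ν := (integrable_const _).sub hq
  have h1 : Integrable (fun k : ℕ => 1 - f * (1 - (1 - c) ^ k)) ν :=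
    (integrable_const _).sub (hq'.const_mul _)
  have h2 := hi.const_mul (c * (h - f) / (1 - c))
  rw [← ofReal_integral_eq_lintegral_ofReal]
  · refine ENNReal.ofReal_le_ofReal ?_
    have e : ∫ k, siteBound c f h k ∂ν =
        1 - f * (1 - ∫ k : ℕ, (1 - c) ^ k ∂ν) + c * (h - f) / (1 - c) * ν.real {0} := by
      simp only [siteBound]
      rw [integral_add h1 h2, integral_const_mul, integral_indicator_const _ (by measurability),
        integral_sub (integrable_const _) (hq'.const_mul _),
        integral_const_mul, integral_sub (integrable_const _) hq]
      simp
    rw [e]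
    refine le_trans (le_of_eq ?_) (Real.add_one_le_exp _)
    ring
  · exact h1.add h2
  · refine ae_of_all _ fun k => ?_
    have h3 : (1 - c) ^ k ≤ 1 := pow_le_one₀ (by linarith) (by linarith)
    have h4 : 0 ≤ (1 - c) ^ k := pow_nonneg (by linarith) k
    have h5 : f * (1 - (1 - c) ^ k) ≤ 1 := mul_le_one₀ hf1 (by linarith) (by linarith)
    have h6 : 0 ≤ c * (h - f) / (1 - c) :=
      div_nonneg (mul_nonneg hc0 (by linarith)) (by linarith)
    have h7 : 0 ≤ Set.indicator {0} (fun _ : ℕ => (1 : ℝ)) k :=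
      Set.indicator_nonneg (fun _ _ => zero_le_one) k
    have := mul_nonneg h6 h7
    simp only [Pi.zero_apply, siteBound]
    linarith

end SiteBound

/-! ### The exponential moment of the number of active particles at the root -/

section Root

variable {V : Type*} {G : SimpleGraph V} [G.LocallyFinite] {lam : ℝ≥0} {o : V}
  {ν : Measure ℕ} [IsProbabilityMeasure ν]

theorem potential_le_prod_siteBound {L T : ℕ} {c : ℝ} (hc0 : 0 ≤ c) (hc1 : c < 1) {h : V → ℝ}
    (hh : IsHitBound G o L h) {S : Finset V} (hoS : o ∈ S) (ρ : V → ℕ) :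
    potential G lam o L T c h (S.erase o) ρ ≤
      ∏ y ∈ S, siteBound c (walkValue G lam o L (G.dist o y) T y) (h y) (ρ y) := by
  rw [potential, ← Finset.mul_prod_erase S _ hoS, walkValue_root, hh.root, siteBound_one]
  have h1 : 0 ≤ 1 - c := by linarith
  gcongr with y hy
  · exact fun y _ => siteFactor_nonneg hc0 hc1.le (walkValue_le_one _ _ _ _) (hh.le_one y) _
  · exact siteFactor_le_siteBound hc0 hc1 (walkValue_nonneg _ _ _ _) (hh.walkValue_le _ _ _)
      (hh.le_one y) _

/-- An exponential bound for the probability that at most `N` active particles can be brought to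
`o` from the ball of radius `L`. -/
theorem measure_forall_reach_le [Countable V] (hconn : G.Connected) (hdeg : ∀ x, 0 < G.degree x)
    (L T : ℕ) {c : ℝ} (hc0 : 0 ≤ c) (hc1 : c < 1) {h : V → ℝ} (hh : IsHitBound G o L h) (N : ℕ) :
    ENNReal.ofReal ((1 - c) ^ N) * law G lam ν {ω | ∀ cfg u,
        Reach (initial ω (ball G hconn o L)) ω.2.1 cfg u → (cfg o).numActive ≤ N} ≤
      ENNReal.ofReal (Real.exp (∑ y ∈ ball G hconn o L,
        (-(walkValue G lam o L (G.dist o y) T y * (1 - ∫ k : ℕ, (1 - c) ^ k ∂ν)) +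
          c * (h y - walkValue G lam o L (G.dist o y) T y) / (1 - c) * ν.real {0}))) := by
  set S := ball G hconn o L with hS
  have hoS : o ∈ S := by simp [hS]
  set v : V → ℝ := fun y => walkValue G lam o L (G.dist o y) T y with hv
  -- The strategy depends on the initial numbers only through their restriction to the finite ball.
  -- These restrictions are countably many, so the bounds chosen for each of them are jointly
  -- measurable.
  let ext : (S → ℕ) → V → ℕ := fun q x => if h : x ∈ S then q ⟨x, h⟩ else 0
  have hext : ∀ η : V → ℕ, ext (S.restrict η) = fun x => if x ∈ S then η x else 0 := fun η => by
    funext x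
    simp [ext]
  have hB : ∀ q, Bounded G lam o c (ext q) (potential G lam o L T c h (S.erase o) (ext q)) :=
    fun q => bounded_potential hdeg T hc0 hc1 hh (S.erase o) (Finset.notMem_erase o S)
      (fun z hz hzL _ _ _ => Finset.mem_erase.2 ⟨hz, (mem_ball G).2 hzL⟩) _
      (fun y hy => (mem_ball G).1 (Finset.mem_of_mem_erase hy))
  choose K hK _ hr hle using fun q => (hB q).exists_realization hdeg hc0 hc1.le 0
  let F : Sample V → ℝ≥0∞ := fun ω => K (S.restrict ω.1) ω.2.1
  have hFm : Measurable F :=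
    measurable_apply_of_countable (n := fun ω : Sample V => S.restrict ω.1)
      (f := fun q (ω : Sample V) => K q ω.2.1) ((Finset.measurable_restrict S).comp measurable_fst)
      fun q => (hK q).comp (measurable_fst.comp measurable_snd)
  have hsub : {ω : Sample V | ∀ cfg u, Reach (initial ω S) ω.2.1 cfg u → (cfg o).numActive ≤ N} ⊆
      {ω | ENNReal.ofReal ((1 - c) ^ N) ≤ F ω} := by
    intro ω hω
    have hi : ext (S.restrict ω.1) = initial ω S := hext ω.1
    obtain ⟨cfg, u, h1, h2⟩ := hr (S.restrict ω.1) (initial ω S) ω.2.1 _ Reach.start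
      fun y => by rw [hi]; rfl
    refine le_trans (ENNReal.ofReal_le_ofReal ?_) h2
    exact pow_le_pow_of_le_one (by linarith) (by linarith) (hω cfg u h1)
  calc _ ≤ ENNReal.ofReal ((1 - c) ^ N) * law G lam ν {ω | ENNReal.ofReal ((1 - c) ^ N) ≤ F ω} := by
        gcongr
    _ ≤ ∫⁻ ω, F ω ∂law G lam ν := mul_meas_ge_le_lintegral hFm _
    _ = ∫⁻ η, ∫⁻ I, K (S.restrict η) I ∂instrMeasure G lam
          ∂Measure.infinitePi fun _ : V => ν := by
        rw [law, lintegral_prod _ hFm.aemeasurable]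
        refine lintegral_congr fun η => ?_
        exact (measurePreserving_fst (μ := instrMeasure G lam) (ν := Measure.infinitePi fun _ : V =>
          Measure.infinitePi fun _ : ℕ => clockLaw lam)).lintegral_comp (hK (S.restrict η))
    _ ≤ ∫⁻ η, ∏ y ∈ S, ENNReal.ofReal (siteBound c (v y) (h y) (η y))
          ∂Measure.infinitePi fun _ : V => ν := by
        refine lintegral_mono fun η => (hle _).trans ?_
        have hpos : ∀ y ∈ S, 0 ≤ siteBound c (v y) (h y) (η y) := fun y _ =>
          (siteFactor_nonneg hc0 hc1.le (walkValue_le_one _ _ _ _) (hh.le_one y) _).trans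
            (siteFactor_le_siteBound hc0 hc1 (walkValue_nonneg _ _ _ _) (hh.walkValue_le _ _ _)
              (hh.le_one y) _)
        rw [← ENNReal.ofReal_prod_of_nonneg hpos]
        refine ENNReal.ofReal_le_ofReal
          ((potential_le_prod_siteBound hc0 hc1 hh hoS _).trans (le_of_eq ?_))
        refine Finset.prod_congr rfl fun y hy => ?_
        simp only [hext, if_pos hy, hv]
    _ = ∏ y ∈ S, ∫⁻ k, ENNReal.ofReal (siteBound c (v y) (h y) k) ∂ν := by
        rw [lintegral_prod_eq_prod_lintegral_of_indepFun S
          (fun y (η : V → ℕ) => ENNReal.ofReal (siteBound c (v y) (h y) (η y)))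
          (iIndepFun_infinitePi (X := fun y k => ENNReal.ofReal (siteBound c (v y) (h y) k))
            fun y => measurable_of_countable _)
          fun y => (measurable_of_countable
            fun k => ENNReal.ofReal (siteBound c (v y) (h y) k)).comp (measurable_pi_apply y)]
        refine Finset.prod_congr rfl fun y _ => ?_
        exact (measurePreserving_eval_infinitePi (fun _ : V => ν) y).lintegral_comp
          (f := fun k => ENNReal.ofReal (siteBound c (v y) (h y) k)) (measurable_of_countable _)
    _ ≤ ∏ y ∈ S, ENNReal.ofReal (Real.exp (-(v y * (1 - ∫ k : ℕ, (1 - c) ^ k ∂ν)) +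
          c * (h y - v y) / (1 - c) * ν.real {0})) := by
        gcongr with y _
        exact lintegral_siteBound_le hc0 hc1 (hh.walkValue_le _ _ _) (walkValue_le_one _ _ _ _)
    _ = _ := by
        rw [Real.exp_sum, ENNReal.ofReal_prod_of_nonneg fun y _ => (Real.exp_pos _).le]

end Root

/-! ## Activity -/

/-! ### The generating function of the initial law for small `c` -/

section Generating

variable {ν : Measure ℕ} [IsProbabilityMeasure ν]

theorem one_le_mean_add_measureReal_zero (hint : Integrable (fun k : ℕ => (k : ℝ)) ν) :
    1 ≤ ∫ k : ℕ, (k : ℝ) ∂ν + ν.real {0} := by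
  have hi : Integrable (Set.indicator {0} fun _ : ℕ => (1 : ℝ)) ν :=
    (integrable_const 1).indicator (by measurability)
  have h : ∫ _ : ℕ, (1 : ℝ) ∂ν ≤ ∫ k : ℕ, ((k : ℝ) + Set.indicator {0} (fun _ => 1) k) ∂ν := by
    refine integral_mono (integrable_const 1) (hint.add hi) fun k => ?_
    rcases Nat.eq_zero_or_pos k with rfl | hk
    · simp
    · have : (1 : ℝ) ≤ k := by exact_mod_cast hk
      simp [hk.ne', this]
  rw [integral_add hint hi, integral_indicator_const _ (by measurability)] at h
  simpa using h

theorem one_sub_integral_pow {c : ℝ} (hc0 : 0 < c) (hc1 : c < 1) :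
    (1 - ∫ k : ℕ, (1 - c) ^ k ∂ν) / c = ∫ k : ℕ, ∑ j ∈ Finset.range k, (1 - c) ^ j ∂ν := by
  have h : ∀ k : ℕ, ∑ j ∈ Finset.range k, (1 - c) ^ j = (1 - (1 - c) ^ k) / c := fun k => by
    rw [eq_div_iff hc0.ne', mul_comm, ← mul_neg_geom_sum]
    ring
  simp only [h]
  rw [integral_div, integral_sub (integrable_const _) (integrable_one_sub_pow hc0.le hc1.le)]
  simp

theorem tendsto_one_sub_integral_pow (hint : Integrable (fun k : ℕ => (k : ℝ)) ν) :
    Tendsto (fun c : ℝ => (1 - ∫ k : ℕ, (1 - c) ^ k ∂ν) / c) (𝓝[>] 0) (𝓝 (∫ k : ℕ, (k : ℝ) ∂ν)) := by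
  have hc : ∀ᶠ c : ℝ in 𝓝[>] 0, c ∈ Set.Ioo (0 : ℝ) 1 := Ioo_mem_nhdsGT one_pos
  have h : Tendsto (fun c : ℝ => ∫ k : ℕ, ∑ j ∈ Finset.range k, (1 - c) ^ j ∂ν) (𝓝[>] 0)
      (𝓝 (∫ k : ℕ, (k : ℝ) ∂ν)) := by
    refine tendsto_integral_filter_of_dominated_convergence (fun k => (k : ℝ))
      (.of_forall fun c => (measurable_of_countable _).aestronglyMeasurable) ?_ hint
      (ae_of_all _ fun k => ?_)
    · filter_upwards [hc] with c hc
      refine ae_of_all _ fun k => ?_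
      have h0 : 0 ≤ 1 - c := by linarith [hc.2]
      have h1 : 1 - c ≤ 1 := by linarith [hc.1]
      rw [Real.norm_of_nonneg (Finset.sum_nonneg fun j _ => pow_nonneg h0 j)]
      refine (Finset.sum_le_sum fun j _ => pow_le_one₀ (n := j) h0 h1).trans ?_
      simp
    · have : Tendsto (fun c : ℝ => ∑ j ∈ Finset.range k, (1 - c) ^ j) (𝓝 0)
          (𝓝 (∑ j ∈ Finset.range k, (1 - 0 : ℝ) ^ j)) :=
        Continuous.tendsto (by fun_prop) 0
      simp only [sub_zero, one_pow, Finset.sum_const, Finset.card_range, nsmul_eq_mul,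
        mul_one] at this
      exact this.mono_left nhdsWithin_le_nhds
  refine h.congr' ?_
  filter_upwards [hc] with c hc
  exact (one_sub_integral_pow hc.1 hc.2).symm

/-- Divided by `c`, the expression tends to `μ + ν₀ (1 - 1 / r)` as `c → 0`, which is positive by
`hr`. A finite mean suffices: `(1 - (1 - c) ^ k) / c` is a geometric sum bounded by `k`. -/
theorem exists_rate_pos (hint : Integrable (fun k : ℕ => (k : ℝ)) ν) {r : ℝ} (hr0 : 0 < r)
    (hr : ν.real {0} < r * (∫ k : ℕ, (k : ℝ) ∂ν + ν.real {0})) :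
    ∃ c : ℝ, 0 < c ∧ c < 1 ∧ 0 < (1 - ∫ k : ℕ, (1 - c) ^ k ∂ν) +
      c / (1 - c) * ν.real {0} - c / (1 - c) * ν.real {0} / r := by
  have hc : ∀ᶠ c : ℝ in 𝓝[>] 0, c ∈ Set.Ioo (0 : ℝ) 1 := Ioo_mem_nhdsGT one_pos
  have h1 : Tendsto (fun c : ℝ => ν.real {0} / (1 - c) * (1 - 1 / r)) (𝓝[>] 0)
      (𝓝 (ν.real {0} / (1 - 0) * (1 - 1 / r))) := by
    refine Tendsto.mono_left ?_ nhdsWithin_le_nhds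
    refine (tendsto_const_nhds.div (tendsto_const_nhds.sub tendsto_id) ?_).mul_const _
    norm_num
  have h2 := (tendsto_one_sub_integral_pow hint).add h1
  have h3 : 0 < ∫ k : ℕ, (k : ℝ) ∂ν + ν.real {0} / (1 - 0) * (1 - 1 / r) := by
    have : ∫ k : ℕ, (k : ℝ) ∂ν + ν.real {0} / (1 - 0) * (1 - 1 / r) =
        (r * (∫ k : ℕ, (k : ℝ) ∂ν + ν.real {0}) - ν.real {0}) / r := by
      field_simp
      ring
    rw [this]
    exact div_pos (by linarith) hr0
  obtain ⟨c, h4, h5⟩ := ((h2.eventually (lt_mem_nhds h3)).and hc).exists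
  refine ⟨c, h5.1, h5.2, ?_⟩
  have h6 := mul_pos h5.1 h4
  have h7 : c ≠ 0 := h5.1.ne'
  have h8 : 1 - c ≠ 0 := (sub_pos.2 h5.2).ne'
  refine h6.trans_le (le_of_eq ?_)
  field_simp
  ring

end Generating

/-! ### Divergence of the exponent -/

section Activity

variable {V : Type*} {G : SimpleGraph V} [G.LocallyFinite] {lam : ℝ≥0} {o : V}
  {ν : Measure ℕ} [IsProbabilityMeasure ν]

/-- If the numbers of visits are large enough then arbitrarily many active particles can be brought
to `o`. -/
theorem ae_exists_reach [Countable V] (hconn : G.Connected) (hdeg : ∀ x, 0 < G.degree x)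
    (hint : Integrable (fun k : ℕ => (k : ℝ)) ν) {r : ℝ} (hr0 : 0 < r)
    (hr : ν.real {0} < r * (∫ k : ℕ, (k : ℝ) ∂ν + ν.real {0}))
    (hratio : ∀ᶠ L in atTop, r * ∑ y ∈ ball G hconn o L, hitProb G lam o L (L + 1) y ≤
      ∑ y ∈ ball G hconn o L, hitProb G lam o L (G.dist o y) y)
    (hlim : Tendsto (fun L => ∑ y ∈ ball G hconn o L, hitProb G lam o L (G.dist o y) y)
      atTop atTop) :
    ∀ᵐ ω ∂law G lam ν, ∀ N, ∃ S cfg u, Reach (initial ω S) ω.2.1 cfg u ∧ N < (cfg o).numActive := by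
  obtain ⟨c, hc0, hc1, hκ⟩ := exists_rate_pos hint hr0 hr
  set a := 1 - ∫ k : ℕ, (1 - c) ^ k ∂ν with ha
  set b := c / (1 - c) * ν.real {0} with hb
  have hb0 : 0 ≤ b := mul_nonneg (div_nonneg hc0.le (by linarith)) measureReal_nonneg
  have ha0 : 0 ≤ a := by
    have := integral_mono (integrable_one_sub_pow (ν := ν) hc0.le hc1.le)
      (integrable_const (1 : ℝ)) fun k => pow_le_one₀ (n := k) (by linarith) (by linarith)
    simp only [integral_const, probReal_univ, smul_eq_mul, mul_one] at this
    linarith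
  refine ae_all_iff.2 fun N => ?_
  set E := {ω : Sample V | ∀ L cfg u,
    Reach (initial ω (ball G hconn o L)) ω.2.1 cfg u → (cfg o).numActive ≤ N} with hE
  have hbound : ∀ᶠ L in atTop, ENNReal.ofReal ((1 - c) ^ N) * law G lam ν E ≤
      ENNReal.ofReal (Real.exp (-((a + b - b / r) *
        ∑ y ∈ ball G hconn o L, hitProb G lam o L (G.dist o y) y) + (a + b))) := by
    filter_upwards [hratio] with L hL
    -- The number `T` of topplings per particle may depend on `L`. An error of at most `1` in the
    -- sum costs only the constant `a + b` in the exponent.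
    obtain ⟨T, hT⟩ := exists_le_sum_walkValue (G := G) (lam := lam) (o := o) L
      (ball G hconn o L) one_pos
    refine le_trans ?_ ((measure_forall_reach_le (ν := ν) (o := o) (lam := lam) hconn hdeg L T hc0.le hc1
      (isHitBound_hitProb (o := o) (lam := lam) L) N).trans
        (ENNReal.ofReal_le_ofReal (Real.exp_le_exp.2 ?_)))
    · gcongr
      exact fun ω hω => hω L
    · set m := ∑ y ∈ ball G hconn o L, hitProb G lam o L (G.dist o y) y
      set m₁ := ∑ y ∈ ball G hconn o L, hitProb G lam o L (L + 1) y
      set v := ∑ y ∈ ball G hconn o L, walkValue G lam o L (G.dist o y) T y with hv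
      have e : ∑ y ∈ ball G hconn o L, (-(walkValue G lam o L (G.dist o y) T y * a) +
          c * (hitProb G lam o L (L + 1) y - walkValue G lam o L (G.dist o y) T y) / (1 - c) *
            ν.real {0}) = -((a + b) * v) + b * m₁ := by
        rw [hv, Finset.mul_sum, Finset.mul_sum, ← Finset.sum_neg_distrib, ← Finset.sum_add_distrib]
        refine Finset.sum_congr rfl fun y _ => ?_
        rw [hb]
        ring
      rw [e]
      have h1 : (a + b) * (m - 1) ≤ (a + b) * v := mul_le_mul_of_nonneg_left hT (by linarith)
      have h2 : b * m₁ ≤ b * (m / r) := by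
        gcongr
        rw [le_div_iff₀ hr0, mul_comm]
        exact hL
      have h3 : b * (m / r) = b / r * m := by ring
      nlinarith
  have hzero : Tendsto (fun L => ENNReal.ofReal (Real.exp (-((a + b - b / r) *
      ∑ y ∈ ball G hconn o L, hitProb G lam o L (G.dist o y) y) + (a + b)))) atTop (𝓝 0) := by
    rw [← ENNReal.ofReal_zero]
    refine (ENNReal.continuous_ofReal.tendsto 0).comp (Real.tendsto_exp_atBot.comp ?_)
    exact tendsto_atBot_add_const_right _ _
      (tendsto_neg_atTop_atBot.comp (hlim.const_mul_atTop hκ))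
  have h0 := ge_of_tendsto hzero hbound
  have hpos : ENNReal.ofReal ((1 - c) ^ N) ≠ 0 :=
    (ENNReal.ofReal_pos.2 (pow_pos (by linarith) N)).ne'
  have hE0 : law G lam ν E = 0 := (mul_eq_zero.1 (le_zero_iff.1 h0)).resolve_left hpos
  filter_upwards [measure_eq_zero_iff_ae_notMem.1 hE0] with ω hω
  simp only [hE, Set.mem_ofPred_eq, not_forall, not_le] at hω
  obtain ⟨L, cfg, u, h1, h2⟩ := hω
  exact ⟨_, cfg, u, h1, h2⟩

end Activity

end ARW

end

/-! ### Conclusion -/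

theorem theorem6 {V : Type*} [Infinite V] (G : SimpleGraph V) [G.LocallyFinite]
    (hconn : G.Connected) (htrans : ∀ u v : V, ∃ φ : G ≃g G, φ u = v)
    (lam : ℝ≥0) (hlam : 0 < lam)
    -- the initial number of particles at a vertex: its law, its mean, the mass of zero
    (ν : Measure ℕ) [IsProbabilityMeasure ν] (hint : Integrable (fun k : ℕ => (k : ℝ)) ν)
    (μ ν₀ : ℝ) (hμ : μ = ∫ k : ℕ, (k : ℝ) ∂ν) (hν₀ : ν₀ = ν.real {0})
    -- simple random walk from the origin, and the independent marks
    (o : V) {Ω : Type*} [MeasurableSpace Ω] (Q : Measure Ω) [IsProbabilityMeasure Q]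
    (X : ℕ → Ω → V) (Y : ℕ → Ω → Bool) (hXY : ARW.IsMarkedWalk Q G lam o X Y)
    (hratio : ENNReal.ofReal (ν₀ / (μ + ν₀)) <
      liminf (fun L : ℕ => ARW.meanVisitsKilled Q G o X Y L / ARW.meanVisits Q G o X L) atTop)
    (hlim : Tendsto (fun L : ℕ => ARW.meanVisitsKilled Q G o X Y L) atTop (𝓝 ⊤)) :
    ∀ᵐ ω ∂(ARW.law G lam ν), ARW.IsActive ω := by
  have := ARW.countable_of_connected G hconn
  have hd : ∀ x, G.degree x = G.degree o := fun x => ARW.degree_eq_of_transitive G htrans x o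
  have hd0 : 0 < G.degree o := ARW.degree_pos_of_connected G hconn o
  have hdeg : ∀ x, 0 < G.degree x := ARW.degree_pos_of_connected G hconn
  have hν : ∫⁻ k, (k : ℝ≥0∞) ∂ν ≠ ∞ := by
    have h := hint.hasFiniteIntegral
    rw [hasFiniteIntegral_iff_ofReal (ae_of_all _ fun k => Nat.cast_nonneg k)] at h
    simpa only [ENNReal.ofReal_natCast] using h.ne
  simp only [hXY.meanVisits_eq hconn hd hd0, hXY.meanVisitsKilled_eq hconn hd hd0] at hratio hlim
  have hμν : 1 ≤ μ + ν₀ := by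
    rw [hμ, hν₀]
    exact ARW.one_le_mean_add_measureReal_zero hint
  -- A number `r` strictly between the threshold and the lower limit makes the ratio hypothesis hold
  -- for all large `L` and leaves room to choose `c`.
  obtain ⟨r, hr1, hr2⟩ := ENNReal.lt_iff_exists_nnreal_btwn.1 hratio
  rw [← ENNReal.ofReal_coe_nnreal, ENNReal.ofReal_lt_ofReal_iff_of_nonneg
    (div_nonneg (hν₀ ▸ measureReal_nonneg) (by linarith)), div_lt_iff₀ (by linarith)] at hr1
  have hr0 : (0 : ℝ) < r := by
    have : 0 ≤ ν₀ := hν₀ ▸ measureReal_nonneg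
    exact (pos_iff_pos_of_mul_pos (this.trans_lt hr1)).2 (by linarith)
  have hreach := ARW.ae_exists_reach (lam := lam) hconn hdeg hint hr0 (by rwa [← hμ, ← hν₀]) (by
    filter_upwards [eventually_lt_of_lt_liminf hr2] with L hL
    set m := ∑ y ∈ ARW.ball G hconn o L, ARW.hitProb G lam o L (G.dist o y) y
    have h := (ENNReal.mul_le_of_le_div hL.le)
    rw [← ENNReal.ofReal_coe_nnreal, ← ENNReal.ofReal_mul r.coe_nonneg] at h
    exact (ENNReal.ofReal_le_ofReal_iff
      (Finset.sum_nonneg fun y _ => ARW.hitProb_nonneg _ _ y)).1 h)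
    (ENNReal.tendsto_ofReal_nhds_top.1 hlim)
  have hreg := ARW.ae_regular (lam := lam) (ν := ν) hdeg
  filter_upwards [hreg, ARW.ae_nonExplosive hreg hd hν, ARW.ae_usedAt_bounded hreg hd hd0 hν, hreach]
    with ω h1 h2 h3 h4
  -- Many active particles at `o` simultaneously become many topplings at `o`, since each toppling
  -- there removes at most one of them.
  refine ARW.isActive_of_reach h1 h2 h3 o fun N => ?_
  obtain ⟨S, cfg, u, hr, hN⟩ := h4 N
  obtain ⟨cfg', u', hr', hu⟩ := hr.exists_used_ge N hN
  exact ⟨S, cfg', u', hr', (Nat.le_add_left _ _).trans hu⟩
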